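/- For $a\in[-1,0)$ and $x=(x_1,x_2)\in\mathbb R^2$ let $\mathbf A_0(x)=(-x_2,0)$, $\sigma(x)=1$ if $x_2>0$ and $\sigma(x)=a$ if $x_2<0$. Let $\mathcal L_a=-(\nabla-i\sigma\mathbf A_0)^2$ be the self-adjoint magnetic Hamiltonian in $L^2(\mathbb R^2)$ and $\beta_a=\inf\mathrm{sp}(\mathcal L_a)$. For $R>0$ let $S_R=(-R/2,R/2)\times\mathbb R$, $$\mathcal D_R=\Big\{u\in L^2(S_R):\ (\nabla-i\sigma\mathbf A_0)u\in L^2(S_R),\ u\big(x_1=\pm\tfrac R2,\cdot\big)=0\Big\}$$ (weak derivatives, boundary values in the sense of $H^1_0$), and for $b>0$ and $u\in\mathcal D_R$ $$\mathcal G_{a,b,R}(u)=\int_{S_R}\Big(b\,|(\nabla-i\sigma\mathbf A_0)u|^2-|u|^2+\tfrac12|u|^4\Big)\,dx,\qquad \mathfrak g_a(b,R)=\inf_{u\in\mathcal D_R}\mathcal G_{a,b,R}(u).$$ There exists a universal constant $C>0$ (independent of $a$, $b$ and $R$) such that, for all $a\in[-1,0)$, all $b$ with $\frac1{|a|}\le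 b<\frac1{\beta_a}$ and all $R>0$, the functional $\mathcal G_{a,b,R}$ has a minimizer: there is $\varphi\in\mathcal D_R$ with $$\mathcal G_{a,b,R}(\varphi)=\mathfrak g_a(b,R)\quad\text{and}\quad\|\varphi\|_{L^\infty(S_R)}\le 1,$$ which moreover satisfies $$\int_{S_R\cap\{|x_2|\ge4\}}\frac{|x_2|}{(\ln|x_2|)^2}\Big(|(\nabla-i\sigma\mathbf A_0)\varphi|^2+|\varphi|^2\Big)\,dx\le CbR,$$ $$\int_{S_R\cap\{|x_2|\ge4\}}\frac{|x_2|^3}{(\ln|x_2|)^2}|\varphi|^4\,dx\le Cb^2R,$$ $$\int_{S_R}\Big(b\,|(\nabla-i\sigma\mathbf A_0)\varphi|^2+|\varphi|^2\Big)\,dx\le CbR.$$ -/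

import Mathlib

open MeasureTheory Set Filter Topology
open scoped ContDiff ENNReal

noncomputable section

namespace MagneticStep

/-- The step function `σ`, equal to `1` on the upper half plane and to `a` on the lower one
(its value on the null set `x₂ = 0` is irrelevant). -/
def sigma (a : ℝ) (x : ℝ × ℝ) : ℝ := if 0 < x.2 then 1 else a

/-- The magnetic potential `A₀(x) = (-x₂, 0)`. -/
def A0 (x : ℝ × ℝ) : Fin 2 → ℝ := ![-x.2, 0]

/-- The standard basis of `ℝ²`. -/
def e : Fin 2 → ℝ × ℝ := ![(1, 0), (0, 1)]

/-- The strip `S_R = (-R/2, R/2) × ℝ`. -/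
def strip (R : ℝ) : Set (ℝ × ℝ) := Ioo (-R / 2) (R / 2) ×ˢ univ

/-- `ψ ∈ C_c^∞(U; F)`. -/
structure IsTest {F : Type*} [NormedAddCommGroup F] [NormedSpace ℝ F]
    (U : Set (ℝ × ℝ)) (ψ : ℝ × ℝ → F) : Prop where
  smooth : ContDiff ℝ ∞ ψ
  compact : HasCompactSupport ψ
  supp : tsupport ψ ⊆ U

/-- `w` is the weak partial derivative `∂_j u` in the open set `U`. -/
structure HasWeakPartial (U : Set (ℝ × ℝ)) (j : Fin 2) (u w : ℝ × ℝ → ℂ) : Prop where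
  locInt : LocallyIntegrableOn u U
  locInt_deriv : LocallyIntegrableOn w U
  byParts : ∀ ψ : ℝ × ℝ → ℝ, IsTest U ψ →
    ∫ x in U, (fderiv ℝ ψ x (e j) : ℂ) * u x = -∫ x in U, (ψ x : ℂ) * w x

open Classical in
/-- The weak partial derivative `∂_j u` in `U` (unique up to null sets); `0` if there is none. -/
def weakPartial (U : Set (ℝ × ℝ)) (j : Fin 2) (u : ℝ × ℝ → ℂ) : ℝ × ℝ → ℂ :=
  if h : ∃ w, HasWeakPartial U j u w then h.choose else 0

/-- The `j`-th component of `(∇ - iσA₀)u` in `U`, in the weak sense. -/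
def covDeriv (a : ℝ) (U : Set (ℝ × ℝ)) (j : Fin 2) (u : ℝ × ℝ → ℂ) (x : ℝ × ℝ) : ℂ :=
  weakPartial U j u x - Complex.I * (sigma a x * A0 x j : ℝ) * u x

/-- The `j`-th component of `(∇ - iσA₀)ψ` for a smooth function `ψ`. -/
def covDerivSmooth (a : ℝ) (j : Fin 2) (ψ : ℝ × ℝ → ℂ) (x : ℝ × ℝ) : ℂ :=
  fderiv ℝ ψ x (e j) - Complex.I * (sigma a x * A0 x j : ℝ) * ψ x

/-- `|(∇ - iσA₀)u|²`. -/
def covGradSq (a : ℝ) (U : Set (ℝ × ℝ)) (u : ℝ × ℝ → ℂ) (x : ℝ × ℝ) : ℝ :=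
  ∑ j, ‖covDeriv a U j u x‖ ^ 2

/-- `u ∈ L²(U)` and `(∇ - iσA₀)u ∈ L²(U)`. -/
structure MemMagSobolev (a : ℝ) (U : Set (ℝ × ℝ)) (u : ℝ × ℝ → ℂ) : Prop where
  memLp : MemLp u 2 (volume.restrict U)
  weakDiff : ∀ j, ∃ w, HasWeakPartial U j u w
  memLp_covDeriv : ∀ j, MemLp (covDeriv a U j u) 2 (volume.restrict U)

/-- `u` vanishes on `∂U` in the Sobolev (`H¹₀`) sense: it is a limit of functions of
`C_c^∞(U)` in the norm `(‖u‖²_{L²} + ‖(∇ - iσA₀)u‖²_{L²})^{1/2}`. -/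
def VanishesOnBoundary (a : ℝ) (U : Set (ℝ × ℝ)) (u : ℝ × ℝ → ℂ) : Prop :=
  ∃ ψ : ℕ → ℝ × ℝ → ℂ, (∀ n, IsTest U (ψ n)) ∧
    Tendsto (fun n => eLpNorm (fun x => ψ n x - u x) 2 (volume.restrict U)) atTop (𝓝 0) ∧
    ∀ j, Tendsto (fun n => eLpNorm (fun x => covDerivSmooth a j (ψ n) x - covDeriv a U j u x) 2
      (volume.restrict U)) atTop (𝓝 0)

/-- The space `𝓓_R`. Functions are considered on `S_R` only; their values elsewhere are
immaterial. -/
def domainD (a R : ℝ) : Set (ℝ × ℝ → ℂ) :=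
  {u | MemMagSobolev a (strip R) u ∧ VanishesOnBoundary a (strip R) u}

/-- The reduced Ginzburg–Landau functional `𝓖_{a,b,R}`. -/
def energyG (a b R : ℝ) (u : ℝ × ℝ → ℂ) : ℝ :=
  ∫ x in strip R, (b * covGradSq a (strip R) u x - ‖u x‖ ^ 2 + 1 / 2 * ‖u x‖ ^ 4)

/-- The ground state energy `𝔤_a(b, R)`. -/
def groundEnergy (a b R : ℝ) : ℝ := sInf (energyG a b R '' domainD a R)

/-- `L²(ℝ²; ℂ)`. -/
abbrev L2 : Type := Lp ℂ 2 (volume : Measure (ℝ × ℝ))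

/-- The graph of the self-adjoint magnetic Hamiltonian `𝓛_a = -(∇ - iσA₀)²` in `L²(ℝ²)`:
`u ∈ dom 𝓛_a` and `𝓛_a u = f`. It is the operator associated with the closed quadratic form
`∫ |(∇ - iσA₀)u|²` on `{u ∈ L² : (∇ - iσA₀)u ∈ L²}`, of which `C_c^∞(ℝ²)` is a core. -/
def HamiltonianGraph (a : ℝ) (u f : L2) : Prop :=
  MemMagSobolev a univ u ∧
    ∀ ψ : ℝ × ℝ → ℂ, IsTest univ ψ →
      ∑ j, ∫ x, covDeriv a univ j u x * star (covDerivSmooth a j ψ x) = ∫ x, f x * star (ψ x)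

/-- The resolvent set of `𝓛_a`: `𝓛_a - z` is a bijection from `dom 𝓛_a` onto `L²(ℝ²)` with
bounded inverse. -/
def resolventSetL (a : ℝ) : Set ℂ :=
  {z | (∀ g : L2, ∃! u : L2, HamiltonianGraph a u (g + z • u)) ∧
    ∃ C : ℝ, ∀ u f : L2, HamiltonianGraph a u f → ‖u‖ ≤ C * ‖f - z • u‖}

/-- `β_a = inf sp(𝓛_a)`, the spectrum being a subset of `ℝ`. -/
def beta (a : ℝ) : ℝ := sInf {t : ℝ | (t : ℂ) ∉ resolventSetL a}

end MagneticStep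

end

noncomputable section

namespace MagneticStep

/-! The obstacle to existence is the unbounded strip: mass could escape as `|x₂| → ∞`, and on all of
`S_R` it is not even clear that the energy is bounded below. Both problems are settled by decay
estimates in `x₂` whose constants are universal, and these are proved for approximate minimizers
instead of solutions of the Euler–Lagrange equation, so no regularity theory is needed.

Approximants. Among smooth functions compactly supported in the strip and vanishing for `|x₂| > m`,
the energy is bounded below because the region has finite area. A smooth truncation that increases
the energy arbitrarily little gives near-minimizers `ψ` with `|ψ| ≤ 1` (`exists_boxTest_near_min`).
Comparing `ψ` with `(1 - tη(x₂))ψ` for small `t` shows that the first variation in the direction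
`ηψ` is almost nonpositive (`exists_near_min_firstVar_le`).

Decay. On either side of the line `x₂ = 0` the field is constant, `1` or `a`, so a function `χψ`
living on one side has magnetic energy at least `|a| ∫ |χψ|²` (`abs_mul_integral_wmul_le`). As `b|a|
≥ 1`, testing with `χ²` makes the kinetic term absorb the negative quadratic term, and what remains
is `∫ χ²|ψ|⁴ ≤ b ∫ χ'²|ψ|² + δ`. For `χ² = |t|³/(ln|t|)²` one has `χ'² ≲ |t|/(ln|t|)²`; Young's
inequality absorbs the right side up to `b² ∫ dt/(t ln² t)` per unit length, which is finite
precisely because of the logarithm. The same Young inequality gives the bound on `|ψ|²` with weight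
`|t|/(ln|t|)²`, a second variation gives the one on the gradient, and `|ψ| ≤ 1` controls the region
`|x₂| ≤ 4` (`exists_apriori_const`).

Compactness. The weighted bound makes the tails uniformly small, and a Poincaré inequality on small
cells gives an `L²`-Cauchy subsequence (`exists_subseq_cauchy`). The energy is convex up to a
multiple of `‖f - g‖²_{L²}` (`IsTest.energyS_midpoint_le`), so a minimizing sequence that is Cauchy
in `L²` is also Cauchy in the magnetic Sobolev norm. Its limit lies in `𝓓_R`. A Ladyzhenskaya
inequality makes the quartic term continuous in that norm, so the infimum over test functions equals
the infimum over `𝓓_R` and is attained (`exists_minimizer_of_cauchy`). Fatou's lemma transfers the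
bounds to the minimizer. -/

variable {U : Set (ℝ × ℝ)} {ψ : ℝ × ℝ → ℂ}

/-! ### The potential, test functions, and multiplication by functions of `x₂` -/

/-- The product `σ(x) x₂` as a function of `t = x₂`. -/
def kap (a t : ℝ) : ℝ := max t 0 + a * min t 0

theorem continuous_kap (a : ℝ) : Continuous (kap a) := by
  unfold kap; fun_prop

theorem kap_of_nonneg (a : ℝ) {t : ℝ} (ht : 0 ≤ t) : kap a t = t := by
  simp [kap, ht]

theorem kap_of_nonpos (a : ℝ) {t : ℝ} (ht : t ≤ 0) : kap a t = a * t := by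
  simp [kap, ht]

/-- The jump of `σ` lies where the potential vanishes, so `σA₀` is continuous and covariant
derivatives of test functions are continuous everywhere. -/
theorem sigma_mul_snd (a : ℝ) (x : ℝ × ℝ) : sigma a x * x.2 = kap a x.2 := by
  unfold sigma
  split_ifs with h
  · rw [kap_of_nonneg a h.le, one_mul]
  · rw [kap_of_nonpos a (not_lt.1 h)]

theorem abs_kap_le {a : ℝ} (ha : -1 ≤ a) (ha' : a < 0) (t : ℝ) : |kap a t| ≤ |t| := by
  rcases le_total 0 t with h | h
  · rw [kap_of_nonneg a h]
  · rw [kap_of_nonpos a h, abs_mul]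
    have : |a| ≤ 1 := abs_le.2 ⟨ha, by linarith⟩
    nlinarith [abs_nonneg t]

/-- The `j`-th component of `σA₀` as a function of `x`. -/
theorem sigma_mul_A0_zero (a : ℝ) (x : ℝ × ℝ) : sigma a x * A0 x 0 = -kap a x.2 := by
  rw [← sigma_mul_snd]; simp [A0]

theorem sigma_mul_A0_one (a : ℝ) (x : ℝ × ℝ) : sigma a x * A0 x 1 = 0 := by
  simp [A0]

theorem continuous_sigma_mul_A0 (a : ℝ) (j : Fin 2) :
    Continuous fun x : ℝ × ℝ => sigma a x * A0 x j := by
  fin_cases j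
  · simp only [Fin.zero_eta, sigma_mul_A0_zero]
    exact ((continuous_kap a).comp continuous_snd).neg
  · simp only [Fin.mk_one, sigma_mul_A0_one]
    exact continuous_const

theorem covDerivSmooth_zero (a : ℝ) (ψ : ℝ × ℝ → ℂ) (x : ℝ × ℝ) :
    covDerivSmooth a 0 ψ x = fderiv ℝ ψ x (1, 0) + Complex.I * (kap a x.2 : ℝ) * ψ x := by
  simp [covDerivSmooth, sigma_mul_A0_zero, e]

theorem covDerivSmooth_one (a : ℝ) (ψ : ℝ × ℝ → ℂ) (x : ℝ × ℝ) :
    covDerivSmooth a 1 ψ x = fderiv ℝ ψ x (0, 1) := by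
  simp [covDerivSmooth, sigma_mul_A0_one, e]

/-- `|(∇ - iσA₀)ψ|²` for smooth `ψ`. -/
def gradSq (a : ℝ) (ψ : ℝ × ℝ → ℂ) (x : ℝ × ℝ) : ℝ := ∑ j, ‖covDerivSmooth a j ψ x‖ ^ 2

theorem gradSq_eq (a : ℝ) (ψ : ℝ × ℝ → ℂ) (x : ℝ × ℝ) :
    gradSq a ψ x = ‖covDerivSmooth a 0 ψ x‖ ^ 2 + ‖covDerivSmooth a 1 ψ x‖ ^ 2 := by
  simp [gradSq, Fin.sum_univ_two]

theorem gradSq_nonneg (a : ℝ) (ψ : ℝ × ℝ → ℂ) (x : ℝ × ℝ) : 0 ≤ gradSq a ψ x :=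
  Finset.sum_nonneg fun _ _ => by positivity


theorem IsTest.continuous {F : Type*} [NormedAddCommGroup F] [NormedSpace ℝ F]
    {ψ : ℝ × ℝ → F} (h : IsTest U ψ) : Continuous ψ := h.smooth.continuous

theorem IsTest.differentiable {F : Type*} [NormedAddCommGroup F] [NormedSpace ℝ F]
    {ψ : ℝ × ℝ → F} (h : IsTest U ψ) : Differentiable ℝ ψ := h.smooth.differentiable (by simp)

theorem IsTest.contDiff_fderiv_apply {F : Type*} [NormedAddCommGroup F] [NormedSpace ℝ F]
    {ψ : ℝ × ℝ → F} (h : IsTest U ψ) (v : ℝ × ℝ) :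
    ContDiff ℝ ∞ fun x => fderiv ℝ ψ x v :=
  (h.smooth.fderiv_right (m := ∞) (by simp)).clm_apply contDiff_const

theorem IsTest.continuous_fderiv_apply {F : Type*} [NormedAddCommGroup F] [NormedSpace ℝ F]
    {ψ : ℝ × ℝ → F} (h : IsTest U ψ) (v : ℝ × ℝ) :
    Continuous fun x => fderiv ℝ ψ x v := (h.contDiff_fderiv_apply v).continuous

theorem fderiv_eq_zero_of_notMem_tsupport {F : Type*} [NormedAddCommGroup F] [NormedSpace ℝ F]
    {ψ : ℝ × ℝ → F} {x : ℝ × ℝ} (hx : x ∉ tsupport ψ) : fderiv ℝ ψ x = 0 := by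
  by_contra h
  exact hx (support_fderiv_subset ℝ h)

theorem covDerivSmooth_eq_zero {a : ℝ} {j : Fin 2} {x : ℝ × ℝ} (hx : x ∉ tsupport ψ) :
    covDerivSmooth a j ψ x = 0 := by
  simp [covDerivSmooth, fderiv_eq_zero_of_notMem_tsupport hx, image_eq_zero_of_notMem_tsupport hx]

theorem gradSq_eq_zero {a : ℝ} {x : ℝ × ℝ} (hx : x ∉ tsupport ψ) : gradSq a ψ x = 0 := by
  simp [gradSq, covDerivSmooth_eq_zero hx]

theorem IsTest.continuous_covDerivSmooth (h : IsTest U ψ) (a : ℝ) (j : Fin 2) :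
    Continuous (covDerivSmooth a j ψ) := by
  unfold covDerivSmooth
  have := continuous_sigma_mul_A0 a j
  have := h.continuous
  have := h.continuous_fderiv_apply (e j)
  fun_prop

theorem IsTest.continuous_gradSq (h : IsTest U ψ) (a : ℝ) : Continuous (gradSq a ψ) := by
  unfold gradSq
  exact continuous_finsetSum _ fun j _ => (h.continuous_covDerivSmooth a j).norm.pow 2

/-- A continuous function which vanishes off the support of a test function is integrable. -/
theorem IsTest.integrable {F G : Type*} [NormedAddCommGroup F] [NormedSpace ℝ F]
    [NormedAddCommGroup G] {ψ : ℝ × ℝ → F}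
    (h : IsTest U ψ) {f : ℝ × ℝ → G} (hf : Continuous f)
    (h0 : ∀ x, x ∉ tsupport ψ → f x = 0) : Integrable f :=
  hf.integrable_of_hasCompactSupport (HasCompactSupport.intro h.compact h0)

theorem IsTest.integrable_normSq (h : IsTest U ψ) : Integrable fun x => ‖ψ x‖ ^ 2 :=
  h.integrable (h.continuous.norm.pow 2) fun x hx => by
    simp [image_eq_zero_of_notMem_tsupport hx]

theorem IsTest.integrable_norm_pow_four (h : IsTest U ψ) : Integrable fun x => ‖ψ x‖ ^ 4 :=
  h.integrable (h.continuous.norm.pow 4) fun x hx => by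
    simp [image_eq_zero_of_notMem_tsupport hx]

theorem IsTest.integrable_gradSq (h : IsTest U ψ) (a : ℝ) : Integrable (gradSq a ψ) :=
  h.integrable (h.continuous_gradSq a) fun _ hx => gradSq_eq_zero hx

/-- A weight depending on `x₂` may be inserted in front of an integrand supported in `supp ψ`. -/
theorem IsTest.integrable_weight_mul (h : IsTest U ψ) {w : ℝ → ℝ} (hw : Continuous w)
    {f : ℝ × ℝ → ℝ} (hf : Continuous f) (h0 : ∀ x, x ∉ tsupport ψ → f x = 0) :
    Integrable fun x : ℝ × ℝ => w x.2 * f x :=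
  h.integrable ((hw.comp continuous_snd).mul hf) fun x hx => by simp [h0 x hx]

/-- `Re (conj ψ ∂₂ψ)`. -/
def crossRe (ψ : ℝ × ℝ → ℂ) (x : ℝ × ℝ) : ℝ :=
  (ψ x).re * (fderiv ℝ ψ x (0, 1)).re + (ψ x).im * (fderiv ℝ ψ x (0, 1)).im

theorem IsTest.continuous_crossRe (h : IsTest U ψ) : Continuous (crossRe ψ) := by
  unfold crossRe
  have := h.continuous
  have := h.continuous_fderiv_apply (0, 1)
  fun_prop

theorem crossRe_eq_zero {x : ℝ × ℝ} (hx : x ∉ tsupport ψ) : crossRe ψ x = 0 := by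
  simp [crossRe, image_eq_zero_of_notMem_tsupport hx]

theorem sq_norm_eq (z : ℂ) : ‖z‖ ^ 2 = z.re ^ 2 + z.im ^ 2 := by
  rw [Complex.sq_norm, Complex.normSq_apply]; ring

theorem norm_pow_four_eq (z : ℂ) : ‖z‖ ^ 4 = (‖z‖ ^ 2) ^ 2 := by ring

theorem crossRe_sq_le (a : ℝ) (ψ : ℝ × ℝ → ℂ) (x : ℝ × ℝ) :
    crossRe ψ x ^ 2 ≤ ‖ψ x‖ ^ 2 * gradSq a ψ x := by
  have h1 : crossRe ψ x ^ 2 ≤ ‖ψ x‖ ^ 2 * ‖covDerivSmooth a 1 ψ x‖ ^ 2 := by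
    rw [covDerivSmooth_one, sq_norm_eq, sq_norm_eq, crossRe]
    nlinarith [sq_nonneg ((ψ x).re * (fderiv ℝ ψ x (0, 1)).im
      - (ψ x).im * (fderiv ℝ ψ x (0, 1)).re)]
  refine h1.trans (mul_le_mul_of_nonneg_left ?_ (by positivity))
  rw [gradSq_eq]
  nlinarith [sq_nonneg ‖covDerivSmooth a 0 ψ x‖]

/-- Multiplication of `ψ` by a real function of `x₂`. -/
def wmul (χ : ℝ → ℝ) (ψ : ℝ × ℝ → ℂ) (x : ℝ × ℝ) : ℂ := (χ x.2 : ℂ) * ψ x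

theorem tsupport_wmul_subset (χ : ℝ → ℝ) (ψ : ℝ × ℝ → ℂ) : tsupport (wmul χ ψ) ⊆ tsupport ψ :=
  closure_mono fun x hx => by
    simp only [Function.mem_support, wmul] at hx ⊢
    exact right_ne_zero_of_mul hx

theorem IsTest.wmul (h : IsTest U ψ) {χ : ℝ → ℝ} (hχ : ContDiff ℝ ∞ χ) :
    IsTest U (wmul χ ψ) where
  smooth := by
    unfold MagneticStep.wmul
    exact (Complex.ofRealCLM.contDiff.comp (hχ.comp contDiff_snd)).mul h.smooth
  compact := h.compact.mono' ((subset_tsupport _).trans (tsupport_wmul_subset χ ψ))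
  supp := (tsupport_wmul_subset χ ψ).trans h.supp

theorem IsTest.fderiv_wmul (h : IsTest U ψ) {χ : ℝ → ℝ} (hχ : ContDiff ℝ ∞ χ) (x v : ℝ × ℝ) :
    fderiv ℝ (MagneticStep.wmul χ ψ) x v
      = (χ x.2 : ℂ) * fderiv ℝ ψ x v + ((deriv χ x.2 * v.2 : ℝ) : ℂ) * ψ x := by
  have h1 : HasFDerivAt (fun x : ℝ × ℝ => χ x.2)
      (deriv χ x.2 • ContinuousLinearMap.snd ℝ ℝ ℝ) x :=
    ((hχ.differentiable (by simp)).differentiableAt.hasDerivAt).comp_hasFDerivAt x hasFDerivAt_snd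
  have h2 := Complex.ofRealCLM.hasFDerivAt.comp x h1
  have h3 := h2.mul (h.differentiable x).hasFDerivAt
  have h4 : fderiv ℝ (MagneticStep.wmul χ ψ) x = _ := h3.fderiv
  rw [h4]
  simp
  ring

theorem IsTest.covDerivSmooth_wmul_zero (h : IsTest U ψ) {χ : ℝ → ℝ} (hχ : ContDiff ℝ ∞ χ)
    (a : ℝ) (x : ℝ × ℝ) :
    covDerivSmooth a 0 (MagneticStep.wmul χ ψ) x = (χ x.2 : ℂ) * covDerivSmooth a 0 ψ x := by
  rw [covDerivSmooth_zero, covDerivSmooth_zero, h.fderiv_wmul hχ]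
  simp [MagneticStep.wmul]
  ring

theorem IsTest.covDerivSmooth_wmul_one (h : IsTest U ψ) {χ : ℝ → ℝ} (hχ : ContDiff ℝ ∞ χ)
    (a : ℝ) (x : ℝ × ℝ) :
    covDerivSmooth a 1 (MagneticStep.wmul χ ψ) x
      = (χ x.2 : ℂ) * covDerivSmooth a 1 ψ x + ((deriv χ x.2 : ℝ) : ℂ) * ψ x := by
  rw [covDerivSmooth_one, covDerivSmooth_one, h.fderiv_wmul hχ]
  simp

/-- The weight depends on `x₂` alone and the potential has no `x₂` component, so the cross term `Re
(conj ψ ∂₂ψ)` is free of the potential. -/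
theorem IsTest.gradSq_wmul (h : IsTest U ψ) {χ : ℝ → ℝ} (hχ : ContDiff ℝ ∞ χ)
    (a : ℝ) (x : ℝ × ℝ) :
    gradSq a (MagneticStep.wmul χ ψ) x = χ x.2 ^ 2 * gradSq a ψ x
      + 2 * χ x.2 * deriv χ x.2 * crossRe ψ x + deriv χ x.2 ^ 2 * ‖ψ x‖ ^ 2 := by
  rw [gradSq_eq, gradSq_eq, h.covDerivSmooth_wmul_zero hχ, h.covDerivSmooth_wmul_one hχ,
    covDerivSmooth_one, norm_mul, mul_pow, crossRe]
  simp only [sq_norm_eq, Complex.add_re, Complex.add_im, Complex.re_ofReal_mul,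
    Complex.im_ofReal_mul, Complex.ofReal_re, Complex.ofReal_im]
  ring

theorem norm_wmul (χ : ℝ → ℝ) (ψ : ℝ × ℝ → ℂ) (x : ℝ × ℝ) :
    ‖wmul χ ψ x‖ = |χ x.2| * ‖ψ x‖ := by
  simp [wmul]

/-! ### The lower bound for a constant magnetic field -/

/-- The Jacobian determinant of a compactly supported map `(p, q)` integrates to zero: move one
derivative off `p` and use the symmetry of the second derivative of `q`. -/
theorem integral_fderiv_mul_fderiv_comm {p q : ℝ × ℝ → ℝ} (hp : IsTest U p) (hq : IsTest U q) :
    ∫ x, fderiv ℝ p x (1, 0) * fderiv ℝ q x (0, 1)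
      = ∫ x, fderiv ℝ p x (0, 1) * fderiv ℝ q x (1, 0) := by
  have key : ∀ v w : ℝ × ℝ, ∫ x, fderiv ℝ p x v * fderiv ℝ q x w
      = -∫ x, p x * fderiv ℝ (fun y => fderiv ℝ q y w) x v := by
    intro v w
    have hs := hq.contDiff_fderiv_apply w
    have hs' : Continuous fun x => fderiv ℝ (fun y => fderiv ℝ q y w) x v :=
      (hs.continuous_fderiv (by simp)).clm_apply continuous_const
    rw [integral_mul_fderiv_eq_neg_fderiv_mul_of_integrable (μ := volume) (f := p)
      (g := fun y => fderiv ℝ q y w) (v := v), neg_neg]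
    · refine hp.integrable ((hp.continuous_fderiv_apply v).mul hs.continuous) fun x hx => ?_
      simp [fderiv_eq_zero_of_notMem_tsupport hx]
    · refine hp.integrable (hp.continuous.mul hs') fun x hx => ?_
      simp [image_eq_zero_of_notMem_tsupport hx]
    · refine hp.integrable (hp.continuous.mul hs.continuous) fun x hx => ?_
      simp [image_eq_zero_of_notMem_tsupport hx]
    · exact fun x _ => hp.differentiable x
    · exact fun x _ => (hs.differentiable (by simp)) x
  rw [key, key]
  congr 1
  refine integral_congr_ae (ae_of_all _ fun x => ?_)
  simp only
  congr 1
  have hd : DifferentiableAt ℝ (fderiv ℝ q) x :=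
    ((hq.smooth.fderiv_right (m := ∞) (by simp)).differentiable (by simp)) x
  have hsym : IsSymmSndFDerivAt ℝ q x :=
    hq.smooth.contDiffAt.isSymmSndFDerivAt (by simp; exact WithTop.coe_le_coe.2 le_top)
  have hcalc : ∀ v w : ℝ × ℝ, fderiv ℝ (fun y => fderiv ℝ q y w) x v
      = fderiv ℝ (fderiv ℝ q) x v w := by
    intro v w
    rw [fderiv_clm_apply hd (differentiableAt_const w)]
    simp
  rw [hcalc, hcalc]
  exact hsym _ _

theorem integral_snd_mul_fderiv {g : ℝ × ℝ → ℝ} (hg : IsTest U g) :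
    ∫ x : ℝ × ℝ, x.2 * fderiv ℝ g x (0, 1) = -∫ x, g x := by
  have hsnd : ∀ x, fderiv ℝ (fun x : ℝ × ℝ => x.2) x = ContinuousLinearMap.snd ℝ ℝ ℝ :=
    fun _ => fderiv_snd
  rw [integral_mul_fderiv_eq_neg_fderiv_mul_of_integrable (μ := volume)
    (f := fun x : ℝ × ℝ => x.2) (g := g) (v := (0, 1))]
  · simp [hsnd]
  · refine hg.integrable (by simpa [hsnd] using hg.continuous) fun x hx => ?_
    simp [image_eq_zero_of_notMem_tsupport hx]
  · refine hg.integrable (continuous_snd.mul (hg.continuous_fderiv_apply _)) fun x hx => ?_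
    simp [fderiv_eq_zero_of_notMem_tsupport hx]
  · refine hg.integrable (continuous_snd.mul hg.continuous) fun x hx => ?_
    simp [image_eq_zero_of_notMem_tsupport hx]
  · exact fun x _ => differentiableAt_snd
  · exact fun x _ => hg.differentiable x

theorem IsTest.re (h : IsTest U ψ) : IsTest U fun x => (ψ x).re where
  smooth := Complex.reCLM.contDiff.comp h.smooth
  compact := h.compact.comp_left (g := Complex.re) rfl
  supp := (closure_mono fun x hx => by
    simp only [Function.mem_support] at hx ⊢
    exact fun h0 => hx (by simp [h0])).trans h.supp

theorem IsTest.im (h : IsTest U ψ) : IsTest U fun x => (ψ x).im where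
  smooth := Complex.imCLM.contDiff.comp h.smooth
  compact := h.compact.comp_left (g := Complex.im) rfl
  supp := (closure_mono fun x hx => by
    simp only [Function.mem_support] at hx ⊢
    exact fun h0 => hx (by simp [h0])).trans h.supp

theorem IsTest.fderiv_re (h : IsTest U ψ) (x v : ℝ × ℝ) :
    fderiv ℝ (fun x => (ψ x).re) x v = (fderiv ℝ ψ x v).re := by
  have := (Complex.reCLM.hasFDerivAt.comp x (h.differentiable x).hasFDerivAt).fderiv
  change fderiv ℝ (Complex.reCLM ∘ ψ) x v = _
  rw [this]; simp

theorem IsTest.fderiv_im (h : IsTest U ψ) (x v : ℝ × ℝ) :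
    fderiv ℝ (fun x => (ψ x).im) x v = (fderiv ℝ ψ x v).im := by
  have := (Complex.imCLM.hasFDerivAt.comp x (h.differentiable x).hasFDerivAt).fderiv
  change fderiv ℝ (Complex.imCLM ∘ ψ) x v = _
  rw [this]; simp

theorem IsTest.normSq (h : IsTest U ψ) : IsTest U fun x => ‖ψ x‖ ^ 2 where
  smooth := h.smooth.norm_sq ℝ
  compact := h.compact.comp_left (g := fun z : ℂ => ‖z‖ ^ 2) (by simp)
  supp := (closure_mono fun x hx => by
    simp only [Function.mem_support] at hx ⊢
    exact fun h0 => hx (by simp [h0])).trans h.supp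

theorem IsTest.fderiv_normSq (h : IsTest U ψ) (x v : ℝ × ℝ) :
    fderiv ℝ (fun x => ‖ψ x‖ ^ 2) x v
      = 2 * ((ψ x).re * (fderiv ℝ ψ x v).re + (ψ x).im * (fderiv ℝ ψ x v).im) := by
  have h1 := (h.re.differentiable x).hasFDerivAt
  have h2 := (h.im.differentiable x).hasFDerivAt
  have h3 := ((h1.pow 2).add (h2.pow 2)).fderiv
  have h4 : (fun x => ‖ψ x‖ ^ 2) = (fun x => (ψ x).re ^ 2) + fun x => (ψ x).im ^ 2 := by
    ext x; simp [sq_norm_eq]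
  rw [h4, h3]
  simp [h.fderiv_re, h.fderiv_im]
  ring

/-- The bottom of the spectrum of the Hamiltonian with constant magnetic field `c` is at
least `|c|`. -/
theorem abs_mul_integral_le_of_constant_field (h : IsTest U ψ) (c : ℝ) :
    |c| * ∫ x, ‖ψ x‖ ^ 2 ≤ ∫ x, (‖fderiv ℝ ψ x (1, 0) + Complex.I * (c * x.2 : ℝ) * ψ x‖ ^ 2
      + ‖fderiv ℝ ψ x (0, 1)‖ ^ 2) := by
  set F : ℝ × ℝ → ℝ := fun x => ‖fderiv ℝ ψ x (1, 0) + Complex.I * (c * x.2 : ℝ) * ψ x‖ ^ 2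
      + ‖fderiv ℝ ψ x (0, 1)‖ ^ 2 with hF
  have hc1 := h.continuous_fderiv_apply (1, 0)
  have hc2 := h.continuous_fderiv_apply (0, 1)
  have hc := h.continuous
  have iF : Integrable F := h.integrable (by rw [hF]; fun_prop) fun x hx => by
    simp [hF, fderiv_eq_zero_of_notMem_tsupport hx, image_eq_zero_of_notMem_tsupport hx]
  set P : ℝ × ℝ → ℝ := fun x => fderiv ℝ (fun x => (ψ x).re) x (1, 0)
    * fderiv ℝ (fun x => (ψ x).im) x (0, 1) with hP
  set Q : ℝ × ℝ → ℝ := fun x => fderiv ℝ (fun x => (ψ x).re) x (0, 1)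
    * fderiv ℝ (fun x => (ψ x).im) x (1, 0) with hQ
  set S : ℝ × ℝ → ℝ := fun x => x.2 * fderiv ℝ (fun x => ‖ψ x‖ ^ 2) x (0, 1) with hS
  have iP : Integrable P := h.re.integrable
    ((h.re.continuous_fderiv_apply _).mul (h.im.continuous_fderiv_apply _)) fun x hx => by
    simp [hP, fderiv_eq_zero_of_notMem_tsupport hx]
  have iQ : Integrable Q := h.re.integrable
    ((h.re.continuous_fderiv_apply _).mul (h.im.continuous_fderiv_apply _)) fun x hx => by
    simp [hQ, fderiv_eq_zero_of_notMem_tsupport hx]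
  have iS : Integrable S := h.normSq.integrable
    (continuous_snd.mul (h.normSq.continuous_fderiv_apply _)) fun x hx => by
    simp [hS, fderiv_eq_zero_of_notMem_tsupport hx]
  have hPQ : ∫ x, P x = ∫ x, Q x := integral_fderiv_mul_fderiv_comm h.re h.im
  have hSg : ∫ x, S x = -∫ x, ‖ψ x‖ ^ 2 := integral_snd_mul_fderiv h.normSq
  -- Factorization by creation and annihilation operators: the nonnegative quantity is `|D₁ψ - i s
  -- ∂₂ψ|²` with `D₁ = ∂₁ + i c x₂`. After integration its Jacobian part vanishes and `x₂ ∂₂|ψ|²`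
  -- produces the commutator term `s c ∫ |ψ|²`. The sign `s` is finally chosen opposite to that of
  -- `c`.
  have key : ∀ s : ℝ, s ^ 2 = 1 → -(s * c) * ∫ x, ‖ψ x‖ ^ 2 ≤ ∫ x, F x := by
    intro s hs
    have hpos : ∀ x, 0 ≤ F x + (2 * s) * (P x - Q x) - (s * c) * S x := by
      intro x
      have : F x + (2 * s) * (P x - Q x) - (s * c) * S x
          = ((fderiv ℝ ψ x (1, 0)).re - c * x.2 * (ψ x).im + s * (fderiv ℝ ψ x (0, 1)).im) ^ 2
          + ((fderiv ℝ ψ x (1, 0)).im + c * x.2 * (ψ x).re - s * (fderiv ℝ ψ x (0, 1)).re) ^ 2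
          := by
        simp only [hF, hP, hQ, hS, h.fderiv_re, h.fderiv_im, h.fderiv_normSq]
        simp only [sq_norm_eq]
        simp
        linear_combination (-(fderiv ℝ ψ x (0, 1)).re ^ 2 - (fderiv ℝ ψ x (0, 1)).im ^ 2) * hs
      rw [this]; positivity
    have i1 : Integrable fun x => (2 * s) * (P x - Q x) := (iP.sub iQ).const_mul _
    have i2 : Integrable fun x => F x + (2 * s) * (P x - Q x) := iF.add i1
    have h1 : ∫ x, (F x + (2 * s) * (P x - Q x) - (s * c) * S x)
        = (∫ x, F x) + (2 * s) * ((∫ x, P x) - ∫ x, Q x) - (s * c) * ∫ x, S x := by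
      rw [integral_sub i2 (iS.const_mul _), integral_add iF i1, integral_const_mul,
        integral_const_mul, integral_sub iP iQ]
    have h2 : 0 ≤ ∫ x, (F x + (2 * s) * (P x - Q x) - (s * c) * S x) :=
      integral_nonneg fun x => hpos x
    rw [h1, hPQ, hSg] at h2
    linarith
  rcases abs_cases c with ⟨h1, _⟩ | ⟨h1, _⟩
  · rw [h1]; simpa using key (-1) (by norm_num)
  · rw [h1]; simpa using key 1 (by norm_num)

/-- The magnetic lower bound for functions living on one side of the line `x₂ = 0`. -/
theorem abs_mul_integral_wmul_le {a : ℝ} (ha : -1 ≤ a) (ha' : a < 0) (h : IsTest U ψ)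
    {χ : ℝ → ℝ} (hχ : ContDiff ℝ ∞ χ)
    (h0 : (∀ t ≤ 0, χ t = 0) ∨ (∀ t, 0 ≤ t → χ t = 0)) :
    |a| * ∫ x, ‖wmul χ ψ x‖ ^ 2 ≤ ∫ x, gradSq a (wmul χ ψ) x := by
  -- The field may be replaced by the constant `c`, which is `1` or `a`: the potential enters only
  -- multiplied by `wmul χ ψ`, and wherever `χ ≠ 0` the two potentials coincide.
  have main : ∀ c : ℝ, |a| ≤ |c| → (∀ t, χ t = 0 ∨ kap a t = c * t) →
      |a| * ∫ x, ‖wmul χ ψ x‖ ^ 2 ≤ ∫ x, gradSq a (wmul χ ψ) x := by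
    intro c hc hk
    refine (mul_le_mul_of_nonneg_right hc (integral_nonneg fun x => by positivity)).trans ?_
    refine (abs_mul_integral_le_of_constant_field (h.wmul hχ) c).trans_eq ?_
    refine integral_congr_ae (ae_of_all _ fun x => ?_)
    simp only [gradSq_eq, covDerivSmooth_one, covDerivSmooth_zero]
    rcases hk x.2 with h1 | h1
    · simp [wmul, h1]
    · rw [h1]
  rcases h0 with h0 | h0
  · refine main 1 ?_ fun t => ?_
    · rw [abs_one]; exact abs_le.2 ⟨ha, by linarith⟩
    · rcases le_total t 0 with ht | ht
      · exact Or.inl (h0 t ht)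
      · exact Or.inr (by rw [kap_of_nonneg a ht, one_mul])
  · refine main a le_rfl fun t => ?_
    rcases le_total t 0 with ht | ht
    · exact Or.inr (kap_of_nonpos a ht)
    · exact Or.inl (h0 t ht)

/-! ### The energy of test functions and near-minimizers in boxes -/

/-- The Ginzburg–Landau energy of a smooth function. -/
def energyS (a b : ℝ) (ψ : ℝ × ℝ → ℂ) : ℝ :=
  ∫ x, (b * gradSq a ψ x - ‖ψ x‖ ^ 2 + 1 / 2 * ‖ψ x‖ ^ 4)

theorem IsTest.integrable_energyS (h : IsTest U ψ) (a b : ℝ) :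
    Integrable fun x => b * gradSq a ψ x - ‖ψ x‖ ^ 2 + 1 / 2 * ‖ψ x‖ ^ 4 :=
  (((h.integrable_gradSq a).const_mul b).sub h.integrable_normSq).add
    (h.integrable_norm_pow_four.const_mul _)

theorem IsTest.energyS_eq (h : IsTest U ψ) (a b : ℝ) :
    energyS a b ψ = b * (∫ x, gradSq a ψ x) - (∫ x, ‖ψ x‖ ^ 2) + 1 / 2 * ∫ x, ‖ψ x‖ ^ 4 := by
  have i1 : Integrable fun x => b * gradSq a ψ x - ‖ψ x‖ ^ 2 :=
    ((h.integrable_gradSq a).const_mul b).sub h.integrable_normSq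
  rw [energyS, integral_add i1 (h.integrable_norm_pow_four.const_mul _),
    integral_sub ((h.integrable_gradSq a).const_mul b) h.integrable_normSq,
    integral_const_mul, integral_const_mul]

/-- The part `|x₂| ≤ m` of the strip. -/
def box (R m : ℝ) : Set (ℝ × ℝ) := Ioo (-R / 2) (R / 2) ×ˢ Icc (-m) m

theorem measurableSet_box (R m : ℝ) : MeasurableSet (box R m) :=
  measurableSet_Ioo.prod measurableSet_Icc

theorem volume_box (R m : ℝ) :
    volume (box R m) = ENNReal.ofReal R * ENNReal.ofReal (2 * m) := by
  rw [box, Measure.volume_eq_prod, Measure.prod_prod, Real.volume_Ioo, Real.volume_Icc]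
  congr 2 <;> ring

/-- Test functions in the strip which vanish for `|x₂| > m`. -/
structure BoxTest (R m : ℝ) (ψ : ℝ × ℝ → ℂ) : Prop where
  test : IsTest (strip R) ψ
  zero : ∀ x : ℝ × ℝ, m < |x.2| → ψ x = 0

theorem BoxTest.eq_zero {R m : ℝ} (h : BoxTest R m ψ) {x : ℝ × ℝ} (hx : x ∉ box R m) :
    ψ x = 0 := by
  by_contra h0
  refine hx ?_
  have h1 : x ∈ strip R := h.test.supp (subset_tsupport _ h0)
  have h2 : |x.2| ≤ m := not_lt.1 fun h2 => h0 (h.zero x h2)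
  exact ⟨h1.1, abs_le.1 h2⟩

theorem isTest_zero : IsTest U (fun _ => (0 : ℂ)) where
  smooth := contDiff_const
  compact := HasCompactSupport.zero
  supp := by
    have : tsupport (fun _ : ℝ × ℝ => (0 : ℂ)) = ∅ := by
      rw [tsupport_eq_empty_iff]; rfl
    rw [this]; exact empty_subset _

theorem boxTest_zero (R m : ℝ) : BoxTest R m (fun _ => (0 : ℂ)) := ⟨isTest_zero, fun _ _ => rfl⟩

theorem energyS_zero (a b : ℝ) : energyS a b (fun _ => 0) = 0 := by
  simp [energyS, gradSq, covDerivSmooth]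

/-- Comparison of integrals with an error `c` on the box. -/
theorem integral_le_add_box {R m c : ℝ} (hR : 0 ≤ R) (hm : 0 ≤ m) {f g : ℝ × ℝ → ℝ}
    (hf : Integrable f) (hg : Integrable g) (h1 : ∀ x ∈ box R m, f x ≤ g x + c)
    (h2 : ∀ x ∉ box R m, f x ≤ g x) : ∫ x, f x ≤ (∫ x, g x) + c * (R * (2 * m)) := by
  have hfin : volume (box R m) ≠ ⊤ := by
    rw [volume_box]; exact ENNReal.mul_ne_top ENNReal.ofReal_ne_top ENNReal.ofReal_ne_top
  have i1 : Integrable ((box R m).indicator fun _ => c) :=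
    (integrable_indicator_iff (measurableSet_box R m)).2 (integrableOn_const hfin)
  have h3 : ∫ x, (box R m).indicator (fun _ => c) x = c * (R * (2 * m)) := by
    rw [integral_indicator (measurableSet_box R m), setIntegral_const, smul_eq_mul,
      Measure.real, volume_box, ENNReal.toReal_mul, ENNReal.toReal_ofReal hR,
      ENNReal.toReal_ofReal (by positivity)]
    ring
  rw [← h3, ← integral_add hg i1]
  refine integral_mono hf (hg.add i1) fun x => ?_
  by_cases hx : x ∈ box R m
  · simpa [hx] using h1 x hx
  · simpa [hx] using h2 x hx

theorem BoxTest.integral_normSq_le {R m : ℝ} (hR : 0 ≤ R) (hm : 0 ≤ m) (h : BoxTest R m ψ)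
    (h1 : ∀ x, ‖ψ x‖ ≤ 1) : ∫ x, ‖ψ x‖ ^ 2 ≤ R * (2 * m) := by
  have := integral_le_add_box (c := 1) hR hm h.test.integrable_normSq (integrable_zero _ ℝ _)
    (fun x _ => by simpa using h1 x)
    (fun x hx => by simp [h.eq_zero hx])
  simpa using this

/-- Completing the square, `-s + s²/2 ≥ -1/2` with `s = |ψ|²`, and the box has area `2mR`. This
bound degenerates as `m → ∞`. -/
theorem BoxTest.neg_le_energyS {R m b : ℝ} (hR : 0 ≤ R) (hm : 0 ≤ m) (hb : 0 ≤ b) (a : ℝ)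
    (h : BoxTest R m ψ) : -(1 / 2 * (R * (2 * m))) ≤ energyS a b ψ := by
  have := integral_le_add_box (c := 1 / 2) hR hm (integrable_zero _ ℝ _)
    (h.test.integrable_energyS a b)
    (fun x _ => by
      have := mul_nonneg hb (gradSq_nonneg a ψ x)
      rw [Pi.zero_apply]
      nlinarith [sq_nonneg (‖ψ x‖ ^ 2 - 1)])
    (fun x hx => by
      have := mul_nonneg hb (gradSq_nonneg a ψ x)
      simpa [h.eq_zero hx] using this)
  simp only [Pi.zero_apply, integral_zero] at this
  rw [energyS]
  linarith

/-! ### Smooth truncation at modulus one -/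

/-- A radial factor `h` with `h' ≤ 0 ≤ h + s h'` and `0 ≤ h ≤ 1` contracts covariant
derivatives. -/
theorem norm_sq_radial_le {h h' : ℝ} {z ζ : ℂ} (h0 : 0 ≤ h) (h1 : h ≤ 1) (h2 : h' ≤ 0)
    (h3 : 0 ≤ h + ‖z‖ ^ 2 * h') :
    ‖(h : ℂ) * ζ + ((h' * (2 * (z.re * ζ.re + z.im * ζ.im)) : ℝ) : ℂ) * z‖ ^ 2 ≤ ‖ζ‖ ^ 2 := by
  have key : ‖(h : ℂ) * ζ + ((h' * (2 * (z.re * ζ.re + z.im * ζ.im)) : ℝ) : ℂ) * z‖ ^ 2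
      = h ^ 2 * ‖ζ‖ ^ 2
        + 4 * h' * (h + ‖z‖ ^ 2 * h') * (z.re * ζ.re + z.im * ζ.im) ^ 2 := by
    simp only [sq_norm_eq, Complex.add_re, Complex.add_im, Complex.re_ofReal_mul,
      Complex.im_ofReal_mul]
    ring
  rw [key]
  have h4 : h' * (h + ‖z‖ ^ 2 * h') * (z.re * ζ.re + z.im * ζ.im) ^ 2 ≤ 0 :=
    mul_nonpos_of_nonpos_of_nonneg (mul_nonpos_of_nonpos_of_nonneg h2 h3) (sq_nonneg _)
  have h5 : h ^ 2 * ‖ζ‖ ^ 2 ≤ 1 * ‖ζ‖ ^ 2 :=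
    mul_le_mul_of_nonneg_right (pow_le_one₀ h0 h1) (by positivity)
  linarith

/-- The smooth radial cut-off factor `(1 + s^k)^(-1/(2k))`, for which `s ↦ s h(s)²` approximates
`min s 1`. -/
def cutFactor (k : ℕ) (s : ℝ) : ℝ := (1 + s ^ k) ^ (-(1 / (2 * k : ℝ)))

/-- The truncation of `ψ` at modulus one. -/
def trunc (k : ℕ) (ψ : ℝ × ℝ → ℂ) (x : ℝ × ℝ) : ℂ := (cutFactor k (‖ψ x‖ ^ 2) : ℂ) * ψ x

theorem hasDerivAt_cutFactor {k : ℕ} (hk : k ≠ 0) {s : ℝ} (hs : 0 ≤ s) :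
    HasDerivAt (cutFactor k) (-(1 / 2) * s ^ (k - 1) * (cutFactor k s / (1 + s ^ k))) s := by
  have hpos : 0 < 1 + s ^ k := by positivity
  have h1 : HasDerivAt (fun s : ℝ => 1 + s ^ k) (k * s ^ (k - 1)) s := by
    simpa using (hasDerivAt_pow k s).const_add 1
  have h2 := h1.rpow_const (p := -(1 / (2 * k : ℝ))) (Or.inl hpos.ne')
  change HasDerivAt (fun y : ℝ => (1 + y ^ k) ^ (-(1 / (2 * k : ℝ)))) _ _
  convert h2 using 1
  rw [Real.rpow_sub_one hpos.ne', cutFactor]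
  have : (k : ℝ) ≠ 0 := Nat.cast_ne_zero.2 hk
  field_simp

theorem cutFactor_pos (k : ℕ) {s : ℝ} (hs : 0 ≤ s) : 0 < cutFactor k s :=
  Real.rpow_pos_of_pos (by positivity) _

theorem cutFactor_le_one (k : ℕ) {s : ℝ} (hs : 0 ≤ s) : cutFactor k s ≤ 1 :=
  Real.rpow_le_one_of_one_le_of_nonpos (by simpa using pow_nonneg hs k)
    (neg_nonpos.2 (by positivity))

theorem cutFactor_sq {k : ℕ} (hk : k ≠ 0) {s : ℝ} (hs : 0 ≤ s) :
    cutFactor k s ^ 2 = ((1 + s ^ k) ^ (1 / (k : ℝ)))⁻¹ := by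
  have hpos : 0 < 1 + s ^ k := by positivity
  have : (k : ℝ) ≠ 0 := Nat.cast_ne_zero.2 hk
  rw [cutFactor, ← Real.rpow_natCast, ← Real.rpow_mul hpos.le, ← Real.rpow_neg hpos.le]
  congr 1
  push_cast
  field_simp

theorem mul_cutFactor_sq_le_one {k : ℕ} (hk : k ≠ 0) {s : ℝ} (hs : 0 ≤ s) :
    s * cutFactor k s ^ 2 ≤ 1 := by
  have hpos : 0 < 1 + s ^ k := by positivity
  rw [cutFactor_sq hk hs, ← div_eq_mul_inv, div_le_one (Real.rpow_pos_of_pos hpos _)]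
  calc s = (s ^ k) ^ (1 / (k : ℝ)) := by rw [one_div, Real.pow_rpow_inv_natCast hs hk]
    _ ≤ _ := Real.rpow_le_rpow (by positivity) (by linarith) (by positivity)

/-- Since `1 + s ^ k ≤ 2 max(1, s ^ k)`, the `k`-th root exceeds `max(1, s)` by a factor of at most
`2 ^ (1/k)`, which tends to one. -/
theorem min_mul_le_mul_cutFactor_sq {k : ℕ} (hk : k ≠ 0) {s : ℝ} (hs : 0 ≤ s) :
    min s 1 * ((2 : ℝ) ^ (1 / (k : ℝ)))⁻¹ ≤ s * cutFactor k s ^ 2 := by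
  have hpos : 0 < 1 + s ^ k := by positivity
  have hG : 0 < (1 + s ^ k) ^ (1 / (k : ℝ)) := Real.rpow_pos_of_pos hpos _
  have hL : 0 < (2 : ℝ) ^ (1 / (k : ℝ)) := by positivity
  rw [cutFactor_sq hk hs, ← div_eq_mul_inv, ← div_eq_mul_inv, div_le_div_iff₀ hL hG]
  rcases le_total s 1 with h | h
  · rw [min_eq_left h]
    refine mul_le_mul_of_nonneg_left ?_ hs
    exact Real.rpow_le_rpow hpos.le (by linarith [pow_le_one₀ hs h (n := k)]) (by positivity)
  · rw [min_eq_right h, one_mul]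
    calc (1 + s ^ k) ^ (1 / (k : ℝ)) ≤ (s ^ k * 2) ^ (1 / (k : ℝ)) :=
          Real.rpow_le_rpow hpos.le (by linarith [one_le_pow₀ h (n := k)]) (by positivity)
      _ = s * 2 ^ (1 / (k : ℝ)) := by
          rw [Real.mul_rpow (by positivity) (by norm_num), one_div, Real.pow_rpow_inv_natCast hs hk]

/-- The potential energy increases by at most `1 - 2^(-1/k)` under truncation. -/
theorem potential_trunc_le {k : ℕ} (hk : k ≠ 0) {s : ℝ} (hs : 0 ≤ s) :
    -(s * cutFactor k s ^ 2) + 1 / 2 * (s * cutFactor k s ^ 2) ^ 2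
      ≤ -s + 1 / 2 * s ^ 2 + (1 - ((2 : ℝ) ^ (1 / (k : ℝ)))⁻¹) := by
  set z := s * cutFactor k s ^ 2
  set c := ((2 : ℝ) ^ (1 / (k : ℝ)))⁻¹
  have h1 : z ≤ 1 := mul_cutFactor_sq_le_one hk hs
  have h2 : min s 1 * c ≤ z := min_mul_le_mul_cutFactor_sq hk hs
  have h0 : 0 ≤ z := mul_nonneg hs (sq_nonneg _)
  have hzs : z ≤ s := mul_le_of_le_one_right hs
    (pow_le_one₀ (cutFactor_pos k hs).le (cutFactor_le_one k hs))
  have hc1 : c ≤ 1 := inv_le_one_of_one_le₀ (Real.one_le_rpow (by norm_num) (by positivity))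
  -- Let `p(z) = -z + z²/2`. For `s ≤ 1`, `p(z) - p(s) ≤ s - z ≤ 1 - c`. For `s ≥ 1`, `p(s) ≥ -1/2`,
  -- while `p(z) + 1/2 = (1 - z)²/2 ≤ 1 - c`.
  rcases le_total s 1 with h | h
  · rw [min_eq_left h] at h2
    nlinarith
  · rw [min_eq_right h, one_mul] at h2
    nlinarith [sq_nonneg (1 - s)]

theorem tsupport_trunc_subset (k : ℕ) (ψ : ℝ × ℝ → ℂ) : tsupport (trunc k ψ) ⊆ tsupport ψ :=
  closure_mono fun x hx => by
    simp only [Function.mem_support, trunc] at hx ⊢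
    exact right_ne_zero_of_mul hx

theorem IsTest.trunc (h : IsTest U ψ) (k : ℕ) : IsTest U (trunc k ψ) where
  smooth := by
    unfold MagneticStep.trunc cutFactor
    refine (Complex.ofRealCLM.contDiff.comp (ContDiff.rpow_const_of_ne ?_ fun x => ?_)).mul
      h.smooth
    · exact contDiff_const.add (h.normSq.smooth.pow k)
    · positivity
  compact := h.compact.mono' ((subset_tsupport _).trans (tsupport_trunc_subset k ψ))
  supp := (tsupport_trunc_subset k ψ).trans h.supp

theorem BoxTest.trunc {R m : ℝ} (h : BoxTest R m ψ) (k : ℕ) : BoxTest R m (trunc k ψ) :=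
  ⟨h.test.trunc k, fun x hx => by simp [MagneticStep.trunc, h.zero x hx]⟩

theorem norm_trunc_sq (k : ℕ) (ψ : ℝ × ℝ → ℂ) (x : ℝ × ℝ) :
    ‖trunc k ψ x‖ ^ 2 = ‖ψ x‖ ^ 2 * cutFactor k (‖ψ x‖ ^ 2) ^ 2 := by
  rw [trunc, norm_mul, mul_pow, Complex.norm_real, Real.norm_eq_abs, sq_abs]; ring

theorem norm_trunc_le_one {k : ℕ} (hk : k ≠ 0) (ψ : ℝ × ℝ → ℂ) (x : ℝ × ℝ) :
    ‖trunc k ψ x‖ ≤ 1 := by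
  have := mul_cutFactor_sq_le_one hk (sq_nonneg ‖ψ x‖)
  rw [← norm_trunc_sq] at this
  exact (sq_le_one_iff₀ (norm_nonneg _)).1 this

theorem IsTest.gradSq_trunc_le (h : IsTest U ψ) {k : ℕ} (hk : k ≠ 0) (a : ℝ) (x : ℝ × ℝ) :
    gradSq a (MagneticStep.trunc k ψ) x ≤ gradSq a ψ x := by
  refine Finset.sum_le_sum fun j _ => ?_
  set s := ‖ψ x‖ ^ 2 with hs
  have hs0 : 0 ≤ s := sq_nonneg _
  set H := cutFactor k s with hH
  set H' := -(1 / 2) * s ^ (k - 1) * (H / (1 + s ^ k)) with hH'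
  have hpos : 0 < 1 + s ^ k := by positivity
  have hHpos : 0 < H := cutFactor_pos k hs0
  have h1 : HasFDerivAt (fun x => cutFactor k (‖ψ x‖ ^ 2))
      (H' • fderiv ℝ (fun x => ‖ψ x‖ ^ 2) x) x :=
    HasDerivAt.comp_hasFDerivAt (f := fun x => ‖ψ x‖ ^ 2) x (hasDerivAt_cutFactor hk hs0) (h.normSq.differentiable x).hasFDerivAt
  have h2 := (Complex.ofRealCLM.hasFDerivAt.comp x h1).mul (h.differentiable x).hasFDerivAt
  have h3 : fderiv ℝ (MagneticStep.trunc k ψ) x = _ := h2.fderiv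
  have h4 : covDerivSmooth a j (MagneticStep.trunc k ψ) x = (H : ℂ) * covDerivSmooth a j ψ x
      + ((H' * (2 * ((ψ x).re * (covDerivSmooth a j ψ x).re
        + (ψ x).im * (covDerivSmooth a j ψ x).im)) : ℝ) : ℂ) * ψ x := by
    -- The potential adds an imaginary multiple of `ψ` to the derivative, which is invisible in `Re
    -- (conj ψ D_j ψ)`. Hence the derivative of the radial factor can be written with covariant
    -- derivatives.
    have h5 : (ψ x).re * (covDerivSmooth a j ψ x).re + (ψ x).im * (covDerivSmooth a j ψ x).im
        = (ψ x).re * (fderiv ℝ ψ x (e j)).re + (ψ x).im * (fderiv ℝ ψ x (e j)).im := by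
      simp only [covDerivSmooth]
      generalize sigma a x * A0 x j = r
      simp
      ring
    rw [h5, ← h.fderiv_normSq]
    simp only [covDerivSmooth, h3]
    simp [MagneticStep.trunc, ← hs, ← hH]
    ring
  rw [h4]
  refine norm_sq_radial_le hHpos.le (cutFactor_le_one k hs0) ?_ ?_
  · rw [hH']
    have : 0 ≤ s ^ (k - 1) * (H / (1 + s ^ k)) := by positivity
    linarith
  -- The remaining condition holds because `H + s H' = H (1 - s ^ k / (2 (1 + s ^ k)))`.
  · rw [hH', ← hs]
    have h6 : s * s ^ (k - 1) = s ^ k := mul_pow_sub_one hk s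
    have h7 : s ^ k * (H / (1 + s ^ k)) ≤ H := by
      rw [← mul_div_assoc, div_le_iff₀ hpos]; nlinarith
    have h8 : s * (-(1 / 2) * s ^ (k - 1) * (H / (1 + s ^ k)))
      = -(1 / 2) * (s ^ k * (H / (1 + s ^ k))) := by rw [← h6]; ring
    rw [h8]
    have : 0 ≤ s ^ k * (H / (1 + s ^ k)) := by positivity
    linarith

theorem BoxTest.energyS_trunc_le {R m b : ℝ} (hR : 0 ≤ R) (hm : 0 ≤ m) (hb : 0 ≤ b) (a : ℝ)
    (h : BoxTest R m ψ) {k : ℕ} (hk : k ≠ 0) :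
    energyS a b (MagneticStep.trunc k ψ) ≤ energyS a b ψ
      + (1 - ((2 : ℝ) ^ (1 / (k : ℝ)))⁻¹) * (R * (2 * m)) := by
  refine integral_le_add_box hR hm ((h.trunc k).test.integrable_energyS a b)
    (h.test.integrable_energyS a b) (fun x _ => ?_) fun x hx => ?_
  · have h1 := mul_le_mul_of_nonneg_left (h.test.gradSq_trunc_le hk a x) hb
    have h2 := potential_trunc_le hk (sq_nonneg ‖ψ x‖)
    rw [← norm_trunc_sq] at h2
    rw [norm_pow_four_eq, norm_pow_four_eq]
    linarith
  · have h1 := mul_le_mul_of_nonneg_left (h.test.gradSq_trunc_le hk a x) hb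
    simpa [h.eq_zero hx, (h.trunc k).eq_zero hx] using h1

/-- In every box there are near-minimizers of modulus at most one. -/
theorem exists_boxTest_near_min {R m b ε : ℝ} (hR : 0 ≤ R) (hm : 0 ≤ m) (hb : 0 ≤ b) (a : ℝ)
    (hε : 0 < ε) : ∃ ψ, BoxTest R m ψ ∧ (∀ x, ‖ψ x‖ ≤ 1) ∧
      ∀ v, BoxTest R m v → energyS a b ψ ≤ energyS a b v + ε := by
  set S : Set ℝ := energyS a b '' {v | BoxTest R m v}
  have hne : S.Nonempty := ⟨_, _, boxTest_zero R m, rfl⟩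
  have hbd : BddBelow S := ⟨_, by rintro _ ⟨v, hv, rfl⟩; exact hv.neg_le_energyS hR hm hb a⟩
  obtain ⟨_, ⟨v, hv, rfl⟩, hlt⟩ := exists_lt_of_csInf_lt hne (lt_add_of_pos_right (sInf S)
    (half_pos hε))
  have hlim : Tendsto (fun k : ℕ => (1 - ((2 : ℝ) ^ (1 / (k : ℝ)))⁻¹) * (R * (2 * m))) atTop
      (𝓝 0) := by
    have h1 : Tendsto (fun k : ℕ => (2 : ℝ) ^ (1 / (k : ℝ))) atTop (𝓝 1) := by
      have := (Real.continuous_const_rpow (a := 2) (by norm_num)).continuousAt.tendsto.comp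
        tendsto_one_div_atTop_nhds_zero_nat
      simpa [Function.comp_def] using this
    have h2 := ((h1.inv₀ (by norm_num)).const_sub 1).mul_const (R * (2 * m))
    simpa using h2
  obtain ⟨k, hk1, hk2⟩ := ((hlim.eventually_lt_const (half_pos hε)).and
    (eventually_ne_atTop 0)).exists
  refine ⟨trunc k v, hv.trunc k, norm_trunc_le_one hk2 v, fun w hw => ?_⟩
  have h1 := hv.energyS_trunc_le hR hm hb a hk2
  have h2 : sInf S ≤ energyS a b w := csInf_le hbd ⟨w, hw, rfl⟩
  linarith

/-! ### The approximate Euler–Lagrange inequality -/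

/-- The first variation of the energy at `ψ` in the direction `η(x₂) ψ` (up to a factor two). -/
def firstVar (a b : ℝ) (η : ℝ → ℝ) (ψ : ℝ × ℝ → ℂ) : ℝ :=
  ∫ x : ℝ × ℝ, (b * (η x.2 * gradSq a ψ x + deriv η x.2 * crossRe ψ x)
    - η x.2 * ‖ψ x‖ ^ 2 + η x.2 * ‖ψ x‖ ^ 4)

theorem IsTest.integrable_weight_gradSq (h : IsTest U ψ) (a : ℝ) {w : ℝ → ℝ}
    (hw : Continuous w) : Integrable fun x : ℝ × ℝ => w x.2 * gradSq a ψ x :=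
  h.integrable_weight_mul hw (h.continuous_gradSq a) fun _ hx => gradSq_eq_zero hx

theorem IsTest.integrable_weight_crossRe (h : IsTest U ψ) {w : ℝ → ℝ}
    (hw : Continuous w) : Integrable fun x : ℝ × ℝ => w x.2 * crossRe ψ x :=
  h.integrable_weight_mul hw h.continuous_crossRe fun _ hx => crossRe_eq_zero hx

theorem IsTest.integrable_weight_normSq (h : IsTest U ψ) {w : ℝ → ℝ}
    (hw : Continuous w) : Integrable fun x : ℝ × ℝ => w x.2 * ‖ψ x‖ ^ 2 :=
  h.integrable_weight_mul hw (h.continuous.norm.pow 2) fun x hx => by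
    simp [image_eq_zero_of_notMem_tsupport hx]

theorem IsTest.integrable_weight_norm_pow_four (h : IsTest U ψ) {w : ℝ → ℝ}
    (hw : Continuous w) : Integrable fun x : ℝ × ℝ => w x.2 * ‖ψ x‖ ^ 4 :=
  h.integrable_weight_mul hw (h.continuous.norm.pow 4) fun x hx => by
    simp [image_eq_zero_of_notMem_tsupport hx]

theorem IsTest.integrable_firstVar (h : IsTest U ψ) (a b : ℝ) {η : ℝ → ℝ}
    (hη : ContDiff ℝ ∞ η) : Integrable fun x : ℝ × ℝ =>
      b * (η x.2 * gradSq a ψ x + deriv η x.2 * crossRe ψ x)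
        - η x.2 * ‖ψ x‖ ^ 2 + η x.2 * ‖ψ x‖ ^ 4 :=
  ((((h.integrable_weight_gradSq a hη.continuous).add
    (h.integrable_weight_crossRe (hη.continuous_deriv (by simp)))).const_mul b).sub
    (h.integrable_weight_normSq hη.continuous)).add
    (h.integrable_weight_norm_pow_four hη.continuous)

/-- Second order expansion of the energy density of `(1 - tη)ψ`. -/
theorem energy_density_expansion_le {b t y y' M g s c : ℝ} (hb : 0 ≤ b) (ht : 0 < t)
    (ht1 : t ≤ 1) (hy : 0 ≤ y) (hyM : y ≤ M) (hy' : |y'| ≤ M) (hg : 0 ≤ g) (hs : 0 ≤ s)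
    (hs1 : s ≤ 1) (hc : c ^ 2 ≤ s * g) :
    b * ((1 - t * y) ^ 2 * g + 2 * (1 - t * y) * (-(t * y')) * c + (-(t * y')) ^ 2 * s)
      - (1 - t * y) ^ 2 * s + 1 / 2 * ((1 - t * y) ^ 4 * s ^ 2)
    ≤ (b * g - s + 1 / 2 * s ^ 2) - 2 * t * (b * (y * g + y' * c) - y * s + y * s ^ 2)
      + t ^ 2 * (2 * M ^ 2 * (b * g) + (2 * b * M ^ 2 + 3 * M ^ 2 + M ^ 4) * s) := by
  have hyM2 : y ^ 2 ≤ M ^ 2 := pow_le_pow_left₀ hy hyM 2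
  have hyM4 : y ^ 4 ≤ M ^ 4 := pow_le_pow_left₀ hy hyM 4
  have hy2 : y' ^ 2 ≤ M ^ 2 := sq_le_sq' (abs_le.1 hy').1 (abs_le.1 hy').2
  have hss : s ^ 2 ≤ s := by nlinarith
  -- AM–GM for a quantity known only through its square: if `2A > B + D ≥ 0`, then `4A² > (B + D)² ≥
  -- 4BD`, against `A² ≤ BD`.
  have hcross : 2 * (y * y' * c) ≤ y ^ 2 * g + y' ^ 2 * s := by
    by_contra hcon
    push Not at hcon
    have h1 : (y * y' * c) ^ 2 ≤ (y ^ 2 * g) * (y' ^ 2 * s) := by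
      have := mul_le_mul_of_nonneg_left hc (by positivity : 0 ≤ y ^ 2 * y' ^ 2)
      nlinarith
    have h2 : 0 ≤ y ^ 2 * g := by positivity
    have h3 : 0 ≤ y' ^ 2 * s := by positivity
    nlinarith [sq_nonneg (y ^ 2 * g - y' ^ 2 * s)]
  have hquad : y ^ 2 * g + 2 * (y * y' * c) + y' ^ 2 * s ≤ 2 * M ^ 2 * g + 2 * M ^ 2 * s := by
    have h1 := mul_le_mul_of_nonneg_right hyM2 hg
    have h2 := mul_le_mul_of_nonneg_right hy2 hs
    linarith
  have hkin : t ^ 2 * (b * (y ^ 2 * g + 2 * (y * y' * c) + y' ^ 2 * s))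
      ≤ t ^ 2 * (b * (2 * M ^ 2 * g + 2 * M ^ 2 * s)) := by gcongr
  have hquart : 1 / 2 * ((1 - t * y) ^ 4 * s ^ 2)
      ≤ 1 / 2 * s ^ 2 - 2 * t * y * s ^ 2 + t ^ 2 * ((3 * M ^ 2 + M ^ 4) * s) := by
    have e1 : 1 / 2 * ((1 - t * y) ^ 4 * s ^ 2) = 1 / 2 * s ^ 2 - 2 * t * y * s ^ 2
        + t ^ 2 * (3 * y ^ 2 * s ^ 2) - 2 * (t * y) ^ 3 * s ^ 2
        + t ^ 2 * (1 / 2 * (t ^ 2 * (y ^ 4 * s ^ 2))) := by ring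
    -- The cubic term of `(1 - ty)⁴` enters with a minus sign; since the weight is nonnegative it
    -- can be dropped.
    have p1 : 0 ≤ 2 * (t * y) ^ 3 * s ^ 2 := by positivity
    have p2 : t ^ 2 * (3 * y ^ 2 * s ^ 2) ≤ t ^ 2 * (3 * M ^ 2 * s) := by gcongr
    have p3 : t ^ 2 * (1 / 2 * (t ^ 2 * (y ^ 4 * s ^ 2))) ≤ t ^ 2 * (1 / 2 * (1 * (M ^ 4 * s))) := by
      gcongr
      exact pow_le_one₀ ht.le ht1
    have p4 : 0 ≤ t ^ 2 * (M ^ 4 * s) := by positivity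
    rw [e1]
    nlinarith
  have hsq : 0 ≤ t ^ 2 * (y ^ 2 * s) := by positivity
  nlinarith

/-- Almost minimality implies that the first variation is almost nonpositive, uniformly in the
near-minimizer and in the weight. -/
theorem exists_near_min_firstVar_le {R m M b δ : ℝ} (hR : 0 ≤ R) (hm : 0 ≤ m) (hb : 0 ≤ b)
    (a : ℝ) (hδ : 0 < δ) : ∃ ε > 0, ∀ ψ, BoxTest R m ψ → (∀ x, ‖ψ x‖ ≤ 1) →
      (∀ v, BoxTest R m v → energyS a b ψ ≤ energyS a b v + ε) →
      ∀ η : ℝ → ℝ, ContDiff ℝ ∞ η → (∀ t, 0 ≤ η t) → (∀ t, |t| ≤ m → η t ≤ M) →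
        (∀ t, |t| ≤ m → |deriv η t| ≤ M) → firstVar a b η ψ ≤ δ := by
  set A := R * (2 * m) with hA
  have hA0 : 0 ≤ A := by positivity
  set K := 2 * M ^ 2 * (A + 1) + (2 * b * M ^ 2 + 3 * M ^ 2 + M ^ 4) * A with hK
  have hK0 : 0 ≤ K := by positivity
  -- Near-minimality gives `2t · firstVar ≤ t²K + ε`, where `K` bounds the second-order terms via `∫
  -- |ψ|² ≤ A` and, by comparison with zero, `b ∫ gradSq ≤ A + 1`. With `tK ≤ δ` and `ε ≤ tδ` the
  -- right side is at most `2tδ`.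
  set t := min 1 (δ / (K + 1)) with ht
  have ht0 : 0 < t := lt_min one_pos (by positivity)
  have ht1 : t ≤ 1 := min_le_left _ _
  have htK : t * K ≤ δ := by
    have h1 : t ≤ δ / (K + 1) := min_le_right _ _
    rw [le_div_iff₀ (by positivity)] at h1
    nlinarith
  refine ⟨min 1 (t * δ), lt_min one_pos (by positivity), ?_⟩
  intro ψ hψ h1 hmin η hη hη0 hηM hη'
  set ε := min 1 (t * δ) with hε
  have hε1 : ε ≤ 1 := min_le_left _ _
  have hε2 : ε ≤ t * δ := min_le_right _ _
  have hT := hψ.test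
  have hN : ∫ x, ‖ψ x‖ ^ 2 ≤ A := hψ.integral_normSq_le hR hm h1
  have hG : b * ∫ x, gradSq a ψ x ≤ A + 1 := by
    have h2 := hmin _ (boxTest_zero R m)
    rw [energyS_zero, hT.energyS_eq] at h2
    have : 0 ≤ ∫ x, ‖ψ x‖ ^ 4 := integral_nonneg fun x => by positivity
    linarith
  have hχ : ContDiff ℝ ∞ fun s => 1 - t * η s := contDiff_const.sub (contDiff_const.mul hη)
  have hderiv : ∀ s, deriv (fun s => 1 - t * η s) s = -(t * deriv η s) := by
    intro s
    rw [deriv_const_sub, deriv_const_mul _ ((hη.differentiable (by simp)) s)]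
  have hv : BoxTest R m (wmul (fun s => 1 - t * η s) ψ) :=
    ⟨hT.wmul hχ, fun x hx => by simp [wmul, hψ.zero x hx]⟩
  have iG := hT.integrable_gradSq a
  have iN := hT.integrable_normSq
  have iE := hT.integrable_energyS a b
  have iJ := hT.integrable_firstVar a b hη
  set c1 := 2 * M ^ 2
  set c2 := 2 * b * M ^ 2 + 3 * M ^ 2 + M ^ 4
  have i1 : Integrable fun x => c1 * (b * gradSq a ψ x) + c2 * ‖ψ x‖ ^ 2 :=
    ((iG.const_mul b).const_mul c1).add (iN.const_mul c2)
  have i2 : Integrable fun x => (b * gradSq a ψ x - ‖ψ x‖ ^ 2 + 1 / 2 * ‖ψ x‖ ^ 4)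
      - 2 * t * (b * (η x.2 * gradSq a ψ x + deriv η x.2 * crossRe ψ x)
        - η x.2 * ‖ψ x‖ ^ 2 + η x.2 * ‖ψ x‖ ^ 4) := iE.sub (iJ.const_mul _)
  have hle : energyS a b (wmul (fun s => 1 - t * η s) ψ)
      ≤ energyS a b ψ - 2 * t * firstVar a b η ψ
        + t ^ 2 * (c1 * (b * ∫ x, gradSq a ψ x) + c2 * ∫ x, ‖ψ x‖ ^ 2) := by
    have h3 : ∫ x, ((b * gradSq a ψ x - ‖ψ x‖ ^ 2 + 1 / 2 * ‖ψ x‖ ^ 4)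
        - 2 * t * (b * (η x.2 * gradSq a ψ x + deriv η x.2 * crossRe ψ x)
        - η x.2 * ‖ψ x‖ ^ 2 + η x.2 * ‖ψ x‖ ^ 4)
        + t ^ 2 * (c1 * (b * gradSq a ψ x) + c2 * ‖ψ x‖ ^ 2))
        = energyS a b ψ - 2 * t * firstVar a b η ψ
        + t ^ 2 * (c1 * (b * ∫ x, gradSq a ψ x) + c2 * ∫ x, ‖ψ x‖ ^ 2) := by
      rw [integral_add i2 (i1.const_mul _), integral_sub iE (iJ.const_mul _),
        integral_const_mul, integral_const_mul,
        integral_add ((iG.const_mul b).const_mul c1) (iN.const_mul c2), integral_const_mul,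
        integral_const_mul, integral_const_mul, energyS, firstVar]
    rw [← h3]
    refine integral_mono (hv.test.integrable_energyS a b) (i2.add (i1.const_mul _)) fun x => ?_
    beta_reduce
    by_cases hx : |x.2| ≤ m
    · have key := energy_density_expansion_le hb ht0 ht1 (hη0 x.2) (hηM x.2 hx) (hη' x.2 hx)
        (gradSq_nonneg a ψ x) (sq_nonneg ‖ψ x‖) (pow_le_one₀ (norm_nonneg _) (h1 x))
        (crossRe_sq_le a ψ x)
      rw [hT.gradSq_wmul hχ, norm_wmul, hderiv]
      have e1 : (|1 - t * η x.2| * ‖ψ x‖) ^ 2 = (1 - t * η x.2) ^ 2 * ‖ψ x‖ ^ 2 := by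
        rw [mul_pow, sq_abs]
      have e2 : (|1 - t * η x.2| * ‖ψ x‖) ^ 4 = (1 - t * η x.2) ^ 4 * (‖ψ x‖ ^ 2) ^ 2 := by
        rw [mul_pow, show (4 : ℕ) = 2 * 2 from rfl, pow_mul, sq_abs, ← pow_mul, ← pow_mul]
      rw [e1, e2, norm_pow_four_eq]
      exact key
    -- Outside the box the weight is not bounded by `M`, but there `ψ` vanishes in a neighbourhood
    -- and every density is zero.
    · have hψx : ∀ y : ℝ × ℝ, m < |y.2| → ψ y = 0 := hψ.zero
      have hx' : x ∉ tsupport ψ := by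
        rw [notMem_tsupport_iff_eventuallyEq]
        have : ∀ᶠ y : ℝ × ℝ in 𝓝 x, m < |y.2| :=
          (continuous_snd.abs.tendsto x).eventually_const_lt (not_le.1 hx)
        filter_upwards [this] with y hy using hψx y hy
      have hx'' : x ∉ tsupport (wmul (fun s => 1 - t * η s) ψ) :=
        fun h => hx' (tsupport_wmul_subset _ _ h)
      simp [gradSq_eq_zero hx', gradSq_eq_zero hx'', image_eq_zero_of_notMem_tsupport hx',
        image_eq_zero_of_notMem_tsupport hx'', crossRe_eq_zero hx']
  have hmin' := hmin _ hv
  have hb1 : c1 * (b * ∫ x, gradSq a ψ x) + c2 * ∫ x, ‖ψ x‖ ^ 2 ≤ K := by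
    rw [hK]; gcongr
  have hb2 : t ^ 2 * (c1 * (b * ∫ x, gradSq a ψ x) + c2 * ∫ x, ‖ψ x‖ ^ 2) ≤ t * δ := by
    calc _ ≤ t ^ 2 * K := by gcongr
      _ = t * (t * K) := by ring
      _ ≤ t * δ := by gcongr
  have : 2 * t * firstVar a b η ψ ≤ 2 * t * δ := by linarith
  exact le_of_mul_le_mul_left this (by positivity)

/-! ### The weights -/

/-- The data used in the weighted estimates on the side `s x₂ > 0` of the line `x₂ = 0`:
`χ² = |t|³ / (ln |t|)²` and `η² = |t| / (ln |t|)²` for `s t ≥ 4`. -/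
structure WeightPair (s : ℝ) (χ η W : ℝ → ℝ) (c : ℝ) : Prop where
  smooth_strong : ContDiff ℝ ∞ χ
  smooth_weak : ContDiff ℝ ∞ η
  zero_strong : ∀ t, s * t ≤ 0 → χ t = 0
  integrable : Integrable W
  nonneg : ∀ t, 0 ≤ W t
  -- In both Young inequalities `r` stands for `|ψ|²`. The coefficient `1/2` lets the quartic term
  -- be absorbed, and `W` is the integrable remainder.
  young_deriv : ∀ t r b : ℝ, 0 ≤ r → r ≤ 1 → 1 ≤ b →
    b * (deriv χ t ^ 2 * r) ≤ 1 / 2 * (χ t ^ 2 * r ^ 2) + b ^ 2 * W t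
  young_weak : ∀ t r b : ℝ, 0 ≤ r → r ≤ 1 → 1 ≤ b →
    b * (η t ^ 2 * r) ≤ χ t ^ 2 * r ^ 2 + b ^ 2 * W t
  deriv_weak : ∀ t, deriv η t ^ 2 ≤ c
  strong_sq : ∀ t, 4 ≤ s * t → χ t ^ 2 = |t| ^ 3 / Real.log |t| ^ 2
  weak_sq : ∀ t, 4 ≤ s * t → η t ^ 2 = |t| / Real.log |t| ^ 2

theorem WeightPair.mirror {χ η W : ℝ → ℝ} {c : ℝ} (h : WeightPair 1 χ η W c) :
    WeightPair (-1) (fun t => χ (-t)) (fun t => η (-t)) (fun t => W (-t)) c where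
  smooth_strong := h.smooth_strong.comp contDiff_neg
  smooth_weak := h.smooth_weak.comp contDiff_neg
  zero_strong t ht := h.zero_strong (-t) (by linarith)
  integrable := h.integrable.comp_neg
  nonneg t := h.nonneg _
  young_deriv t r b h0 h1 hb := by
    simpa [deriv_comp_neg] using h.young_deriv (-t) r b h0 h1 hb
  young_weak t r b h0 h1 hb := h.young_weak (-t) r b h0 h1 hb
  deriv_weak t := by simpa [deriv_comp_neg] using h.deriv_weak (-t)
  strong_sq t ht := by simpa using h.strong_sq (-t) (by linarith)
  weak_sq t ht := by simpa using h.weak_sq (-t) (by linarith)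

theorem one_le_log {t : ℝ} (ht : 4 ≤ t) : 1 ≤ Real.log t := by
  rw [Real.le_log_iff_exp_le (by linarith)]
  linarith [Real.exp_one_lt_d9]

/-- A smooth step, `0` on `(-∞, 2]` and `1` on `[3, ∞)`, times `f`. -/
def stepMul (f : ℝ → ℝ) (t : ℝ) : ℝ := Real.smoothTransition (t - 2) * f t

theorem stepMul_of_le (f : ℝ → ℝ) {t : ℝ} (ht : t ≤ 2) : stepMul f t = 0 := by
  rw [stepMul, Real.smoothTransition.zero_of_nonpos (by linarith), zero_mul]

theorem stepMul_of_ge (f : ℝ → ℝ) {t : ℝ} (ht : 3 ≤ t) : stepMul f t = f t := by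
  rw [stepMul, Real.smoothTransition.one_of_one_le (by linarith), one_mul]

theorem contDiff_stepMul {f : ℝ → ℝ} (hf : ∀ t, 1 < t → ContDiffAt ℝ ∞ f t) :
    ContDiff ℝ ∞ (stepMul f) := by
  rw [contDiff_iff_contDiffAt]
  intro t
  rcases lt_or_ge 1 t with h | h
  · exact ((Real.smoothTransition.contDiff.comp
      (contDiff_id.sub contDiff_const)).contDiffAt).mul (hf t h)
  · have : stepMul f =ᶠ[𝓝 t] fun _ => 0 := by
      filter_upwards [gt_mem_nhds (show t < 2 by linarith)] with y hy
        using stepMul_of_le f hy.le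
    exact contDiffAt_const.congr_of_eventuallyEq this

theorem deriv_stepMul_of_lt (f : ℝ → ℝ) {t : ℝ} (ht : t < 2) : deriv (stepMul f) t = 0 := by
  have : stepMul f =ᶠ[𝓝 t] fun _ => 0 := by
    filter_upwards [gt_mem_nhds ht] with y hy using stepMul_of_le f hy.le
  rw [this.deriv_eq, deriv_const]

theorem deriv_stepMul_of_gt (f : ℝ → ℝ) {t : ℝ} (ht : 3 < t) :
    deriv (stepMul f) t = deriv f t := by
  have : stepMul f =ᶠ[𝓝 t] f := by
    filter_upwards [lt_mem_nhds ht] with y hy using stepMul_of_ge f hy.le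
  exact this.deriv_eq

theorem hasDerivAt_strong {t : ℝ} (ht : 1 < t) :
    HasDerivAt (fun t => t * √t / Real.log t)
      (√t * (3 / 2 * Real.log t - 1) / Real.log t ^ 2) t := by
  have h0 : 0 < t := by linarith
  have hL : 0 < Real.log t := Real.log_pos ht
  have h1 := ((hasDerivAt_id t).mul (Real.hasDerivAt_sqrt h0.ne')).div
    (Real.hasDerivAt_log h0.ne') hL.ne'
  refine h1.congr_deriv ?_
  have hs : 0 < √t := Real.sqrt_pos.2 h0
  have e : √t ^ 2 = t := Real.sq_sqrt h0.le
  simp only [id, Pi.mul_apply]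
  congr 1
  have : t * (1 / (2 * √t)) = √t / 2 := by
    field_simp; rw [e]
  rw [this]
  field_simp
  ring

theorem hasDerivAt_weak {t : ℝ} (ht : 1 < t) :
    HasDerivAt (fun t => √t / Real.log t)
      ((1 / 2 * Real.log t - 1) / (√t * Real.log t ^ 2)) t := by
  have h0 : 0 < t := by linarith
  have hL : 0 < Real.log t := Real.log_pos ht
  have h1 := (Real.hasDerivAt_sqrt h0.ne').div (Real.hasDerivAt_log h0.ne') hL.ne'
  refine h1.congr_deriv ?_
  have hs : 0 < √t := Real.sqrt_pos.2 h0
  have e : √t ^ 2 = t := Real.sq_sqrt h0.le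
  have : √t * t⁻¹ = 1 / √t := by
    field_simp; rw [e]
  rw [this]
  field_simp

theorem contDiffAt_sqrt_log {t : ℝ} (ht : 1 < t) :
    ContDiffAt ℝ ∞ (fun t => √t / Real.log t) t :=
  (Real.contDiffAt_sqrt (by linarith)).div (Real.contDiffAt_log.2 (by linarith))
    (Real.log_pos ht).ne'

/-- The antiderivative is `-1 / log t`. Without the logarithm in the weights the Young remainder
would be `1/t`, which is not integrable. -/
theorem integrableOn_inv_mul_log_sq :
    IntegrableOn (fun t : ℝ => 1 / (t * Real.log t ^ 2)) (Ioi 4) := by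
  have hd : ∀ x ∈ Ici (4 : ℝ), HasDerivAt (fun t => -(Real.log t)⁻¹)
      (1 / (x * Real.log x ^ 2)) x := by
    intro x hx
    have hx0 : (0 : ℝ) < x := by linarith [mem_Ici.1 hx]
    have hL : 0 < Real.log x := Real.log_pos (by linarith [mem_Ici.1 hx])
    refine ((Real.hasDerivAt_log hx0.ne').inv hL.ne').neg.congr_deriv ?_
    field_simp
  refine integrableOn_Ioi_deriv_of_nonneg' hd (fun x hx => ?_)
    (l := 0) ?_
  · have : (0 : ℝ) < x := by linarith [mem_Ioi.1 hx]
    positivity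
  · simpa using (Real.tendsto_log_atTop.inv_tendsto_atTop).neg

/-- The weights are `t^(3/2) / log t` and `t^(1/2) / log t`, switched on between `2` and `3`. Beyond
`4`, where `log t ≥ 1`, both `χ'²` and `η²` are at most a multiple of `t / log² t`, and Young's
inequality in the variable `t² r` applies. On `[2, 4]` continuity bounds everything by constants,
which are put into `W` using `r ≤ 1` and `b ≤ b²`. -/
theorem exists_weightPair : ∃ χ η W c, WeightPair 1 χ η W c := by
  set f : ℝ → ℝ := fun t => t * √t / Real.log t with hf
  set g : ℝ → ℝ := fun t => √t / Real.log t with hg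
  have sχ : ContDiff ℝ ∞ (stepMul f) := contDiff_stepMul fun t ht => by
    have := (contDiffAt_id (x := t) (n := ∞) (𝕜 := ℝ)).mul (contDiffAt_sqrt_log ht)
    simpa [hf, mul_div_assoc] using this
  have sη : ContDiff ℝ ∞ (stepMul g) := contDiff_stepMul fun t ht => contDiffAt_sqrt_log ht
  obtain ⟨c1, hc1⟩ := isCompact_Icc.exists_bound_of_continuousOn (s := Icc (2 : ℝ) 4)
    ((sχ.continuous_deriv (by simp)).pow 2).continuousOn
  obtain ⟨c2, hc2⟩ := isCompact_Icc.exists_bound_of_continuousOn (s := Icc (2 : ℝ) 4)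
    (sη.continuous.pow 2).continuousOn
  obtain ⟨c3, hc3⟩ := isCompact_Icc.exists_bound_of_continuousOn (s := Icc (2 : ℝ) 4)
    ((sη.continuous_deriv (by simp)).pow 2).continuousOn
  replace hc1 : ∀ t ∈ Icc (2 : ℝ) 4, deriv (stepMul f) t ^ 2 ≤ c1 :=
    fun t ht => (le_abs_self _).trans (hc1 t ht)
  replace hc2 : ∀ t ∈ Icc (2 : ℝ) 4, stepMul g t ^ 2 ≤ c2 :=
    fun t ht => (le_abs_self _).trans (hc2 t ht)
  replace hc3 : ∀ t ∈ Icc (2 : ℝ) 4, deriv (stepMul g) t ^ 2 ≤ c3 :=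
    fun t ht => (le_abs_self _).trans (hc3 t ht)
  have hc10 : 0 ≤ c1 := (sq_nonneg _).trans (hc1 2 (by norm_num))
  have hc20 : 0 ≤ c2 := (sq_nonneg _).trans (hc2 2 (by norm_num))
  have hc30 : 0 ≤ c3 := (sq_nonneg _).trans (hc3 2 (by norm_num))
  set W : ℝ → ℝ := fun t => (Icc 2 4).indicator (fun _ => c1 + c2) t
    + (Ioi 4).indicator (fun t => 3 * (1 / (t * Real.log t ^ 2))) t with hW
  have hW0 : ∀ t, 0 ≤ W t := fun t => add_nonneg
    (indicator_nonneg (fun _ _ => by positivity) _)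
    (indicator_nonneg (fun x hx => by
      have : (0 : ℝ) < x := by linarith [mem_Ioi.1 hx]
      positivity) _)
  have hWmid : ∀ t ∈ Icc (2 : ℝ) 4, W t = c1 + c2 := fun t ht => by
    have : t ∉ Ioi (4 : ℝ) := not_lt.2 ht.2
    simp only [hW, indicator_of_mem ht, indicator_of_notMem this, add_zero]
  have hWfar : ∀ t, 4 < t → W t = 3 * (1 / (t * Real.log t ^ 2)) := fun t ht => by
    have h1 : t ∉ Icc (2 : ℝ) 4 := fun h => absurd h.2 (not_le.2 ht)
    have h2 : t ∈ Ioi (4 : ℝ) := ht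
    simp only [hW, indicator_of_mem h2, indicator_of_notMem h1, zero_add]
  have hχsq : ∀ t, 4 ≤ t → stepMul f t ^ 2 = t ^ 3 / Real.log t ^ 2 := fun t ht => by
    rw [stepMul_of_ge f (by linarith)]
    simp only [hf]
    rw [div_pow, mul_pow, Real.sq_sqrt (by linarith)]
    ring
  have hηsq : ∀ t, 4 ≤ t → stepMul g t ^ 2 = t / Real.log t ^ 2 := fun t ht => by
    rw [stepMul_of_ge g (by linarith)]
    simp only [hg]
    rw [div_pow, Real.sq_sqrt (by linarith)]
  have hχd : ∀ t, 4 < t → deriv (stepMul f) t ^ 2 ≤ 9 / 4 * (t / Real.log t ^ 2) := by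
    intro t ht
    have hL := one_le_log ht.le
    rw [deriv_stepMul_of_gt f (by linarith), (hasDerivAt_strong (by linarith)).deriv, div_pow,
      mul_pow, Real.sq_sqrt (by linarith), ← mul_div_assoc,
      div_le_div_iff₀ (by positivity) (by positivity)]
    have h1 : (3 / 2 * Real.log t - 1) ^ 2 ≤ 9 / 4 * Real.log t ^ 2 := by nlinarith
    have h2 : 0 ≤ t * Real.log t ^ 2 := by positivity
    calc t * (3 / 2 * Real.log t - 1) ^ 2 * Real.log t ^ 2
        = (t * Real.log t ^ 2) * (3 / 2 * Real.log t - 1) ^ 2 := by ring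
      _ ≤ (t * Real.log t ^ 2) * (9 / 4 * Real.log t ^ 2) := by gcongr
      _ = 9 / 4 * t * (Real.log t ^ 2) ^ 2 := by ring
  have young : ∀ {t r b k : ℝ}, 4 < t → 0 ≤ r → 0 ≤ k → k ≤ 9 / 4 → ∀ q : ℝ, 1 / 2 ≤ q →
      b * (k * (t / Real.log t ^ 2) * r)
        ≤ q * (t ^ 3 / Real.log t ^ 2 * r ^ 2) + b ^ 2 * W t := by
    intro t r b k ht hr hk hk' q hq
    have hL := one_le_log ht.le
    rw [hWfar t ht]
    have h0 : 0 < t * Real.log t ^ 2 := by positivity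
    -- With `u = t² r`, `b k u ≤ u²/2 + b² k²/2` and `k²/2 ≤ 81/32 < 3`; this is the source of the
    -- factor `3` in `W`.
    have key : b * k * (t ^ 2 * r) ≤ q * (t ^ 2 * r) ^ 2 + 3 * b ^ 2 := by
      set u := t ^ 2 * r
      have h1 : 1 / 2 * u ^ 2 ≤ q * u ^ 2 := by gcongr
      have h2 : k ^ 2 ≤ 81 / 16 := by nlinarith
      nlinarith [sq_nonneg (u - b * k), sq_nonneg b]
    calc b * (k * (t / Real.log t ^ 2) * r)
        = (b * k * (t ^ 2 * r)) / (t * Real.log t ^ 2) := by field_simp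
      _ ≤ (q * (t ^ 2 * r) ^ 2 + 3 * b ^ 2) / (t * Real.log t ^ 2) := by gcongr
      _ = _ := by field_simp
  refine ⟨stepMul f, stepMul g, W, max c3 1, sχ, sη, ?_, ?_, hW0, ?_, ?_, ?_, ?_, ?_⟩
  · intro t ht
    exact stepMul_of_le f (by linarith)
  · refine Integrable.add ?_ ?_
    · exact (integrable_indicator_iff measurableSet_Icc).2 (integrableOn_const (by simp))
    · exact (integrable_indicator_iff measurableSet_Ioi).2
        (integrableOn_inv_mul_log_sq.const_mul 3)
  · intro t r b hr hr1 hb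
    have hpos : 0 ≤ 1 / 2 * (stepMul f t ^ 2 * r ^ 2) := by positivity
    rcases lt_or_ge t 2 with h | h
    · rw [deriv_stepMul_of_lt f h]
      have := mul_nonneg (sq_nonneg b) (hW0 t)
      simp only [ne_eq, OfNat.ofNat_ne_zero, not_false_eq_true, zero_pow, zero_mul, mul_zero]
      linarith
    rcases le_or_gt t 4 with h4 | h4
    · have h1 := hc1 t ⟨h, h4⟩
      rw [hWmid t ⟨h, h4⟩]
      have h2 : b * (deriv (stepMul f) t ^ 2 * r) ≤ b * (c1 * 1) := by gcongr
      have h3 : b ≤ b ^ 2 := by nlinarith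
      nlinarith [mul_le_mul_of_nonneg_right h3 hc10, mul_nonneg (sq_nonneg b) hc20]
    · have h1 : b * (deriv (stepMul f) t ^ 2 * r) ≤ b * (9 / 4 * (t / Real.log t ^ 2) * r) := by
        gcongr
        exact hχd t h4
      rw [hχsq t h4.le]
      exact h1.trans (young h4 hr (by norm_num) le_rfl _ le_rfl)
  · intro t r b hr hr1 hb
    have hpos : 0 ≤ stepMul f t ^ 2 * r ^ 2 := by positivity
    rcases lt_or_ge t 2 with h | h
    · rw [stepMul_of_le g h.le]
      have := mul_nonneg (sq_nonneg b) (hW0 t)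
      simp only [ne_eq, OfNat.ofNat_ne_zero, not_false_eq_true, zero_pow, zero_mul, mul_zero]
      linarith
    rcases le_or_gt t 4 with h4 | h4
    · have h1 := hc2 t ⟨h, h4⟩
      rw [hWmid t ⟨h, h4⟩]
      have h2 : b * (stepMul g t ^ 2 * r) ≤ b * (c2 * 1) := by gcongr
      have h3 : b ≤ b ^ 2 := by nlinarith
      nlinarith [mul_le_mul_of_nonneg_right h3 hc20, mul_nonneg (sq_nonneg b) hc10]
    · rw [hχsq t h4.le, hηsq t h4.le]
      have := young (b := b) h4 hr zero_le_one (by norm_num) 1 (by norm_num)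
      simpa using this
  · intro t
    rcases lt_or_ge t 2 with h | h
    · rw [deriv_stepMul_of_lt g h]
      simp
    rcases le_or_gt t 4 with h4 | h4
    · have h1 := hc3 t ⟨h, h4⟩
      exact h1.trans (le_max_left _ _)
    · refine le_trans ?_ (le_max_right _ _)
      have hL := one_le_log h4.le
      rw [deriv_stepMul_of_gt g (by linarith), (hasDerivAt_weak (by linarith)).deriv, div_pow,
        mul_pow, Real.sq_sqrt (by linarith), div_le_one (by positivity)]
      have h1 : (1 / 2 * Real.log t - 1) ^ 2 ≤ Real.log t ^ 2 := by nlinarith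
      have h2 : Real.log t ^ 2 ≤ (Real.log t ^ 2) ^ 2 := by
        have : 1 ≤ Real.log t ^ 2 := one_le_pow₀ hL
        nlinarith
      nlinarith [sq_nonneg (Real.log t ^ 2)]
  · intro t ht
    rw [one_mul] at ht
    rw [abs_of_pos (by linarith), hχsq t ht]
  · intro t ht
    rw [one_mul] at ht
    rw [abs_of_pos (by linarith), hηsq t ht]

/-- From `log t = 2 log √t ≤ 2 (√t - 1)` follows `log² t ≤ 4t`. -/
theorem quarter_le_div_log_sq {t : ℝ} (ht : 4 ≤ t) : 1 / 4 ≤ t / Real.log t ^ 2 := by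
  have hL := one_le_log ht
  have h1 : Real.log √t ≤ √t - 1 := Real.log_le_sub_one_of_pos (Real.sqrt_pos.2 (by linarith))
  rw [Real.log_sqrt (by linarith)] at h1
  have h2 : √t ^ 2 = t := Real.sq_sqrt (by linarith)
  rw [div_le_div_iff₀ (by norm_num) (by positivity)]
  nlinarith [Real.sqrt_nonneg t]

/-! ### A priori estimates for near-minimizers -/

/-- The function `W(x₂)` restricted to the strip. -/
def stripWeight (R : ℝ) (W : ℝ → ℝ) (x : ℝ × ℝ) : ℝ :=
  (Ioo (-R / 2) (R / 2)).indicator (fun _ => 1) x.1 * W x.2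

theorem integrable_stripWeight (R : ℝ) {W : ℝ → ℝ} (hW : Integrable W) :
    Integrable (stripWeight R W) := by
  have : Integrable ((Ioo (-R / 2) (R / 2)).indicator fun _ : ℝ => (1 : ℝ)) :=
    (integrable_indicator_iff measurableSet_Ioo).2 (integrableOn_const (by simp))
  exact this.mul_prod hW

theorem integral_stripWeight {R : ℝ} (hR : 0 ≤ R) (W : ℝ → ℝ) :
    ∫ x, stripWeight R W x = R * ∫ t, W t := by
  have h1 : ∫ t, (Ioo (-R / 2) (R / 2)).indicator (fun _ : ℝ => (1 : ℝ)) t = R := by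
    rw [integral_indicator measurableSet_Ioo, setIntegral_const, smul_eq_mul, mul_one,
      Measure.real, Real.volume_Ioo, show R / 2 - -R / 2 = R by ring, ENNReal.toReal_ofReal hR]
  have h2 := integral_prod_mul (μ := volume) (ν := volume)
    ((Ioo (-R / 2) (R / 2)).indicator (fun _ : ℝ => (1 : ℝ))) W
  rw [h1] at h2
  exact h2

theorem stripWeight_nonneg (R : ℝ) {W : ℝ → ℝ} (hW : ∀ t, 0 ≤ W t) (x : ℝ × ℝ) :
    0 ≤ stripWeight R W x :=
  mul_nonneg (indicator_nonneg (fun _ _ => zero_le_one) _) (hW _)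

/-- A pointwise bound by `W(x₂)` where `ψ ≠ 0` gives a bound of the integral by `R ∫ W`. -/
theorem integral_le_add_stripWeight {R κ : ℝ} (hR : 0 ≤ R) (hκ : 0 ≤ κ) {W : ℝ → ℝ}
    (hW : Integrable W) (hW0 : ∀ t, 0 ≤ W t) (h : IsTest (strip R) ψ) {f g : ℝ × ℝ → ℝ}
    (hf : Integrable f) (hg : Integrable g) (h1 : ∀ x, f x ≤ g x + κ * W x.2)
    (h2 : ∀ x, ψ x = 0 → f x ≤ g x) : ∫ x, f x ≤ (∫ x, g x) + κ * (R * ∫ t, W t) := by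
  have i1 := (integrable_stripWeight R hW).const_mul κ
  rw [← integral_stripWeight hR, ← integral_const_mul, ← integral_add hg i1]
  refine integral_mono hf (hg.add i1) fun x => ?_
  by_cases hx : ψ x = 0
  · exact (h2 x hx).trans
      (le_add_of_nonneg_right (mul_nonneg hκ (stripWeight_nonneg R hW0 x)))
  · have hx1 : x.1 ∈ Ioo (-R / 2) (R / 2) := (h.supp (subset_tsupport _ hx)).1
    simpa [stripWeight, hx1] using h1 x

theorem deriv_sq_comp {χ : ℝ → ℝ} (hχ : ContDiff ℝ ∞ χ) (t : ℝ) :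
    deriv (fun t => χ t ^ 2) t = 2 * χ t * deriv χ t := by
  have h1 : HasDerivAt (fun t => χ t ^ 2) _ t :=
    ((hχ.differentiable (by simp)) t).hasDerivAt.pow 2
  simpa using h1.deriv

/-- The IMS localization formula: pairing the gradient of `ψ` with that of `χ²ψ` gives `|(∇ -
iσA₀)(χψ)|² - χ'²|ψ|²`. -/
theorem IsTest.firstVar_sq_eq (h : IsTest U ψ) (a b : ℝ) {χ : ℝ → ℝ} (hχ : ContDiff ℝ ∞ χ) :
    firstVar a b (fun t => χ t ^ 2) ψ
      = b * ((∫ x, gradSq a (MagneticStep.wmul χ ψ) x)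
          - ∫ x : ℝ × ℝ, deriv χ x.2 ^ 2 * ‖ψ x‖ ^ 2)
        - (∫ x : ℝ × ℝ, χ x.2 ^ 2 * ‖ψ x‖ ^ 2) + ∫ x : ℝ × ℝ, χ x.2 ^ 2 * ‖ψ x‖ ^ 4 := by
  have c1 := hχ.continuous
  have c2 : Continuous (deriv χ) := hχ.continuous_deriv (by simp)
  have i1 := (h.wmul hχ).integrable_gradSq a
  have i2 := h.integrable_weight_normSq (c2.pow 2)
  have i3 := h.integrable_weight_normSq (c1.pow 2)
  have i4 := h.integrable_weight_norm_pow_four (c1.pow 2)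
  have i5 : Integrable fun x : ℝ × ℝ => b * (gradSq a (MagneticStep.wmul χ ψ) x
      - (deriv χ ^ 2) x.2 * ‖ψ x‖ ^ 2) := (i1.sub i2).const_mul b
  have i6 : Integrable fun x : ℝ × ℝ => b * (gradSq a (MagneticStep.wmul χ ψ) x
      - (deriv χ ^ 2) x.2 * ‖ψ x‖ ^ 2) - (χ ^ 2) x.2 * ‖ψ x‖ ^ 2 := i5.sub i3
  have : firstVar a b (fun t => χ t ^ 2) ψ = ∫ x : ℝ × ℝ,
      (b * (gradSq a (MagneticStep.wmul χ ψ) x - (deriv χ ^ 2) x.2 * ‖ψ x‖ ^ 2)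
        - (χ ^ 2) x.2 * ‖ψ x‖ ^ 2 + (χ ^ 2) x.2 * ‖ψ x‖ ^ 4) := by
    refine integral_congr_ae (ae_of_all _ fun x => ?_)
    simp only [h.gradSq_wmul hχ, deriv_sq_comp hχ, Pi.pow_apply]
    ring
  rw [this, integral_add i6 i4, integral_sub i5 i3, integral_const_mul, integral_sub i1 i2]
  rfl

/-- The one-sided spectral bound and `b|a| ≥ 1` cancel the term `-χ²|ψ|²` of the first variation,
leaving `∫ χ²|ψ|⁴ ≤ b ∫ χ'²|ψ|² + δ`. Young's inequality bounds the right side by half of the left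
side plus `b² R ∫ W`. -/
theorem WeightPair.integral_strong_le {s c : ℝ} {χ η W : ℝ → ℝ} (hw : WeightPair s χ η W c)
    (hs : s = 1 ∨ s = -1) {a b R δ : ℝ} (ha : -1 ≤ a) (ha' : a < 0) (hb : 1 ≤ b)
    (hab : 1 ≤ b * |a|) (hR : 0 ≤ R) (h : IsTest (strip R) ψ) (h1 : ∀ x, ‖ψ x‖ ≤ 1)
    (hv : firstVar a b (fun t => χ t ^ 2) ψ ≤ δ) :
    ∫ x : ℝ × ℝ, χ x.2 ^ 2 * ‖ψ x‖ ^ 4 ≤ 2 * (b ^ 2 * (R * ∫ t, W t)) + 2 * δ := by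
  have hχ := hw.smooth_strong
  have c1 := hχ.continuous
  have c2 : Continuous (deriv χ) := hχ.continuous_deriv (by simp)
  have h0 : (∀ t ≤ 0, χ t = 0) ∨ (∀ t, 0 ≤ t → χ t = 0) := by
    rcases hs with rfl | rfl
    · exact Or.inl fun t ht => hw.zero_strong t (by linarith)
    · exact Or.inr fun t ht => hw.zero_strong t (by linarith)
  have hlow := abs_mul_integral_wmul_le ha ha' h hχ h0
  have e1 : ∫ x, ‖wmul χ ψ x‖ ^ 2 = ∫ x : ℝ × ℝ, χ x.2 ^ 2 * ‖ψ x‖ ^ 2 := by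
    refine integral_congr_ae (ae_of_all _ fun x => ?_)
    simp only [norm_wmul, mul_pow, sq_abs]
  rw [e1] at hlow
  rw [h.firstVar_sq_eq a b hχ] at hv
  have hN : 0 ≤ ∫ x : ℝ × ℝ, χ x.2 ^ 2 * ‖ψ x‖ ^ 2 := integral_nonneg fun x => by positivity
  have h2 : ∫ x : ℝ × ℝ, χ x.2 ^ 2 * ‖ψ x‖ ^ 2 ≤ b * ∫ x, gradSq a (wmul χ ψ) x := by
    calc _ ≤ (b * |a|) * ∫ x : ℝ × ℝ, χ x.2 ^ 2 * ‖ψ x‖ ^ 2 := le_mul_of_one_le_left hN hab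
      _ = b * (|a| * ∫ x : ℝ × ℝ, χ x.2 ^ 2 * ‖ψ x‖ ^ 2) := by ring
      _ ≤ _ := by gcongr
  have h3 := integral_le_add_stripWeight (κ := b ^ 2) hR (by positivity) hw.integrable hw.nonneg h
    ((h.integrable_weight_normSq (c2.pow 2)).const_mul b)
    ((h.integrable_weight_norm_pow_four (c1.pow 2)).const_mul (1 / 2))
    (fun x => by
      have := hw.young_deriv x.2 (‖ψ x‖ ^ 2) b (by positivity)
        (pow_le_one₀ (norm_nonneg _) (h1 x)) hb
      rw [← norm_pow_four_eq] at this
      exact this)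
    (fun x hx => by simp [hx])
  rw [integral_const_mul, integral_const_mul] at h3
  simp only [Pi.pow_apply] at h3
  linarith

/-- This converts quartic decay into quadratic decay with a weaker weight. The factor `b` on the
left turns the order `b²R` of the quartic bound into `bR`. -/
theorem WeightPair.integral_weak_le {s c : ℝ} {χ η W : ℝ → ℝ} (hw : WeightPair s χ η W c)
    {b R : ℝ} (hb : 1 ≤ b) (hR : 0 ≤ R) (h : IsTest (strip R) ψ) (h1 : ∀ x, ‖ψ x‖ ≤ 1) :
    b * ∫ x : ℝ × ℝ, η x.2 ^ 2 * ‖ψ x‖ ^ 2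
      ≤ (∫ x : ℝ × ℝ, χ x.2 ^ 2 * ‖ψ x‖ ^ 4) + b ^ 2 * (R * ∫ t, W t) := by
  have h3 := integral_le_add_stripWeight (κ := b ^ 2) hR (by positivity) hw.integrable hw.nonneg h
    ((h.integrable_weight_normSq (hw.smooth_weak.continuous.pow 2)).const_mul b)
    (h.integrable_weight_norm_pow_four (hw.smooth_strong.continuous.pow 2))
    (fun x => by
      have := hw.young_weak x.2 (‖ψ x‖ ^ 2) b (by positivity)
        (pow_le_one₀ (norm_nonneg _) (h1 x)) hb
      rw [← norm_pow_four_eq] at this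
      exact this)
    (fun x hx => by simp [hx])
  rw [integral_const_mul] at h3
  exact h3

/-- No spectral information is used here: the mass is already controlled, so in the variation along
`η²ψ` the cross term is absorbed by half of the kinetic term at the cost of `η'² ≤ c`. -/
theorem WeightPair.integral_weak_gradSq_le {s c : ℝ} {χ η W : ℝ → ℝ}
    (hw : WeightPair s χ η W c) {a b δ : ℝ} (hb : 1 ≤ b) (h : IsTest U ψ)
    (hv : firstVar a b (fun t => η t ^ 2) ψ ≤ δ) :
    b * ∫ x : ℝ × ℝ, η x.2 ^ 2 * gradSq a ψ x
      ≤ 2 * (∫ x : ℝ × ℝ, η x.2 ^ 2 * ‖ψ x‖ ^ 2) + 4 * b * c * (∫ x, ‖ψ x‖ ^ 2) + 2 * δ := by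
  have hη := hw.smooth_weak
  have c1 := hη.continuous
  have c2 : Continuous (deriv η) := hη.continuous_deriv (by simp)
  have iF := h.integrable_firstVar a b (hη.pow 2)
  have iN := h.integrable_weight_normSq (c1.pow 2)
  have i1 : Integrable fun x : ℝ × ℝ => 2 * (η x.2 ^ 2 * ‖ψ x‖ ^ 2) := iN.const_mul 2
  have i2 : Integrable fun x : ℝ × ℝ => 4 * b * c * ‖ψ x‖ ^ 2 :=
    h.integrable_normSq.const_mul _
  have i12 : Integrable fun x : ℝ × ℝ => 2 * (η x.2 ^ 2 * ‖ψ x‖ ^ 2)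
    + 4 * b * c * ‖ψ x‖ ^ 2 := i1.add i2
  have i3 := iF.const_mul 2
  have key : b * ∫ x : ℝ × ℝ, η x.2 ^ 2 * gradSq a ψ x
      ≤ 2 * (∫ x : ℝ × ℝ, η x.2 ^ 2 * ‖ψ x‖ ^ 2) + 4 * b * c * (∫ x, ‖ψ x‖ ^ 2)
        + 2 * firstVar a b (fun t => η t ^ 2) ψ := by
    rw [← integral_const_mul, ← integral_const_mul, ← integral_const_mul, firstVar,
      ← integral_const_mul, ← integral_add i1 i2, ← integral_add i12 i3]
    refine integral_mono ((h.integrable_weight_gradSq a (c1.pow 2)).const_mul b)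
      (i12.add i3) fun x => ?_
    simp only [deriv_sq_comp hη]
    set y := η x.2
    set y' := deriv η x.2
    set g := gradSq a ψ x
    set r := ‖ψ x‖ ^ 2
    have hr : 0 ≤ r := sq_nonneg _
    have hg : 0 ≤ g := gradSq_nonneg a ψ x
    have hc : crossRe ψ x ^ 2 ≤ r * g := crossRe_sq_le a ψ x
    have hy' : y' ^ 2 ≤ c := hw.deriv_weak x.2
    have hcross : -(4 * (y * y' * crossRe ψ x)) ≤ y ^ 2 * g + 4 * y' ^ 2 * r := by
      by_contra hcon
      push Not at hcon
      have h1 : (y * y' * crossRe ψ x) ^ 2 ≤ (y ^ 2 * g) * (y' ^ 2 * r) := by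
        have := mul_le_mul_of_nonneg_left hc (by positivity : 0 ≤ y ^ 2 * y' ^ 2)
        nlinarith
      have h2 : 0 ≤ y ^ 2 * g := by positivity
      have h3 : 0 ≤ y' ^ 2 * r := by positivity
      nlinarith [sq_nonneg (y ^ 2 * g - 4 * (y' ^ 2 * r))]
    have h4 : y' ^ 2 * r ≤ c * r := mul_le_mul_of_nonneg_right hy' hr
    have h5 : 0 ≤ y ^ 2 * ‖ψ x‖ ^ 4 := by positivity
    have h6 : b * (-(4 * (y * y' * crossRe ψ x))) ≤ b * (y ^ 2 * g + 4 * (c * r)) := by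
      refine mul_le_mul_of_nonneg_left ?_ (by linarith)
      linarith
    linarith
  linarith

/-- The arithmetic of the a priori estimates. -/
theorem apriori_arith {I c b R δ N G Q X₁ X₂ Y₁ Y₂ Z₁ Z₂ : ℝ} (hI : 0 ≤ I) (hc : 0 ≤ c)
    (hb : 1 ≤ b) (hR : 0 ≤ R) (hδ : δ ≤ R) (hQ : 0 ≤ Q)
    (hX₁ : X₁ ≤ 2 * (b ^ 2 * (R * I)) + 2 * δ) (hX₂ : X₂ ≤ 2 * (b ^ 2 * (R * I)) + 2 * δ)
    (hY₁ : b * Y₁ ≤ X₁ + b ^ 2 * (R * I)) (hY₂ : b * Y₂ ≤ X₂ + b ^ 2 * (R * I))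
    (hZ₁ : b * Z₁ ≤ 2 * Y₁ + 4 * b * c * N + 2 * δ)
    (hZ₂ : b * Z₂ ≤ 2 * Y₂ + 4 * b * c * N + 2 * δ)
    (hN : N ≤ 4 * (Y₁ + Y₂) + 1 * (R * (2 * 4))) (hE : b * G - N + 1 / 2 * Q ≤ δ) :
    Z₁ + Z₂ + (Y₁ + Y₂)
        ≤ (22 * (I + 1) + 8 * c * (8 + 24 * (I + 1)) + 2 * (8 + 24 * (I + 1)) + 5) * b * R ∧
      X₁ + X₂
        ≤ (22 * (I + 1) + 8 * c * (8 + 24 * (I + 1)) + 2 * (8 + 24 * (I + 1)) + 5) * b ^ 2 * R ∧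
      b * G + N
        ≤ (22 * (I + 1) + 8 * c * (8 + 24 * (I + 1)) + 2 * (8 + 24 * (I + 1)) + 5) * b * R := by
  -- `X`, `Y`, `Z` are the weighted integrals of `|ψ|⁴`, `|ψ|²` and the squared gradient on the two
  -- sides; `N`, `G`, `Q` are the unweighted mass, kinetic and quartic integrals. `K` is the
  -- constant in `N ≤ K b R`: each `Y ≤ 3 (I + 1) b R` enters with factor `4`, and the region `|x₂|
  -- ≤ 4` adds `8R ≤ 8bR`.
  obtain ⟨K, hK⟩ : ∃ K, K = 8 + 24 * (I + 1) := ⟨_, rfl⟩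
  rw [← hK]
  have hK0 : 0 ≤ K := by rw [hK]; positivity
  have hcK : 0 ≤ c * K := by positivity
  have hb0 : 0 < b := by linarith
  have hbR : R ≤ b * R := le_mul_of_one_le_left hR hb
  have hbbR : R ≤ b ^ 2 * R := le_mul_of_one_le_left hR (one_le_pow₀ hb)
  have hbb : 0 ≤ b ^ 2 * R := by positivity
  have hbR0 : 0 ≤ b * R := by positivity
  have xx : ∀ X : ℝ, X ≤ 2 * (b ^ 2 * (R * I)) + 2 * δ → X ≤ b ^ 2 * R * (2 * (I + 1)) := by
    intro X hX
    calc X ≤ 2 * (b ^ 2 * (R * I)) + 2 * (b ^ 2 * R) := by linarith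
      _ = _ := by ring
  have yy : ∀ X Y : ℝ, X ≤ b ^ 2 * R * (2 * (I + 1)) → b * Y ≤ X + b ^ 2 * (R * I) →
      Y ≤ b * R * (3 * (I + 1)) := by
    intro X Y hX hY
    refine le_of_mul_le_mul_left ?_ hb0
    calc b * Y ≤ b ^ 2 * R * (2 * (I + 1)) + b ^ 2 * (R * I) + b ^ 2 * R := by linarith
      _ = b * (b * R * (3 * (I + 1))) := by ring
  have x1 := xx _ hX₁
  have x2 := xx _ hX₂
  have y1 := yy _ _ x1 hY₁
  have y2 := yy _ _ x2 hY₂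
  have hN' : N ≤ b * R * K := by
    calc N ≤ 8 * (b * R * (3 * (I + 1))) + 8 * (b * R) := by linarith
      _ = b * R * K := by rw [hK]; ring
  have hG' : b * G ≤ b * R * (K + 1) := by linarith
  have zz : ∀ Y Z : ℝ, Y ≤ b * R * (3 * (I + 1)) →
      b * Z ≤ 2 * Y + 4 * b * c * N + 2 * δ → Z ≤ b * R * (6 * (I + 1) + 4 * c * K + 2) := by
    intro Y Z hY hZ
    refine le_of_mul_le_mul_left ?_ hb0
    have s1 : 4 * b * c * N ≤ 4 * b * c * (b * R * K) := by gcongr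
    have s2 : b * R ≤ b * (b * R) := le_mul_of_one_le_left hbR0 hb
    have s3 : b * R * (6 * (I + 1)) ≤ b * (b * R) * (6 * (I + 1)) := by gcongr
    calc b * Z ≤ b * R * (6 * (I + 1)) + 4 * b * c * (b * R * K) + 2 * R := by linarith
      _ ≤ b * (b * R) * (6 * (I + 1)) + 4 * b * c * (b * R * K) + 2 * (b * (b * R)) := by
        linarith
      _ = b * (b * R * (6 * (I + 1) + 4 * c * K + 2)) := by ring
  have z1 := zz _ _ y1 hZ₁
  have z2 := zz _ _ y2 hZ₂
  refine ⟨?_, ?_, ?_⟩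
  · calc Z₁ + Z₂ + (Y₁ + Y₂)
        ≤ b * R * (18 * (I + 1) + 8 * c * K + 4) := by linarith
      _ ≤ b * R * (22 * (I + 1) + 8 * c * K + 2 * K + 5) := by
        refine mul_le_mul_of_nonneg_left ?_ hbR0
        linarith
      _ = _ := by ring
  · calc X₁ + X₂ ≤ b ^ 2 * R * (4 * (I + 1)) := by linarith
      _ ≤ b ^ 2 * R * (22 * (I + 1) + 8 * c * K + 2 * K + 5) := by
        refine mul_le_mul_of_nonneg_left ?_ hbb
        linarith
      _ = _ := by ring
  · calc b * G + N ≤ b * R * (2 * K + 1) := by linarith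
      _ ≤ b * R * (22 * (I + 1) + 8 * c * K + 2 * K + 5) := by
        refine mul_le_mul_of_nonneg_left ?_ hbR0
        linarith
      _ = _ := by ring

/-- The universal a priori estimates, for weights on both sides of the line. -/
theorem exists_apriori_const {χ η W : ℝ → ℝ} {c : ℝ} (hw : WeightPair 1 χ η W c) :
    ∃ C : ℝ, 0 < C ∧ ∀ (a b R δ : ℝ) (ψ : ℝ × ℝ → ℂ), -1 ≤ a → a < 0 → 1 ≤ b → 1 ≤ b * |a| →
      0 ≤ R → δ ≤ R → IsTest (strip R) ψ → (∀ x, ‖ψ x‖ ≤ 1) → energyS a b ψ ≤ δ →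
      firstVar a b (fun t => χ t ^ 2) ψ ≤ δ → firstVar a b (fun t => χ (-t) ^ 2) ψ ≤ δ →
      firstVar a b (fun t => η t ^ 2) ψ ≤ δ → firstVar a b (fun t => η (-t) ^ 2) ψ ≤ δ →
      ((∫ x : ℝ × ℝ, (η x.2 ^ 2 + η (-x.2) ^ 2) * (gradSq a ψ x + ‖ψ x‖ ^ 2)) ≤ C * b * R ∧
        (∫ x : ℝ × ℝ, (χ x.2 ^ 2 + χ (-x.2) ^ 2) * ‖ψ x‖ ^ 4) ≤ C * b ^ 2 * R ∧
        b * (∫ x, gradSq a ψ x) + (∫ x, ‖ψ x‖ ^ 2) ≤ C * b * R) := by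
  set I := ∫ t, W t with hI
  have hI0 : 0 ≤ I := integral_nonneg fun t => hw.nonneg t
  have hc0 : 0 ≤ c := (sq_nonneg _).trans (hw.deriv_weak 0)
  refine ⟨22 * (I + 1) + 8 * c * (8 + 24 * (I + 1)) + 2 * (8 + 24 * (I + 1)) + 5,
    by positivity, ?_⟩
  intro a b R δ ψ ha ha' hb hab hR hδ h h1 hE hv1 hv2 hv3 hv4
  have hw' := hw.mirror
  have hI' : ∫ t, W (-t) = I := integral_neg_eq_self W volume
  have X1 := hw.integral_strong_le (Or.inl rfl) ha ha' hb hab hR h h1 hv1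
  have X2 := hw'.integral_strong_le (Or.inr rfl) ha ha' hb hab hR h h1 hv2
  have Y1 := hw.integral_weak_le hb hR h h1
  have Y2 := hw'.integral_weak_le hb hR h h1
  have Z1 := hw.integral_weak_gradSq_le hb h hv3
  have Z2 := hw'.integral_weak_gradSq_le hb h hv4
  rw [hI'] at X2 Y2
  rw [← hI] at X1 Y1
  have c1 := hw.smooth_weak.continuous
  have c1' := hw'.smooth_weak.continuous
  have c2 := hw.smooth_strong.continuous
  have c2' := hw'.smooth_strong.continuous
  have iX1 := h.integrable_weight_norm_pow_four (c2.pow 2)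
  have iX2 := h.integrable_weight_norm_pow_four (c2'.pow 2)
  have iY1 := h.integrable_weight_normSq (c1.pow 2)
  have iY2 := h.integrable_weight_normSq (c1'.pow 2)
  have iZ1 := h.integrable_weight_gradSq a (c1.pow 2)
  have iZ2 := h.integrable_weight_gradSq a (c1'.pow 2)
  have sX : ∫ x : ℝ × ℝ, (χ x.2 ^ 2 + χ (-x.2) ^ 2) * ‖ψ x‖ ^ 4
      = (∫ x : ℝ × ℝ, χ x.2 ^ 2 * ‖ψ x‖ ^ 4) + ∫ x : ℝ × ℝ, χ (-x.2) ^ 2 * ‖ψ x‖ ^ 4 := by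
    simp only [add_mul]
    exact integral_add iX1 iX2
  have sY : ∫ x : ℝ × ℝ, (η x.2 ^ 2 + η (-x.2) ^ 2) * ‖ψ x‖ ^ 2
      = (∫ x : ℝ × ℝ, η x.2 ^ 2 * ‖ψ x‖ ^ 2) + ∫ x : ℝ × ℝ, η (-x.2) ^ 2 * ‖ψ x‖ ^ 2 := by
    simp only [add_mul]
    exact integral_add iY1 iY2
  have sZ : ∫ x : ℝ × ℝ, (η x.2 ^ 2 + η (-x.2) ^ 2) * gradSq a ψ x
      = (∫ x : ℝ × ℝ, η x.2 ^ 2 * gradSq a ψ x) + ∫ x : ℝ × ℝ, η (-x.2) ^ 2 * gradSq a ψ x := by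
    simp only [add_mul]
    exact integral_add iZ1 iZ2
  have iY : Integrable fun x : ℝ × ℝ => (η x.2 ^ 2 + η (-x.2) ^ 2) * ‖ψ x‖ ^ 2 := by
    simp only [add_mul]
    exact iY1.add iY2
  have iZ : Integrable fun x : ℝ × ℝ => (η x.2 ^ 2 + η (-x.2) ^ 2) * gradSq a ψ x := by
    simp only [add_mul]
    exact iZ1.add iZ2
  have sZY : ∫ x : ℝ × ℝ, (η x.2 ^ 2 + η (-x.2) ^ 2) * (gradSq a ψ x + ‖ψ x‖ ^ 2)
      = (∫ x : ℝ × ℝ, (η x.2 ^ 2 + η (-x.2) ^ 2) * gradSq a ψ x)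
        + ∫ x : ℝ × ℝ, (η x.2 ^ 2 + η (-x.2) ^ 2) * ‖ψ x‖ ^ 2 := by
    simp only [mul_add]
    exact integral_add iZ iY
  -- For `|x₂| ≤ 4` only `|ψ| ≤ 1` is used; for `|x₂| > 4` the weak weight is at least `1/4`.
  have hN := integral_le_add_box (c := 1) (m := 4) hR (by norm_num) h.integrable_normSq
    (iY.const_mul 4)
    (fun x _ => by
      have h2 : ‖ψ x‖ ^ 2 ≤ 1 := pow_le_one₀ (norm_nonneg _) (h1 x)
      have h3 : 0 ≤ 4 * ((η x.2 ^ 2 + η (-x.2) ^ 2) * ‖ψ x‖ ^ 2) := by positivity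
      linarith)
    (fun x hx => by
      by_cases h0 : ψ x = 0
      · simp [h0]
      have hx1 : x.1 ∈ Ioo (-R / 2) (R / 2) := (h.supp (subset_tsupport _ h0)).1
      have hx2 : 4 < |x.2| := by
        by_contra hcon
        exact hx ⟨hx1, abs_le.1 (not_lt.1 hcon)⟩
      have hq := quarter_le_div_log_sq hx2.le
      have hqη : 1 / 4 ≤ η x.2 ^ 2 + η (-x.2) ^ 2 := by
        rcases lt_abs.1 hx2 with h4 | h4
        · have := hw.weak_sq x.2 (by linarith)
          nlinarith [sq_nonneg (η (-x.2))]
        · have := hw.weak_sq (-x.2) (by linarith)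
          rw [abs_neg] at this
          nlinarith [sq_nonneg (η x.2)]
      nlinarith [mul_le_mul_of_nonneg_right hqη (sq_nonneg ‖ψ x‖)])
  rw [integral_const_mul, sY] at hN
  rw [h.energyS_eq] at hE
  rw [sZY, sZ, sY, sX]
  have hQ : 0 ≤ ∫ x, ‖ψ x‖ ^ 4 := integral_nonneg fun x => by positivity
  exact apriori_arith hI0 hc0 hb hR hδ hQ X1 X2 Y1 Y2 Z1 Z2 hN hE

theorem exists_bound_smooth {f : ℝ → ℝ} (hf : ContDiff ℝ ∞ f) (m : ℝ) :
    ∃ M, ∀ t, |t| ≤ m → f t ≤ M ∧ |deriv f t| ≤ M := by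
  obtain ⟨c1, h1⟩ := isCompact_Icc.exists_bound_of_continuousOn (s := Icc (-m) m)
    hf.continuous.continuousOn
  obtain ⟨c2, h2⟩ := isCompact_Icc.exists_bound_of_continuousOn (s := Icc (-m) m)
    (hf.continuous_deriv (by simp)).continuousOn
  exact ⟨max c1 c2, fun t ht =>
    ⟨((le_abs_self _).trans (h1 t (abs_le.1 ht))).trans (le_max_left _ _),
      (h2 t (abs_le.1 ht)).trans (le_max_right _ _)⟩⟩

/-- A bound for an integral implies a bound for the `lintegral` of a smaller function over a
set. -/
theorem setLIntegral_ofReal_le {S : Set (ℝ × ℝ)} (hS : MeasurableSet S) {f F : ℝ × ℝ → ℝ}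
    (hF : Integrable F) (hF0 : ∀ x, 0 ≤ F x) (hfF : ∀ x ∈ S, f x ≤ F x) {K : ℝ}
    (hK : ∫ x, F x ≤ K) : ∫⁻ x in S, ENNReal.ofReal (f x) ≤ ENNReal.ofReal K := by
  calc ∫⁻ x in S, ENNReal.ofReal (f x) ≤ ∫⁻ x in S, ENNReal.ofReal (F x) :=
        setLIntegral_mono' hS fun x hx => ENNReal.ofReal_le_ofReal (hfF x hx)
    _ ≤ ∫⁻ x, ENNReal.ofReal (F x) := setLIntegral_le_lintegral _ _
    _ = ENNReal.ofReal (∫ x, F x) :=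
        (ofReal_integral_eq_lintegral_ofReal hF (ae_of_all _ hF0)).symm
    _ ≤ ENNReal.ofReal K := ENNReal.ofReal_le_ofReal hK

theorem measurableSet_far (L : ℝ) : MeasurableSet {x : ℝ × ℝ | L ≤ |x.2|} :=
  (isClosed_le continuous_const continuous_snd.abs).measurableSet

/-- In every box there are near-minimizers of modulus at most one which satisfy the weighted
estimates with a universal constant. -/
theorem exists_near_min_weighted_bounds : ∃ C : ℝ, 0 < C ∧ ∀ a b R : ℝ, -1 ≤ a → a < 0 →
    1 / |a| ≤ b → 0 < R → ∀ m : ℝ, 0 ≤ m → ∀ ε : ℝ, 0 < ε → ∃ ψ : ℝ × ℝ → ℂ, BoxTest R m ψ ∧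
      (∀ x, ‖ψ x‖ ≤ 1) ∧ (∀ v, BoxTest R m v → energyS a b ψ ≤ energyS a b v + ε) ∧
      ∫⁻ x in {x : ℝ × ℝ | 4 ≤ |x.2|}, ENNReal.ofReal (|x.2| / Real.log |x.2| ^ 2 *
        (gradSq a ψ x + ‖ψ x‖ ^ 2)) ≤ ENNReal.ofReal (C * b * R) ∧
      ∫⁻ x in {x : ℝ × ℝ | 4 ≤ |x.2|}, ENNReal.ofReal (|x.2| ^ 3 / Real.log |x.2| ^ 2 *
        ‖ψ x‖ ^ 4) ≤ ENNReal.ofReal (C * b ^ 2 * R) ∧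
      b * (∫ x, gradSq a ψ x) + (∫ x, ‖ψ x‖ ^ 2) ≤ C * b * R := by
  obtain ⟨χ, η, W, c, hw⟩ := exists_weightPair
  obtain ⟨C, hC, hap⟩ := exists_apriori_const hw
  refine ⟨C, hC, fun a b R ha ha' hab hR m hm ε hε => ?_⟩
  have haa : 0 < |a| := abs_pos.2 ha'.ne
  have ha1 : |a| ≤ 1 := abs_le.2 ⟨ha, by linarith⟩
  have hb : 1 ≤ b := le_trans (by rw [le_div_iff₀ haa]; linarith) hab
  have hab' : 1 ≤ b * |a| := by rwa [div_le_iff₀ haa] at hab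
  have hw' := hw.mirror
  -- The bounds on the unbounded weights depend on `m`, but they enter only the choice of `ε₀` and
  -- never the constant `C`.
  obtain ⟨M1, hM1⟩ := exists_bound_smooth (hw.smooth_strong.pow 2) m
  obtain ⟨M2, hM2⟩ := exists_bound_smooth (hw'.smooth_strong.pow 2) m
  obtain ⟨M3, hM3⟩ := exists_bound_smooth (hw.smooth_weak.pow 2) m
  obtain ⟨M4, hM4⟩ := exists_bound_smooth (hw'.smooth_weak.pow 2) m
  set M := max (max M1 M2) (max M3 M4) with hM
  have l1 : M1 ≤ M := (le_max_left _ _).trans (le_max_left _ _)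
  have l2 : M2 ≤ M := (le_max_right _ _).trans (le_max_left _ _)
  have l3 : M3 ≤ M := (le_max_left _ _).trans (le_max_right _ _)
  have l4 : M4 ≤ M := (le_max_right _ _).trans (le_max_right _ _)
  -- The tolerance is `δ = R`, small enough to be absorbed into `C b R`.
  obtain ⟨ε₀, hε₀, hvar⟩ := exists_near_min_firstVar_le (R := R) (m := m) (M := M) (b := b)
    hR.le hm (by linarith) a hR
  obtain ⟨ψ, hψ, h1, hmin⟩ := exists_boxTest_near_min (R := R) (m := m) (b := b)
    (ε := min ε (min ε₀ R)) hR.le hm (by linarith) a (lt_min hε (lt_min hε₀ hR))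
  have hmin0 : ∀ v, BoxTest R m v → energyS a b ψ ≤ energyS a b v + ε₀ := fun v hv =>
    (hmin v hv).trans (by gcongr; exact (min_le_right _ _).trans (min_le_left _ _))
  have hE : energyS a b ψ ≤ R := by
    have := hmin _ (boxTest_zero R m)
    rw [energyS_zero, zero_add] at this
    exact this.trans ((min_le_right _ _).trans (min_le_right _ _))
  have v1 := hvar ψ hψ h1 hmin0 _ (hw.smooth_strong.pow 2) (fun t => by positivity)
    (fun t ht => (hM1 t ht).1.trans l1) (fun t ht => (hM1 t ht).2.trans l1)
  have v2 := hvar ψ hψ h1 hmin0 _ (hw'.smooth_strong.pow 2) (fun t => by positivity)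
    (fun t ht => (hM2 t ht).1.trans l2) (fun t ht => (hM2 t ht).2.trans l2)
  have v3 := hvar ψ hψ h1 hmin0 _ (hw.smooth_weak.pow 2) (fun t => by positivity)
    (fun t ht => (hM3 t ht).1.trans l3) (fun t ht => (hM3 t ht).2.trans l3)
  have v4 := hvar ψ hψ h1 hmin0 _ (hw'.smooth_weak.pow 2) (fun t => by positivity)
    (fun t ht => (hM4 t ht).1.trans l4) (fun t ht => (hM4 t ht).2.trans l4)
  obtain ⟨B1, B2, B3⟩ := hap a b R R ψ ha ha' hb hab' hR.le le_rfl hψ.test h1 hE v1 v2 v3 v4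
  have hT := hψ.test
  refine ⟨ψ, hψ, h1, fun v hv => (hmin v hv).trans (by gcongr; exact min_le_left _ _),
    setLIntegral_ofReal_le (measurableSet_far 4) ?_ ?_ ?_ B1,
    setLIntegral_ofReal_le (measurableSet_far 4) ?_ ?_ ?_ B2, B3⟩
  · have hc : Continuous fun t => η t ^ 2 + η (-t) ^ 2 :=
      (hw.smooth_weak.continuous.pow 2).add (hw'.smooth_weak.continuous.pow 2)
    exact hT.integrable_weight_mul hc
      ((hT.continuous_gradSq a).add (hT.continuous.norm.pow 2)) fun x hx => by
        simp [gradSq_eq_zero hx, image_eq_zero_of_notMem_tsupport hx]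
  · intro x
    have := gradSq_nonneg a ψ x
    positivity
  · intro x hx
    have hg := gradSq_nonneg a ψ x
    refine mul_le_mul_of_nonneg_right ?_ (by positivity)
    rcases le_abs.1 (show 4 ≤ |x.2| from hx) with h4 | h4
    · rw [← hw.weak_sq x.2 (by linarith)]
      exact le_add_of_nonneg_right (sq_nonneg _)
    · rw [← abs_neg, ← hw.weak_sq (-x.2) (by linarith)]
      exact le_add_of_nonneg_left (sq_nonneg _)
  · have hc : Continuous fun t => χ t ^ 2 + χ (-t) ^ 2 :=
      (hw.smooth_strong.continuous.pow 2).add (hw'.smooth_strong.continuous.pow 2)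
    exact hT.integrable_weight_norm_pow_four hc
  · intro x
    positivity
  · intro x hx
    refine mul_le_mul_of_nonneg_right ?_ (by positivity)
    rcases le_abs.1 (show 4 ≤ |x.2| from hx) with h4 | h4
    · rw [← hw.strong_sq x.2 (by linarith)]
      exact le_add_of_nonneg_right (sq_nonneg _)
    · rw [← abs_neg, ← hw.strong_sq (-x.2) (by linarith)]
      exact le_add_of_nonneg_left (sq_nonneg _)

/-! ### A Poincaré inequality on small cells -/

/-- Cauchy–Schwarz, from the nonnegativity of the integral of `(f - c)²` with `c` the mean of `f`.
-/
theorem sq_intervalIntegral_le {f : ℝ → ℝ} (hf : Continuous f) {p q : ℝ} (hpq : p < q) :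
    (∫ t in p..q, f t) ^ 2 ≤ (q - p) * ∫ t in p..q, f t ^ 2 := by
  set c := (∫ t in p..q, f t) / (q - p) with hc
  have hh : 0 < q - p := sub_pos.2 hpq
  have h0 : 0 ≤ ∫ t in p..q, (f t - c) ^ 2 :=
    intervalIntegral.integral_nonneg hpq.le fun t _ => sq_nonneg _
  have h1 : ∫ t in p..q, (f t - c) ^ 2
      = (∫ t in p..q, f t ^ 2) - 2 * c * (∫ t in p..q, f t) + c ^ 2 * (q - p) := by
    have : ∀ t, (f t - c) ^ 2 = f t ^ 2 - 2 * c * f t + c ^ 2 := fun t => by ring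
    simp only [this]
    have i1 : IntervalIntegrable (fun t => f t ^ 2) volume p q :=
      (hf.pow 2).intervalIntegrable _ _
    have i2 : IntervalIntegrable (fun t => 2 * c * f t) volume p q :=
      (continuous_const.mul hf).intervalIntegrable _ _
    rw [intervalIntegral.integral_add (i1.sub i2) (by simp),
      intervalIntegral.integral_sub i1 i2, intervalIntegral.integral_const_mul,
      intervalIntegral.integral_const, smul_eq_mul]
    ring
  have h2 : c * (q - p) = ∫ t in p..q, f t := by rw [hc]; field_simp
  rw [h1] at h0
  rw [← h2] at h0 ⊢
  nlinarith

theorem sq_norm_intervalIntegral_le {f : ℝ → ℂ} (hf : Continuous f) {p q : ℝ} (hpq : p < q) :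
    ‖∫ t in p..q, f t‖ ^ 2 ≤ (q - p) * ∫ t in p..q, ‖f t‖ ^ 2 :=
  (pow_le_pow_left₀ (norm_nonneg _)
    (intervalIntegral.norm_integral_le_integral_norm hpq.le) 2).trans
    (sq_intervalIntegral_le hf.norm hpq)

/-- One-dimensional Poincaré inequality in terms of the oscillation. -/
theorem integral_normSq_le_of_osc {g : ℝ → ℂ} (hg : Continuous g) {p q M : ℝ} (hpq : p < q)
    (hM : ∀ s ∈ Icc p q, ∀ t ∈ Icc p q, ‖g s - g t‖ ^ 2 ≤ M) :
    ∫ t in p..q, ‖g t‖ ^ 2 ≤ 2 / (q - p) * ‖∫ t in p..q, g t‖ ^ 2 + 2 * (q - p) * M := by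
  have hh : 0 < q - p := sub_pos.2 hpq
  set c : ℂ := ((q - p : ℝ) : ℂ)⁻¹ * ∫ t in p..q, g t with hc
  have hh' : ((q - p : ℝ) : ℂ) ≠ 0 := Complex.ofReal_ne_zero.2 hh.ne'
  have hM0 : 0 ≤ M := by
    simpa using hM p (left_mem_Icc.2 hpq.le) p (left_mem_Icc.2 hpq.le)
  have hosc : ∀ s ∈ Icc p q, ‖g s - c‖ ^ 2 ≤ M := by
    intro s hs
    have e1 : g s - c = ((q - p : ℝ) : ℂ)⁻¹ * ∫ t in p..q, (g s - g t) := by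
      rw [intervalIntegral.integral_sub (by simp) (hg.intervalIntegrable _ _),
        intervalIntegral.integral_const, hc, mul_sub, Complex.real_smul, ← mul_assoc,
        inv_mul_cancel₀ hh', one_mul]
    have e2 : ‖∫ t in p..q, (g s - g t)‖ ≤ √M * |q - p| := by
      refine intervalIntegral.norm_integral_le_of_norm_le_const fun t ht => ?_
      rw [uIoc_of_le hpq.le] at ht
      exact Real.le_sqrt_of_sq_le (hM s hs t ⟨ht.1.le, ht.2⟩)
    have e3 : ‖g s - c‖ ≤ √M := by
      rw [e1, norm_mul, norm_inv, Complex.norm_real, Real.norm_eq_abs]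
      rw [inv_mul_le_iff₀ (abs_pos.2 hh.ne')]
      linarith
    calc ‖g s - c‖ ^ 2 ≤ √M ^ 2 := pow_le_pow_left₀ (norm_nonneg _) e3 2
      _ = M := Real.sq_sqrt hM0
  have hle : ∫ t in p..q, ‖g t‖ ^ 2 ≤ ∫ _ in p..q, (2 * ‖c‖ ^ 2 + 2 * M) := by
    refine intervalIntegral.integral_mono_on hpq.le
      ((hg.norm.pow 2).intervalIntegrable _ _) (by simp) fun t ht => ?_
    have h1 : ‖g t‖ ≤ ‖g t - c‖ + ‖c‖ := by simpa using norm_add_le (g t - c) c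
    have h2 := hosc t ht
    nlinarith [norm_nonneg (g t), norm_nonneg c, norm_nonneg (g t - c),
      sq_nonneg (‖g t - c‖ - ‖c‖)]
  refine hle.trans_eq ?_
  rw [intervalIntegral.integral_const, smul_eq_mul, hc, norm_mul, norm_inv, Complex.norm_real,
    Real.norm_of_nonneg hh.le]
  field_simp

theorem sq_norm_sub_le_integral_deriv {f f' : ℝ → ℂ} (hf : ∀ t, HasDerivAt f (f' t) t)
    (hf' : Continuous f') {p q : ℝ} (hpq : p < q) :
    ∀ s ∈ Icc p q, ∀ t ∈ Icc p q, ‖f s - f t‖ ^ 2 ≤ (q - p) * ∫ r in p..q, ‖f' r‖ ^ 2 := by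
  have key : ∀ s ∈ Icc p q, ∀ t ∈ Icc p q, s ≤ t →
      ‖f t - f s‖ ≤ ∫ r in p..q, ‖f' r‖ := by
    intro s hs t ht hst
    rw [← intervalIntegral.integral_eq_sub_of_hasDerivAt (fun x _ => hf x)
      (hf'.intervalIntegrable _ _)]
    refine (intervalIntegral.norm_integral_le_integral_norm hst).trans ?_
    refine intervalIntegral.integral_mono_interval hs.1 hst ht.2
      (ae_of_all _ fun x => norm_nonneg _) (hf'.norm.intervalIntegrable _ _)
  intro s hs t ht
  have h1 : ‖f s - f t‖ ≤ ∫ r in p..q, ‖f' r‖ := by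
    rcases le_total s t with h | h
    · rw [norm_sub_rev]; exact key s hs t ht h
    · exact key t ht s hs h
  exact (pow_le_pow_left₀ (norm_nonneg _) h1 2).trans (sq_intervalIntegral_le hf'.norm hpq)

/-- The iterated integral over the rectangle `[p, q] × [r, s]`. -/
def rectInt {E : Type*} [NormedAddCommGroup E] [NormedSpace ℝ E] (p q r s : ℝ)
    (F : ℝ × ℝ → E) : E := ∫ x in p..q, ∫ y in r..s, F (x, y)

theorem continuous_inner_integral {E : Type*} [NormedAddCommGroup E] [NormedSpace ℝ E]
    {F : ℝ × ℝ → E} (hF : Continuous F) (r s : ℝ) :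
    Continuous fun x => ∫ y in r..s, F (x, y) :=
  intervalIntegral.continuous_parametric_intervalIntegral_of_continuous'
    (f := fun x y => F (x, y)) hF r s

theorem rectInt_add {E : Type*} [NormedAddCommGroup E] [NormedSpace ℝ E] {F G : ℝ × ℝ → E}
    (hF : Continuous F) (hG : Continuous G) (p q r s : ℝ) :
    rectInt p q r s (fun x => F x + G x) = rectInt p q r s F + rectInt p q r s G := by
  unfold rectInt
  rw [← intervalIntegral.integral_add
    ((continuous_inner_integral hF r s).intervalIntegrable _ _)
    ((continuous_inner_integral hG r s).intervalIntegrable _ _)]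
  congr 1
  ext x
  exact intervalIntegral.integral_add
    ((hF.comp (by fun_prop : Continuous fun y => (x, y))).intervalIntegrable _ _)
    ((hG.comp (by fun_prop : Continuous fun y => (x, y))).intervalIntegrable _ _)

theorem rectInt_sub {E : Type*} [NormedAddCommGroup E] [NormedSpace ℝ E] {F G : ℝ × ℝ → E}
    (hF : Continuous F) (hG : Continuous G) (p q r s : ℝ) :
    rectInt p q r s (fun x => F x - G x) = rectInt p q r s F - rectInt p q r s G := by
  unfold rectInt
  rw [← intervalIntegral.integral_sub
    ((continuous_inner_integral hF r s).intervalIntegrable _ _)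
    ((continuous_inner_integral hG r s).intervalIntegrable _ _)]
  congr 1
  ext x
  exact intervalIntegral.integral_sub
    ((hF.comp (by fun_prop : Continuous fun y => (x, y))).intervalIntegrable _ _)
    ((hG.comp (by fun_prop : Continuous fun y => (x, y))).intervalIntegrable _ _)

theorem norm_rectInt_le {E : Type*} [NormedAddCommGroup E] [NormedSpace ℝ E]
    {F : ℝ × ℝ → E} (h1 : ∀ x, ‖F x‖ ≤ 1) (p q r s : ℝ) :
    ‖rectInt p q r s F‖ ≤ |s - r| * |q - p| := by
  refine intervalIntegral.norm_integral_le_of_norm_le_const fun x _ => ?_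
  simpa using intervalIntegral.norm_integral_le_of_norm_le_const (a := r) (b := s) (C := 1)
    (f := fun y => F (x, y)) fun y _ => h1 _

/-- The Poincaré inequality on a square of side `h`. -/
theorem IsTest.poincare_cell (hf : IsTest U ψ) (p r : ℝ) {h : ℝ} (hh : 0 < h) :
    rectInt p (p + h) r (r + h) (fun x => ‖ψ x‖ ^ 2)
      ≤ 4 / h ^ 2 * ‖rectInt p (p + h) r (r + h) ψ‖ ^ 2
        + 4 * h ^ 2 * rectInt p (p + h) r (r + h)
          (fun x => ‖fderiv ℝ ψ x (1, 0)‖ ^ 2 + ‖fderiv ℝ ψ x (0, 1)‖ ^ 2) := by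
  have hpq : p < p + h := by linarith
  have hrs : r < r + h := by linarith
  have c0 := hf.continuous
  have c1 := hf.continuous_fderiv_apply (1, 0)
  have c2 := hf.continuous_fderiv_apply (0, 1)
  have cx : ∀ x : ℝ, Continuous fun y : ℝ => (x, y) := fun x => by fun_prop
  have cy : ∀ y : ℝ, Continuous fun x : ℝ => (x, y) := fun x => by fun_prop
  have d2 : ∀ x y, HasDerivAt (fun y => ψ (x, y)) (fderiv ℝ ψ (x, y) (0, 1)) y := fun x y =>
    (hf.differentiable (x, y)).hasFDerivAt.comp_hasDerivAt y
      ((hasDerivAt_const y x).prodMk (hasDerivAt_id y))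
  have d1 : ∀ x y, HasDerivAt (fun x => ψ (x, y)) (fderiv ℝ ψ (x, y) (1, 0)) x := fun x y =>
    (hf.differentiable (x, y)).hasFDerivAt.comp_hasDerivAt x
      ((hasDerivAt_id x).prodMk (hasDerivAt_const x y))
  set G : ℝ → ℂ := fun x => ∫ y in r..r + h, ψ (x, y) with hG
  have cG : Continuous G := continuous_inner_integral c0 _ _
  set A1 := rectInt p (p + h) r (r + h) (fun x => ‖fderiv ℝ ψ x (1, 0)‖ ^ 2) with hA1
  set A2 := rectInt p (p + h) r (r + h) (fun x => ‖fderiv ℝ ψ x (0, 1)‖ ^ 2) with hA2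
  have hsum : rectInt p (p + h) r (r + h)
      (fun x => ‖fderiv ℝ ψ x (1, 0)‖ ^ 2 + ‖fderiv ℝ ψ x (0, 1)‖ ^ 2) = A1 + A2 :=
    rectInt_add (c1.norm.pow 2) (c2.norm.pow 2) _ _ _ _
  have cA2 : Continuous fun x => ∫ y in r..r + h, ‖fderiv ℝ ψ (x, y) (0, 1)‖ ^ 2 :=
    continuous_inner_integral (c2.norm.pow 2) _ _
  have hA2nn : 0 ≤ A2 := intervalIntegral.integral_nonneg hpq.le fun x _ =>
    intervalIntegral.integral_nonneg hrs.le fun y _ => by positivity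
  -- The one-dimensional inequality is used twice: in `x₂` on each vertical segment, and then in
  -- `x₁` for the vertical integrals `G`.
  have inner : ∀ x, ∫ y in r..r + h, ‖ψ (x, y)‖ ^ 2 ≤ 2 / h * ‖G x‖ ^ 2
      + 2 * h ^ 2 * ∫ y in r..r + h, ‖fderiv ℝ ψ (x, y) (0, 1)‖ ^ 2 := by
    intro x
    have := integral_normSq_le_of_osc (c0.comp (cx x)) hrs
      (sq_norm_sub_le_integral_deriv (d2 x) (c2.comp (cx x)) hrs)
    simp only [add_sub_cancel_left, Function.comp_apply] at this
    refine this.trans_eq ?_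
    rw [hG]; ring
  have oscG : ∀ s ∈ Icc p (p + h), ∀ t ∈ Icc p (p + h), ‖G s - G t‖ ^ 2 ≤ h ^ 2 * A1 := by
    intro s hs t ht
    have e1 : G s - G t = ∫ y in r..r + h, (ψ (s, y) - ψ (t, y)) :=
      (intervalIntegral.integral_sub ((c0.comp (cx s)).intervalIntegrable _ _)
        ((c0.comp (cx t)).intervalIntegrable _ _)).symm
    have e2 := sq_norm_intervalIntegral_le ((c0.comp (cx s)).sub (c0.comp (cx t))) hrs
    have c3 : Continuous fun y => ∫ x in p..p + h, ‖fderiv ℝ ψ (x, y) (1, 0)‖ ^ 2 :=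
      continuous_inner_integral (F := fun z : ℝ × ℝ => ‖fderiv ℝ ψ (z.2, z.1) (1, 0)‖ ^ 2)
        ((c1.norm.pow 2).comp (by fun_prop : Continuous fun z : ℝ × ℝ => (z.2, z.1))) _ _
    have e3 : ∫ y in r..r + h, ‖ψ (s, y) - ψ (t, y)‖ ^ 2
        ≤ ∫ y in r..r + h, h * ∫ x in p..p + h, ‖fderiv ℝ ψ (x, y) (1, 0)‖ ^ 2 := by
      refine intervalIntegral.integral_mono_on hrs.le
        (((((c0.comp (cx s)).sub (c0.comp (cx t))).norm.pow 2)).intervalIntegrable _ _)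
        ((continuous_const.mul c3).intervalIntegrable _ _) fun y _ => ?_
      have := sq_norm_sub_le_integral_deriv (fun x => d1 x y) (c1.comp (cy y)) hpq s hs t ht
      simpa using this
    have e4 : ∫ y in r..r + h, ∫ x in p..p + h, ‖fderiv ℝ ψ (x, y) (1, 0)‖ ^ 2 = A1 := by
      rw [hA1, rectInt]
      symm
      refine intervalIntegral_intervalIntegral_swap
        (F := fun x y => ‖fderiv ℝ ψ (x, y) (1, 0)‖ ^ 2) ?_
      exact (hf.integrable (c1.norm.pow 2) fun x hx => by
        simp [fderiv_eq_zero_of_notMem_tsupport hx]).integrableOn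
    rw [intervalIntegral.integral_const_mul, e4] at e3
    rw [e1]
    simp only [add_sub_cancel_left] at e2
    calc _ ≤ h * ∫ y in r..r + h, ‖ψ (s, y) - ψ (t, y)‖ ^ 2 := e2
      _ ≤ h * (h * A1) := by gcongr
      _ = h ^ 2 * A1 := by ring
  have outer := integral_normSq_le_of_osc cG hpq oscG
  simp only [add_sub_cancel_left] at outer
  have step : rectInt p (p + h) r (r + h) (fun x => ‖ψ x‖ ^ 2)
      ≤ 2 / h * (∫ x in p..p + h, ‖G x‖ ^ 2) + 2 * h ^ 2 * A2 := by
    have k1 : IntervalIntegrable (fun x => 2 / h * ‖G x‖ ^ 2) volume p (p + h) :=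
      (continuous_const.mul (cG.norm.pow 2)).intervalIntegrable _ _
    have k2 : IntervalIntegrable (fun x => 2 * h ^ 2
        * ∫ y in r..r + h, ‖fderiv ℝ ψ (x, y) (0, 1)‖ ^ 2) volume p (p + h) :=
      (continuous_const.mul cA2).intervalIntegrable _ _
    rw [hA2, rectInt, rectInt, ← intervalIntegral.integral_const_mul,
      ← intervalIntegral.integral_const_mul, ← intervalIntegral.integral_add k1 k2]
    refine intervalIntegral.integral_mono_on hpq.le
      ((continuous_inner_integral (c0.norm.pow 2) _ _).intervalIntegrable _ _)
      (((continuous_const.mul (cG.norm.pow 2)).add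
        (continuous_const.mul cA2)).intervalIntegrable _ _) fun x _ => inner x
  rw [hsum]
  calc _ ≤ 2 / h * (∫ x in p..p + h, ‖G x‖ ^ 2) + 2 * h ^ 2 * A2 := step
    _ ≤ 2 / h * (2 / h * ‖∫ x in p..p + h, G x‖ ^ 2 + 2 * h * (h ^ 2 * A1))
        + 2 * h ^ 2 * A2 := by gcongr
    _ = 4 / h ^ 2 * ‖∫ x in p..p + h, G x‖ ^ 2 + 4 * h ^ 2 * A1 + 2 * h ^ 2 * A2 := by
        field_simp; ring
    _ ≤ 4 / h ^ 2 * ‖∫ x in p..p + h, G x‖ ^ 2 + 4 * h ^ 2 * (A1 + A2) := by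
        have : 0 ≤ h ^ 2 * A2 := by positivity
        linarith

/-- Subdivision of a square into `k²` cells. -/
theorem sum_rectInt_cells {F : ℝ × ℝ → ℝ} (hF : Continuous F) (p r h : ℝ) (k : ℕ) :
    ∑ i ∈ Finset.range k, ∑ j ∈ Finset.range k,
      rectInt (p + i * h) (p + i * h + h) (r + j * h) (r + j * h + h) F
      = rectInt p (p + k * h) r (r + k * h) F := by
  have inner : ∀ x, ∑ j ∈ Finset.range k, ∫ y in (r + j * h)..(r + j * h + h), F (x, y)
      = ∫ y in r..(r + k * h), F (x, y) := by
    intro x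
    have := intervalIntegral.sum_integral_adjacent_intervals (μ := volume)
      (f := fun y => F (x, y)) (a := fun j : ℕ => r + j * h) (n := k)
      fun j _ => (hF.comp (by fun_prop : Continuous fun y => (x, y))).intervalIntegrable _ _
    simp only [Nat.cast_add, Nat.cast_one, Nat.cast_zero, zero_mul, add_zero, add_mul, one_mul,
      ← add_assoc] at this
    exact this
  have outer := intervalIntegral.sum_integral_adjacent_intervals (μ := volume)
      (f := fun x => ∫ y in r..(r + k * h), F (x, y)) (a := fun j : ℕ => p + j * h) (n := k)
      fun j _ => (continuous_inner_integral hF _ _).intervalIntegrable _ _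
  simp only [Nat.cast_add, Nat.cast_one, Nat.cast_zero, zero_mul, add_zero, add_mul, one_mul,
      ← add_assoc] at outer
  rw [rectInt, ← outer]
  refine Finset.sum_congr rfl fun i _ => ?_
  simp only [rectInt]
  rw [← intervalIntegral.integral_finsetSum]
  · simp only [inner]
  · exact fun j _ => (continuous_inner_integral hF _ _).intervalIntegrable _ _

theorem rectInt_eq_setIntegral {F : ℝ × ℝ → ℝ} (hF : Integrable F) {p q r s : ℝ}
    (hpq : p ≤ q) (hrs : r ≤ s) :
    rectInt p q r s F = ∫ x in Ioc p q ×ˢ Ioc r s, F x := by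
  rw [Measure.volume_eq_prod, setIntegral_prod _ (by
    rw [← Measure.volume_eq_prod]; exact hF.integrableOn), rectInt,
    intervalIntegral.integral_of_le hpq]
  simp only [intervalIntegral.integral_of_le hrs]

/-! ### Compactness in `L²` -/

theorem IsTest.add {f g : ℝ × ℝ → ℂ} (hf : IsTest U f) (hg : IsTest U g) :
    IsTest U fun x => f x + g x where
  smooth := hf.smooth.add hg.smooth
  compact := hf.compact.add hg.compact
  supp := (tsupport_add f g).trans (union_subset hf.supp hg.supp)

theorem IsTest.const_mul {f : ℝ × ℝ → ℂ} (hf : IsTest U f) (c : ℂ) :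
    IsTest U fun x => c * f x where
  smooth := contDiff_const.mul hf.smooth
  compact := hf.compact.mul_left (f := fun _ => c)
  supp := (closure_mono fun _ hx => right_ne_zero_of_mul hx).trans hf.supp

theorem IsTest.sub {f g : ℝ × ℝ → ℂ} (hf : IsTest U f) (hg : IsTest U g) :
    IsTest U fun x => f x - g x := by
  simpa [sub_eq_add_neg] using hf.add (hg.const_mul (-1))

theorem IsTest.covDerivSmooth_add {f g : ℝ × ℝ → ℂ} (hf : IsTest U f) (hg : IsTest U g)
    (a : ℝ) (j : Fin 2) (x : ℝ × ℝ) :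
    covDerivSmooth a j (fun x => f x + g x) x
      = covDerivSmooth a j f x + covDerivSmooth a j g x := by
  have : fderiv ℝ (fun x => f x + g x) x = fderiv ℝ f x + fderiv ℝ g x :=
    ((hf.differentiable x).hasFDerivAt.add (hg.differentiable x).hasFDerivAt).fderiv
  simp only [covDerivSmooth, this, add_apply]
  ring

theorem IsTest.covDerivSmooth_const_mul {f : ℝ × ℝ → ℂ} (hf : IsTest U f)
    (c : ℂ) (a : ℝ) (j : Fin 2) (x : ℝ × ℝ) :
    covDerivSmooth a j (fun x => c * f x) x = c * covDerivSmooth a j f x := by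
  have : fderiv ℝ (fun x => c * f x) x = c • fderiv ℝ f x :=
    ((hf.differentiable x).hasFDerivAt.const_mul c).fderiv
  simp only [covDerivSmooth, this, smul_apply, smul_eq_mul]
  ring

theorem IsTest.covDerivSmooth_sub {f g : ℝ × ℝ → ℂ} (hf : IsTest U f) (hg : IsTest U g)
    (a : ℝ) (j : Fin 2) (x : ℝ × ℝ) :
    covDerivSmooth a j (fun x => f x - g x) x
      = covDerivSmooth a j f x - covDerivSmooth a j g x := by
  have := hf.covDerivSmooth_add (hg.const_mul (-1)) a j x
  rw [hg.covDerivSmooth_const_mul] at this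
  simpa [sub_eq_add_neg] using this

theorem norm_sub_sq_le_two (z w : ℂ) : ‖z - w‖ ^ 2 ≤ 2 * ‖z‖ ^ 2 + 2 * ‖w‖ ^ 2 := by
  simp only [sq_norm_eq, Complex.sub_re, Complex.sub_im]
  nlinarith [sq_nonneg (z.re + w.re), sq_nonneg (z.im + w.im)]

theorem IsTest.gradSq_sub_le {f g : ℝ × ℝ → ℂ} (hf : IsTest U f) (hg : IsTest U g)
    (a : ℝ) (x : ℝ × ℝ) :
    gradSq a (fun x => f x - g x) x ≤ 2 * gradSq a f x + 2 * gradSq a g x := by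
  simp only [gradSq_eq, hf.covDerivSmooth_sub hg]
  have h1 := norm_sub_sq_le_two (covDerivSmooth a 0 f x) (covDerivSmooth a 0 g x)
  have h2 := norm_sub_sq_le_two (covDerivSmooth a 1 f x) (covDerivSmooth a 1 g x)
  linarith

theorem IsTest.integral_gradSq_sub_le {f g : ℝ × ℝ → ℂ} (hf : IsTest U f) (hg : IsTest U g)
    (a : ℝ) : ∫ x, gradSq a (fun x => f x - g x) x
      ≤ 2 * (∫ x, gradSq a f x) + 2 * ∫ x, gradSq a g x := by
  rw [← integral_const_mul, ← integral_const_mul, ← integral_add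
    ((hf.integrable_gradSq a).const_mul 2) ((hg.integrable_gradSq a).const_mul 2)]
  exact integral_mono ((hf.sub hg).integrable_gradSq a)
    (((hf.integrable_gradSq a).const_mul 2).add ((hg.integrable_gradSq a).const_mul 2))
    fun x => hf.gradSq_sub_le hg a x

theorem IsTest.setIntegral_normSq_sub_le {f g : ℝ × ℝ → ℂ} (hf : IsTest U f) (hg : IsTest U g)
    (S : Set (ℝ × ℝ)) : ∫ x in S, ‖f x - g x‖ ^ 2
      ≤ 2 * (∫ x in S, ‖f x‖ ^ 2) + 2 * ∫ x in S, ‖g x‖ ^ 2 := by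
  rw [← integral_const_mul, ← integral_const_mul, ← integral_add
    (hf.integrable_normSq.integrableOn.const_mul 2)
    (hg.integrable_normSq.integrableOn.const_mul 2)]
  exact integral_mono ((hf.sub hg).integrable_normSq.integrableOn)
    ((hf.integrable_normSq.integrableOn.const_mul 2).add
      (hg.integrable_normSq.integrableOn.const_mul 2)) fun x => norm_sub_sq_le_two _ _

/-- The Poincaré inequality involves the ordinary gradient. For `|x₂| ≤ N` the potential is at most
`N`, so the magnetic energy and the mass control it there. -/
theorem sq_norm_fderiv_le {a : ℝ} (ha : -1 ≤ a) (ha' : a < 0) (ψ : ℝ × ℝ → ℂ) {N : ℝ}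
    {x : ℝ × ℝ} (hx : |x.2| ≤ N) :
    ‖fderiv ℝ ψ x (1, 0)‖ ^ 2 + ‖fderiv ℝ ψ x (0, 1)‖ ^ 2
      ≤ 2 * gradSq a ψ x + 2 * N ^ 2 * ‖ψ x‖ ^ 2 := by
  have h1 : fderiv ℝ ψ x (1, 0)
      = covDerivSmooth a 0 ψ x - Complex.I * (kap a x.2 : ℝ) * ψ x := by
    rw [covDerivSmooth_zero]; ring
  have h2 := norm_sub_sq_le_two (covDerivSmooth a 0 ψ x) (Complex.I * (kap a x.2 : ℝ) * ψ x)
  have h3 : ‖Complex.I * (kap a x.2 : ℝ) * ψ x‖ ^ 2 ≤ N ^ 2 * ‖ψ x‖ ^ 2 := by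
    rw [norm_mul, norm_mul, Complex.norm_I, one_mul, Complex.norm_real, Real.norm_eq_abs, mul_pow]
    gcongr
    exact (abs_kap_le ha ha' _).trans hx
  rw [← h1] at h2
  rw [gradSq_eq, ← covDerivSmooth_one a]
  nlinarith [sq_nonneg ‖covDerivSmooth a 1 ψ x‖]

/-- The integral of `ψ` over the cell `(i, j)` of the subdivision of `[-N, N]²` into `k²`
squares. -/
def cellInt (N k i j : ℕ) (ψ : ℝ × ℝ → ℂ) : ℂ :=
  rectInt (-(N : ℝ) + i * (2 * N / k)) (-(N : ℝ) + i * (2 * N / k) + 2 * N / k)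
    (-(N : ℝ) + j * (2 * N / k)) (-(N : ℝ) + j * (2 * N / k) + 2 * N / k) ψ

/-- The square `(-N, N]²`. -/
def square (N : ℕ) : Set (ℝ × ℝ) := Ioc (-(N : ℝ)) N ×ˢ Ioc (-(N : ℝ)) N

theorem measurableSet_square (N : ℕ) : MeasurableSet (square N) :=
  measurableSet_Ioc.prod measurableSet_Ioc

/-- The quantitative core of compactness: on a square the `L²` norm is controlled by finitely many
cell integrals, up to an error proportional to the squared mesh size. -/
theorem IsTest.integral_square_le {a : ℝ} (ha : -1 ≤ a) (ha' : a < 0) (h : IsTest U ψ)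
    {N k : ℕ} (hN : 0 < N) (hk : 0 < k) :
    ∫ x in square N, ‖ψ x‖ ^ 2
      ≤ 4 / (2 * N / k : ℝ) ^ 2
          * (∑ i ∈ Finset.range k, ∑ j ∈ Finset.range k, ‖cellInt N k i j ψ‖ ^ 2)
        + 4 * (2 * N / k : ℝ) ^ 2
          * (2 * (∫ x, gradSq a ψ x) + 2 * (N : ℝ) ^ 2 * ∫ x, ‖ψ x‖ ^ 2) := by
  have hN' : (0 : ℝ) < N := Nat.cast_pos.2 hN
  have hk' : (0 : ℝ) < k := Nat.cast_pos.2 hk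
  set d : ℝ := 2 * N / k with hd
  have hd0 : 0 < d := by positivity
  have hkd : -(N : ℝ) + k * d = N := by rw [hd]; field_simp; ring
  set F : ℝ × ℝ → ℝ := fun x => ‖fderiv ℝ ψ x (1, 0)‖ ^ 2 + ‖fderiv ℝ ψ x (0, 1)‖ ^ 2 with hF
  have cF : Continuous F := ((h.continuous_fderiv_apply _).norm.pow 2).add
    ((h.continuous_fderiv_apply _).norm.pow 2)
  have iF : Integrable F := h.integrable cF fun x hx => by
    simp [hF, fderiv_eq_zero_of_notMem_tsupport hx]
  have c0 : Continuous fun x => ‖ψ x‖ ^ 2 := h.continuous.norm.pow 2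
  have e1 : ∫ x in square N, ‖ψ x‖ ^ 2
      = ∑ i ∈ Finset.range k, ∑ j ∈ Finset.range k,
        rectInt (-(N : ℝ) + i * d) (-(N : ℝ) + i * d + d) (-(N : ℝ) + j * d)
          (-(N : ℝ) + j * d + d) (fun x => ‖ψ x‖ ^ 2) := by
    rw [sum_rectInt_cells c0, hkd, rectInt_eq_setIntegral h.integrable_normSq (by linarith)
      (by linarith)]
    rfl
  have e2 : ∫ x in square N, F x
      = ∑ i ∈ Finset.range k, ∑ j ∈ Finset.range k,
        rectInt (-(N : ℝ) + i * d) (-(N : ℝ) + i * d + d) (-(N : ℝ) + j * d)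
          (-(N : ℝ) + j * d + d) F := by
    rw [sum_rectInt_cells cF, hkd, rectInt_eq_setIntegral iF (by linarith) (by linarith)]
    rfl
  have i3 : Integrable fun x => 2 * gradSq a ψ x + 2 * (N : ℝ) ^ 2 * ‖ψ x‖ ^ 2 :=
    ((h.integrable_gradSq a).const_mul 2).add (h.integrable_normSq.const_mul _)
  have e3 : ∫ x in square N, F x
      ≤ 2 * (∫ x, gradSq a ψ x) + 2 * (N : ℝ) ^ 2 * ∫ x, ‖ψ x‖ ^ 2 := by
    rw [← integral_const_mul, ← integral_const_mul, ← integral_add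
      ((h.integrable_gradSq a).const_mul 2) (h.integrable_normSq.const_mul _)]
    refine (setIntegral_mono_on iF.integrableOn i3.integrableOn (measurableSet_square N)
      fun x hx => sq_norm_fderiv_le ha ha' ψ (abs_le.2 ⟨hx.2.1.le, hx.2.2⟩)).trans ?_
    exact setIntegral_le_integral i3 (ae_of_all _ fun x => by
      have := gradSq_nonneg a ψ x
      simp only [Pi.zero_apply]
      positivity)
  have e4 : ∫ x in square N, ‖ψ x‖ ^ 2
      ≤ 4 / d ^ 2 * (∑ i ∈ Finset.range k, ∑ j ∈ Finset.range k, ‖cellInt N k i j ψ‖ ^ 2)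
        + 4 * d ^ 2 * ∫ x in square N, F x := by
    rw [e1, e2, Finset.mul_sum, Finset.mul_sum, ← Finset.sum_add_distrib]
    refine Finset.sum_le_sum fun i _ => ?_
    rw [Finset.mul_sum, Finset.mul_sum, ← Finset.sum_add_distrib]
    exact Finset.sum_le_sum fun j _ => h.poincare_cell _ _ hd0
  refine e4.trans ?_
  gcongr

theorem IsTest.cellInt_sub {f g : ℝ × ℝ → ℂ} (hf : IsTest U f) (hg : IsTest U g)
    (N k i j : ℕ) : cellInt N k i j (fun x => f x - g x) = cellInt N k i j f - cellInt N k i j g :=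
  rectInt_sub hf.continuous hg.continuous _ _ _ _

/-- Test functions in the strip with bounded magnetic energy and uniformly small tails have
a subsequence which is Cauchy in `L²`. -/
theorem exists_subseq_cauchy {a R M : ℝ} (ha : -1 ≤ a) (ha' : a < 0) {ψ : ℕ → ℝ × ℝ → ℂ}
    (hT : ∀ n, IsTest (strip R) (ψ n)) (h1 : ∀ n x, ‖ψ n x‖ ≤ 1)
    (hG : ∀ n, ∫ x, gradSq a (ψ n) x ≤ M) (hN : ∀ n, ∫ x, ‖ψ n x‖ ^ 2 ≤ M)
    (htight : ∀ ε > 0, ∃ L : ℝ, ∀ N : ℕ, L ≤ N → ∀ n,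
      ∫ x in {x : ℝ × ℝ | (N : ℝ) ≤ |x.2|}, ‖ψ n x‖ ^ 2 ≤ ε) :
    ∃ s : ℕ → ℕ, StrictMono s ∧ ∀ ε > 0, ∃ n₀, ∀ m ≥ n₀, ∀ n ≥ n₀,
      ∫ x, ‖ψ (s m) x - ψ (s n) x‖ ^ 2 ≤ ε := by
  have hM : 0 ≤ M := (integral_nonneg fun x => by positivity).trans (hN 0)
  -- All cell integrals, for all squares and subdivisions at once, form a point of a countable
  -- product of closed discs (because `|ψ| ≤ 1`). Compactness of the product gives a single
  -- subsequence along which every one of them converges.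
  set Φ : ℕ → (ℕ × ℕ × ℕ × ℕ) → ℂ := fun n q => cellInt q.1 q.2.1 q.2.2.1 q.2.2.2 (ψ n)
    with hΦ
  have hcomp : IsCompact (univ.pi fun q : ℕ × ℕ × ℕ × ℕ =>
      Metric.closedBall (0 : ℂ) (|2 * (q.1 : ℝ) / q.2.1| * |2 * (q.1 : ℝ) / q.2.1|)) :=
    isCompact_univ_pi fun q => isCompact_closedBall _ _
  have hmem : ∀ n, Φ n ∈ univ.pi fun q : ℕ × ℕ × ℕ × ℕ =>
      Metric.closedBall (0 : ℂ) (|2 * (q.1 : ℝ) / q.2.1| * |2 * (q.1 : ℝ) / q.2.1|) := by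
    intro n q _
    rw [mem_closedBall_zero_iff]
    have := norm_rectInt_le (h1 n)
      (-(q.1 : ℝ) + q.2.2.1 * (2 * q.1 / q.2.1))
      (-(q.1 : ℝ) + q.2.2.1 * (2 * q.1 / q.2.1) + 2 * q.1 / q.2.1)
      (-(q.1 : ℝ) + q.2.2.2 * (2 * q.1 / q.2.1))
      (-(q.1 : ℝ) + q.2.2.2 * (2 * q.1 / q.2.1) + 2 * q.1 / q.2.1)
    simp only [add_sub_cancel_left] at this
    exact this
  obtain ⟨ξ, -, s, hs, hlim⟩ := hcomp.tendsto_subseq hmem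
  refine ⟨s, hs, fun ε hε => ?_⟩
  have hcell : ∀ N k i j : ℕ, CauchySeq fun n => cellInt N k i j (ψ (s n)) := fun N k i j =>
    ((tendsto_pi_nhds.1 hlim (N, k, i, j))).cauchySeq
  -- The tail of a difference is at most `2 · ε/12 + 2 · ε/12 = ε/3`; mesh error and cell integrals
  -- contribute the other two thirds. The choice `N ≥ R/2` makes the square cover the strip for
  -- `|x₂| < N`.
  obtain ⟨L, hL⟩ := htight (ε / 12) (by positivity)
  obtain ⟨N, hNL⟩ := exists_nat_ge (max L (max (R / 2) 1))
  have hNL1 : L ≤ N := (le_max_left _ _).trans hNL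
  have hNR : R / 2 ≤ N := ((le_max_left _ _).trans (le_max_right _ _)).trans hNL
  have hN1 : (1 : ℝ) ≤ N := ((le_max_right _ _).trans (le_max_right _ _)).trans hNL
  have hN0 : 0 < N := by exact_mod_cast (show (0 : ℝ) < N by linarith)
  set B := 2 * (4 * M) + 2 * (N : ℝ) ^ 2 * (4 * M) with hB
  have hB0 : 0 ≤ B := by positivity
  -- The mesh is refined only after `N` is fixed, since the gradient bound `B` grows with `N`.
  obtain ⟨k, hk0, hk⟩ : ∃ k : ℕ, 0 < k ∧ 4 * (2 * N / k : ℝ) ^ 2 * B ≤ ε / 3 := by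
    have : Tendsto (fun k : ℕ => 4 * (2 * N / k : ℝ) ^ 2 * B) atTop (𝓝 0) := by
      have h2 : Tendsto (fun k : ℕ => (2 * N / k : ℝ)) atTop (𝓝 0) :=
        tendsto_const_div_atTop_nhds_zero_nat _
      simpa using ((h2.pow 2).const_mul 4).mul_const B
    obtain ⟨k, h2, h3⟩ := ((this.eventually_le_const (by positivity : 0 < ε / 3)).and
      (eventually_gt_atTop 0)).exists
    exact ⟨k, h3, h2⟩
  have hk' : (0 : ℝ) < k := Nat.cast_pos.2 hk0
  set d : ℝ := 2 * N / k with hd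
  have hd0 : 0 < d := by positivity
  have hsum : ∃ n₀, ∀ m ≥ n₀, ∀ n ≥ n₀, 4 / d ^ 2 * (∑ i ∈ Finset.range k,
      ∑ j ∈ Finset.range k, ‖cellInt N k i j (ψ (s m)) - cellInt N k i j (ψ (s n))‖ ^ 2)
        ≤ ε / 3 := by
    have h2 : Tendsto (fun p : ℕ × ℕ => 4 / d ^ 2 * (∑ i ∈ Finset.range k,
        ∑ j ∈ Finset.range k, ‖cellInt N k i j (ψ (s p.1)) - cellInt N k i j (ψ (s p.2))‖ ^ 2))
        atTop (𝓝 (4 / d ^ 2 * (∑ i ∈ Finset.range k, ∑ j ∈ Finset.range k, (0 : ℝ) ^ 2))) := by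
      refine (tendsto_finsetSum _ fun i _ => tendsto_finsetSum _ fun j _ => ?_).const_mul _
      refine Tendsto.pow ?_ 2
      have := cauchySeq_iff_tendsto_dist_atTop_0.1 (hcell N k i j)
      simpa [dist_eq_norm] using this
    simp only [ne_eq, OfNat.ofNat_ne_zero, not_false_eq_true, zero_pow, Finset.sum_const_zero,
      mul_zero] at h2
    have h3 := h2.eventually_le_const (by positivity : 0 < ε / 3)
    obtain ⟨⟨p, q⟩, hpq⟩ := eventually_atTop.1 h3
    exact ⟨max p q, fun m hm n hn => hpq (m, n)
      ⟨(le_max_left _ _).trans hm, (le_max_right _ _).trans hn⟩⟩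
  obtain ⟨n₀, hn₀⟩ := hsum
  refine ⟨n₀, fun m hm n hn => ?_⟩
  have hf := (hT (s m)).sub (hT (s n))
  have hfN : ∫ x, ‖ψ (s m) x - ψ (s n) x‖ ^ 2 ≤ 4 * M := by
    have := (hT (s m)).setIntegral_normSq_sub_le (hT (s n)) univ
    simp only [setIntegral_univ] at this
    linarith [hN (s m), hN (s n)]
  have hfG : ∫ x, gradSq a (fun x => ψ (s m) x - ψ (s n) x) x ≤ 4 * M := by
    have := (hT (s m)).integral_gradSq_sub_le (hT (s n)) a
    linarith [hG (s m), hG (s n)]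
  have hsq := hf.integral_square_le ha ha' hN0 hk0
  simp only [(hT (s m)).cellInt_sub (hT (s n)), ← hd] at hsq
  have hsq2 : ∫ x in square N, ‖ψ (s m) x - ψ (s n) x‖ ^ 2 ≤ ε / 3 + ε / 3 := by
    refine hsq.trans (add_le_add (hn₀ m hm n hn) (le_trans ?_ hk))
    rw [hB]
    gcongr
  have hfar : ∫ x in {x : ℝ × ℝ | (N : ℝ) ≤ |x.2|}, ‖ψ (s m) x - ψ (s n) x‖ ^ 2 ≤ ε / 3 := by
    have := (hT (s m)).setIntegral_normSq_sub_le (hT (s n)) {x : ℝ × ℝ | (N : ℝ) ≤ |x.2|}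
    linarith [hL N hNL1 (s m), hL N hNL1 (s n)]
  have hcompl : ∫ x in (square N)ᶜ, ‖ψ (s m) x - ψ (s n) x‖ ^ 2
      ≤ ∫ x in {x : ℝ × ℝ | (N : ℝ) ≤ |x.2|}, ‖ψ (s m) x - ψ (s n) x‖ ^ 2 := by
    rw [← integral_indicator (measurableSet_square N).compl,
      ← integral_indicator (measurableSet_far N)]
    refine integral_mono (hf.integrable_normSq.indicator (measurableSet_square N).compl)
      (hf.integrable_normSq.indicator (measurableSet_far N)) fun x => ?_
    by_cases hx : x ∈ {x : ℝ × ℝ | (N : ℝ) ≤ |x.2|}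
    · rw [indicator_of_mem hx]
      exact indicator_le_self' (fun _ _ => by positivity) x
    rw [indicator_of_notMem hx]
    by_cases hxs : x ∈ (square N)ᶜ
    · rw [indicator_of_mem hxs]
      have hx2 : |x.2| < N := not_le.1 hx
      by_contra hcon
      have h0 : ψ (s m) x - ψ (s n) x ≠ 0 := fun h0 => hcon (by simp [h0])
      have hx1 : x.1 ∈ Ioo (-R / 2) (R / 2) := (hf.supp (subset_tsupport _ h0)).1
      rw [abs_lt] at hx2
      exact hxs ⟨⟨by linarith [hx1.1], by linarith [hx1.2]⟩, hx2.1, hx2.2.le⟩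
    · rw [indicator_of_notMem hxs]
  rw [← integral_add_compl (measurableSet_square N) hf.integrable_normSq]
  linarith

/-! ### Convergence in `Lᵖ` -/

section Lp
variable {α : Type*} [MeasurableSpace α] {μ : Measure α}

theorem norm_toLp_pow {p : ℕ} (hp : p ≠ 0) {f : α → ℂ} (hf : MemLp f p μ) :
    ‖hf.toLp f‖ ^ p = ∫ x, ‖f x‖ ^ p ∂μ := by
  have h1 : eLpNorm f p μ ^ p = ∫⁻ x, ‖f x‖ₑ ^ p ∂μ := by
    have := eLpNorm_nnreal_pow_eq_lintegral (μ := μ) (f := f) (p := (p : NNReal))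
      (Nat.cast_ne_zero.2 hp)
    simpa using this
  have h2 : AEStronglyMeasurable (fun x => ‖f x‖ ^ p) μ := hf.1.norm.pow p
  rw [Lp.norm_toLp, ← ENNReal.toReal_pow, h1, integral_eq_lintegral_of_nonneg_ae
    (ae_of_all _ fun x => by simp only [Pi.zero_apply]; positivity) h2]
  congr 1
  refine lintegral_congr fun x => ?_
  rw [ENNReal.ofReal_pow (norm_nonneg _), ofReal_norm]

/-- Completeness of `Lᵖ`, for integer `p`. -/
theorem exists_limit_of_integral_cauchy {p : ℕ} (hp : p ≠ 0) {f : ℕ → α → ℂ}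
    (hf : ∀ n, MemLp (f n) p μ)
    (hc : ∀ ε > 0, ∃ n₀, ∀ m ≥ n₀, ∀ n ≥ n₀, ∫ x, ‖f m x - f n x‖ ^ p ∂μ ≤ ε) :
    ∃ u, MemLp u p μ ∧ Tendsto (fun n => eLpNorm (f n - u) p μ) atTop (𝓝 0) := by
  have : Fact (1 ≤ (p : ℝ≥0∞)) := ⟨by exact_mod_cast Nat.one_le_iff_ne_zero.2 hp⟩
  have hcs : CauchySeq fun n => (hf n).toLp (f n) := by
    rw [Metric.cauchySeq_iff]
    intro ε hε
    obtain ⟨n₀, h0⟩ := hc ((ε / 2) ^ p) (by positivity)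
    refine ⟨n₀, fun m hm n hn => ?_⟩
    have h1 := h0 m hm n hn
    have h2 := norm_toLp_pow hp ((hf m).sub (hf n))
    simp only [Pi.sub_apply] at h2
    rw [← h2] at h1
    have h3 := (pow_le_pow_iff_left₀ (norm_nonneg _) (by positivity) hp).1 h1
    rw [dist_eq_norm, ← MemLp.toLp_sub]
    linarith
  obtain ⟨F, hF⟩ := cauchySeq_tendsto_of_complete hcs
  refine ⟨F, Lp.memLp F, ?_⟩
  rw [← Lp.tendsto_Lp_iff_tendsto_eLpNorm'' f hf F (Lp.memLp F), Lp.toLp_coeFn]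
  exact hF

theorem tendsto_integral_norm_pow {p : ℕ} (hp : p ≠ 0) {f : ℕ → α → ℂ} {u : α → ℂ}
    (hf : ∀ n, MemLp (f n) p μ) (hu : MemLp u p μ)
    (h : Tendsto (fun n => eLpNorm (f n - u) p μ) atTop (𝓝 0)) :
    Tendsto (fun n => ∫ x, ‖f n x‖ ^ p ∂μ) atTop (𝓝 (∫ x, ‖u x‖ ^ p ∂μ)) := by
  have : Fact (1 ≤ (p : ℝ≥0∞)) := ⟨by exact_mod_cast Nat.one_le_iff_ne_zero.2 hp⟩
  have h1 := (Lp.tendsto_Lp_iff_tendsto_eLpNorm'' f hf u hu).2 h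
  have h2 := (h1.norm).pow p
  simpa only [norm_toLp_pow hp] using h2

theorem integral_cauchy_of_tendsto {p : ℕ} (hp : p ≠ 0) {f : ℕ → α → ℂ} {u : α → ℂ}
    (hf : ∀ n, MemLp (f n) p μ) (hu : MemLp u p μ)
    (h : Tendsto (fun n => eLpNorm (f n - u) p μ) atTop (𝓝 0)) :
    ∀ ε > 0, ∃ n₀, ∀ m ≥ n₀, ∀ n ≥ n₀, ∫ x, ‖f m x - f n x‖ ^ p ∂μ ≤ ε := by
  have : Fact (1 ≤ (p : ℝ≥0∞)) := ⟨by exact_mod_cast Nat.one_le_iff_ne_zero.2 hp⟩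
  have h1 := ((Lp.tendsto_Lp_iff_tendsto_eLpNorm'' f hf u hu).2 h).cauchySeq
  intro ε hε
  have h2 := (cauchySeq_iff_tendsto_dist_atTop_0.1 h1).pow p
  rw [zero_pow hp] at h2
  obtain ⟨⟨k, l⟩, hkl⟩ := eventually_atTop.1 (h2.eventually_le_const hε)
  refine ⟨max k l, fun m hm n hn => ?_⟩
  have h3 := hkl (m, n) ⟨(le_max_left _ _).trans hm, (le_max_right _ _).trans hn⟩
  have h4 := norm_toLp_pow hp ((hf m).sub (hf n))
  simp only [Pi.sub_apply] at h4
  rw [← h4, MemLp.toLp_sub, ← dist_eq_norm]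
  exact h3

/-- Pairing an `L²`-convergent sequence with a fixed `L²` function. -/
theorem tendsto_integral_mul {f : ℕ → α → ℂ} {u g : α → ℂ} (hf : ∀ n, MemLp (f n) 2 μ)
    (hu : MemLp u 2 μ) (hg : MemLp g 2 μ)
    (h : Tendsto (fun n => eLpNorm (f n - u) 2 μ) atTop (𝓝 0)) :
    Tendsto (fun n => ∫ x, g x * f n x ∂μ) atTop (𝓝 (∫ x, g x * u x ∂μ)) := by
  refine tendsto_integral_of_L1' _ (hg.integrable_mul hu).1
    (Eventually.of_forall fun n => hg.integrable_mul (hf n)) ?_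
  have hb : ∀ n, eLpNorm ((fun x => g x * f n x) - fun x => g x * u x) 1 μ
      ≤ eLpNorm g 2 μ * eLpNorm (f n - u) 2 μ := by
    intro n
    have e1 : ((fun x => g x * f n x) - fun x => g x * u x) = g • (f n - u) := by
      ext x
      simp [mul_sub]
    rw [e1]
    exact eLpNorm_smul_le_mul_eLpNorm ((hf n).1.sub hu.1) hg.1
  have h0 : Tendsto (fun n => eLpNorm g 2 μ * eLpNorm (f n - u) 2 μ) atTop (𝓝 0) := by
    simpa using ENNReal.Tendsto.const_mul h (Or.inr hg.2.ne)
  exact tendsto_of_tendsto_of_tendsto_of_le_of_le tendsto_const_nhds h0 (fun _ => zero_le) hb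

end Lp

/-! ### Test functions in `Lᵖ` and integration over the strip -/

theorem measurableSet_strip (R : ℝ) : MeasurableSet (strip R) :=
  measurableSet_Ioo.prod MeasurableSet.univ

theorem isOpen_strip (R : ℝ) : IsOpen (strip R) := isOpen_Ioo.prod isOpen_univ

theorem IsTest.memLp (h : IsTest U ψ) (p : ℝ≥0∞) (μ : Measure (ℝ × ℝ))
    [IsFiniteMeasureOnCompacts μ] : MemLp ψ p μ :=
  h.continuous.memLp_of_hasCompactSupport h.compact

theorem IsTest.memLp_covDerivSmooth (h : IsTest U ψ) (a : ℝ) (j : Fin 2) (p : ℝ≥0∞)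
    (μ : Measure (ℝ × ℝ)) [IsFiniteMeasureOnCompacts μ] : MemLp (covDerivSmooth a j ψ) p μ :=
  (h.continuous_covDerivSmooth a j).memLp_of_hasCompactSupport
    (HasCompactSupport.intro h.compact fun _ hx => covDerivSmooth_eq_zero hx)

/-- Integrands supported in `supp ψ ⊆ U` may be integrated over `U` or over the plane. -/
theorem IsTest.setIntegral_eq {E F : Type*} [NormedAddCommGroup E] [NormedSpace ℝ E]
    [NormedAddCommGroup F] [NormedSpace ℝ F] {ψ : ℝ × ℝ → F}
    (h : IsTest U ψ) {f : ℝ × ℝ → E} (h0 : ∀ x, x ∉ tsupport ψ → f x = 0) :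
    ∫ x in U, f x = ∫ x, f x :=
  setIntegral_eq_integral_of_forall_compl_eq_zero fun x hx => h0 x fun h' => hx (h.supp h')

/-! ### A Ladyzhenskaya type inequality -/

/-- A diamagnetic bound: `∂_j|ψ|² = 2 Re (conj ψ D_j ψ)` does not see the potential. The two
directions simply add up, because each coordinate of `v` is at most `‖v‖` in the sup norm. -/
theorem IsTest.norm_fderiv_normSq_le (h : IsTest U ψ) (a : ℝ) (x : ℝ × ℝ) :
    ‖fderiv ℝ (fun x => ‖ψ x‖ ^ 2) x‖ ≤ 2 * ‖ψ x‖ ^ 2 + gradSq a ψ x := by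
  have hre : ∀ j, (ψ x).re * (fderiv ℝ ψ x (e j)).re + (ψ x).im * (fderiv ℝ ψ x (e j)).im
      = (ψ x).re * (covDerivSmooth a j ψ x).re + (ψ x).im * (covDerivSmooth a j ψ x).im := by
    intro j
    simp only [covDerivSmooth]
    generalize sigma a x * A0 x j = r
    simp
    ring
  have hj : ∀ j, |fderiv ℝ (fun x => ‖ψ x‖ ^ 2) x (e j)|
      ≤ ‖ψ x‖ ^ 2 + ‖covDerivSmooth a j ψ x‖ ^ 2 := by
    intro j
    rw [h.fderiv_normSq, hre, sq_norm_eq, sq_norm_eq, abs_le]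
    constructor <;>
    nlinarith [sq_nonneg ((ψ x).re - (covDerivSmooth a j ψ x).re),
      sq_nonneg ((ψ x).im - (covDerivSmooth a j ψ x).im),
      sq_nonneg ((ψ x).re + (covDerivSmooth a j ψ x).re),
      sq_nonneg ((ψ x).im + (covDerivSmooth a j ψ x).im)]
  have h0 := hj 0
  have h1 := hj 1
  have hg := gradSq_nonneg a ψ x
  refine ContinuousLinearMap.opNorm_le_bound _ (by positivity) fun v => ?_
  set T := fderiv ℝ (fun x => ‖ψ x‖ ^ 2) x
  have hv : v = v.1 • e 0 + v.2 • e 1 := by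
    ext <;> simp [e]
  have h2 : T v = v.1 * T (e 0) + v.2 * T (e 1) := by
    conv_lhs => rw [hv]
    simp only [map_add, map_smul, smul_eq_mul]
  have hv1 : |v.1| ≤ ‖v‖ := norm_fst_le v
  have hv2 : |v.2| ≤ ‖v‖ := norm_snd_le v
  rw [h2, Real.norm_eq_abs, gradSq_eq]
  calc |v.1 * T (e 0) + v.2 * T (e 1)| ≤ |v.1| * |T (e 0)| + |v.2| * |T (e 1)| := by
        rw [← abs_mul, ← abs_mul]; exact abs_add_le _ _
    _ ≤ ‖v‖ * (‖ψ x‖ ^ 2 + ‖covDerivSmooth a 0 ψ x‖ ^ 2)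
        + ‖v‖ * (‖ψ x‖ ^ 2 + ‖covDerivSmooth a 1 ψ x‖ ^ 2) := by gcongr
    _ = _ := by ring

/-- The Gagliardo–Nirenberg–Sobolev inequality from `W^{1,1}` to `L²` in dimension two, applied to
`|ψ|²`. It makes the quartic term continuous in the magnetic Sobolev norm. -/
theorem exists_ladyzhenskaya_const : ∃ K : ℝ, 0 ≤ K ∧ ∀ (a : ℝ) (U : Set (ℝ × ℝ))
    (ψ : ℝ × ℝ → ℂ), IsTest U ψ →
    ∫ x, ‖ψ x‖ ^ 4 ≤ K * (2 * (∫ x, ‖ψ x‖ ^ 2) + ∫ x, gradSq a ψ x) ^ 2 := by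
  refine ⟨lintegralPowLePowLIntegralFDerivConst (volume : Measure (ℝ × ℝ)) 2, by positivity, ?_⟩
  intro a U ψ h
  set K := lintegralPowLePowLIntegralFDerivConst (volume : Measure (ℝ × ℝ)) 2
  have hp : Real.HolderConjugate (Module.finrank ℝ (ℝ × ℝ)) 2 := by
    simp only [Module.finrank_prod, Module.finrank_self]
    norm_num
    exact Real.HolderConjugate.two_two
  have h1 := lintegral_pow_le_pow_lintegral_fderiv (μ := (volume : Measure (ℝ × ℝ)))
    (h.normSq.smooth.of_le (by simp)) h.normSq.compact hp
  set B := 2 * (∫ x, ‖ψ x‖ ^ 2) + ∫ x, gradSq a ψ x with hB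
  have hB0 : 0 ≤ B := by
    have : 0 ≤ ∫ x, gradSq a ψ x := integral_nonneg fun x => gradSq_nonneg a ψ x
    have : 0 ≤ ∫ x, ‖ψ x‖ ^ 2 := integral_nonneg fun x => by positivity
    positivity
  have h2 : ∫⁻ x, ‖fderiv ℝ (fun x => ‖ψ x‖ ^ 2) x‖ₑ ≤ ENNReal.ofReal B := by
    have i1 : Integrable fun x => 2 * ‖ψ x‖ ^ 2 + gradSq a ψ x :=
      (h.integrable_normSq.const_mul 2).add (h.integrable_gradSq a)
    rw [hB, ← integral_const_mul, ← integral_add (h.integrable_normSq.const_mul 2)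
      (h.integrable_gradSq a), ofReal_integral_eq_lintegral_ofReal i1
      (ae_of_all _ fun x => by
        have := gradSq_nonneg a ψ x
        simp only [Pi.zero_apply]
        positivity)]
    refine lintegral_mono fun x => ?_
    rw [← ofReal_norm]
    exact ENNReal.ofReal_le_ofReal (h.norm_fderiv_normSq_le a x)
  have h3 : ENNReal.ofReal (∫ x, ‖ψ x‖ ^ 4) = ∫⁻ x, ‖‖ψ x‖ ^ 2‖ₑ ^ (2 : ℝ) := by
    rw [ofReal_integral_eq_lintegral_ofReal h.integrable_norm_pow_four
      (ae_of_all _ fun x => by simp only [Pi.zero_apply]; positivity)]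
    refine lintegral_congr fun x => ?_
    rw [← ofReal_norm, ENNReal.ofReal_rpow_of_nonneg (norm_nonneg _) (by norm_num)]
    congr 1
    rw [Real.norm_of_nonneg (by positivity), Real.rpow_ofNat]
    ring
  have h4 : ENNReal.ofReal (∫ x, ‖ψ x‖ ^ 4) ≤ ENNReal.ofReal (K * B ^ 2) := by
    rw [h3]
    refine h1.trans ?_
    rw [ENNReal.ofReal_mul (by positivity), ENNReal.ofReal_coe_nnreal,
      ENNReal.ofReal_pow hB0, ENNReal.rpow_ofNat]
    gcongr
  exact (ENNReal.ofReal_le_ofReal_iff (by positivity)).1 h4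

/-! ### Limits of test functions and the space `𝓓_R` -/

theorem locallyIntegrableOn_of_memLp {u : ℝ × ℝ → ℂ}
    (hu : MemLp u 2 (volume.restrict U)) : LocallyIntegrableOn u U :=
  locallyIntegrableOn_of_locallyIntegrable_restrict (hu.locallyIntegrable (by norm_num))

theorem integrable_mul_of_memLp {μ : Measure (ℝ × ℝ)} {f g : ℝ × ℝ → ℂ} (hf : MemLp f 2 μ)
    (hg : MemLp g 2 μ) : Integrable (fun x => f x * g x) μ := hf.integrable_mul hg

theorem HasWeakPartial.ae_eq (hU : IsOpen U) {j : Fin 2} {u w₁ w₂ : ℝ × ℝ → ℂ}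
    (h₁ : HasWeakPartial U j u w₁) (h₂ : HasWeakPartial U j u w₂) :
    w₁ =ᵐ[volume.restrict U] w₂ := by
  have key := hU.ae_eq_zero_of_integral_contDiff_smul_eq_zero (μ := volume)
    (f := fun x => w₁ x - w₂ x) (h₁.locInt_deriv.sub h₂.locInt_deriv) fun g hg hgc hgU => by
      have hT : IsTest U g := ⟨hg, hgc, hgU⟩
      have e1 := h₁.byParts g hT
      have e2 := h₂.byParts g hT
      rw [e1, neg_inj] at e2
      have i : ∀ w : ℝ × ℝ → ℂ, LocallyIntegrableOn w U →
          IntegrableOn (fun x => (g x : ℂ) * w x) U := by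
        intro w hw
        have h3 : IntegrableOn (fun x => (g x : ℂ) * w x) (tsupport g) :=
          ((hw.integrableOn_compact_subset hgU hgc).continuousOn_mul
            (Complex.continuous_ofReal.comp hT.continuous).continuousOn hgc)
        have h4 : Integrable fun x => (g x : ℂ) * w x := by
          rwa [integrableOn_iff_integrable_of_support_subset] at h3
          intro x hx
          by_contra hx'
          exact hx (by simp [image_eq_zero_of_notMem_tsupport hx'])
        exact h4.integrableOn
      rw [← hT.setIntegral_eq (fun x hx => by simp [image_eq_zero_of_notMem_tsupport hx])]
      simp only [Complex.real_smul, mul_sub]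
      rw [integral_sub (i _ h₁.locInt_deriv) (i _ h₂.locInt_deriv), e2, sub_self]
  rw [Filter.EventuallyEq, ae_restrict_iff' hU.measurableSet]
  filter_upwards [key] with x hx hxU using sub_eq_zero.1 (hx hxU)

/-- `weakPartial` is a chosen representative, so it can be identified only through almost everywhere
uniqueness of weak derivatives. -/
theorem HasWeakPartial.weakPartial_ae_eq (hU : IsOpen U) {j : Fin 2} {u w : ℝ × ℝ → ℂ}
    (h : HasWeakPartial U j u w) : weakPartial U j u =ᵐ[volume.restrict U] w := by
  have hex : ∃ w, HasWeakPartial U j u w := ⟨w, h⟩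
  have : weakPartial U j u = hex.choose := by simp only [weakPartial, dif_pos hex]
  rw [this]
  exact hex.choose_spec.ae_eq hU h

/-- Integration by parts against a fixed `θ` passes to the `L²` limit, since `θ`, `∂_jθ` and `θσA₀`
are continuous with compact support and hence in `L²`. -/
theorem hasWeakPartial_of_tendsto {a R : ℝ} {j : Fin 2} {ψ : ℕ → ℝ × ℝ → ℂ} {u w : ℝ × ℝ → ℂ}
    (hψ : ∀ n, IsTest (strip R) (ψ n)) (hu : MemLp u 2 (volume.restrict (strip R)))
    (hw : MemLp w 2 (volume.restrict (strip R)))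
    (h1 : Tendsto (fun n => eLpNorm (ψ n - u) 2 (volume.restrict (strip R))) atTop (𝓝 0))
    (h2 : Tendsto (fun n => eLpNorm (covDerivSmooth a j (ψ n) - w) 2
      (volume.restrict (strip R))) atTop (𝓝 0)) :
    HasWeakPartial (strip R) j u
      (fun x => w x + Complex.I * (sigma a x * A0 x j : ℝ) * u x) := by
  have hcA : Continuous fun x : ℝ × ℝ => Complex.I * (sigma a x * A0 x j : ℝ) := by
    have := continuous_sigma_mul_A0 a j
    fun_prop
  refine ⟨locallyIntegrableOn_of_memLp hu, ?_, fun θ hθ => ?_⟩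
  · exact (locallyIntegrableOn_of_memLp hw).add
      ((locallyIntegrableOn_of_memLp hu).continuousOn_mul hcA.continuousOn
        (isOpen_strip R).isLocallyClosed)
  have cθ : Continuous fun x => (θ x : ℂ) := Complex.continuous_ofReal.comp hθ.continuous
  have cdθ : Continuous fun x => (fderiv ℝ θ x (e j) : ℂ) :=
    Complex.continuous_ofReal.comp (hθ.continuous_fderiv_apply (e j))
  have mem : ∀ {g : ℝ × ℝ → ℂ}, Continuous g → (∀ x, x ∉ tsupport θ → g x = 0) →
      MemLp g 2 (volume.restrict (strip R)) := fun hg h0 =>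
    hg.memLp_of_hasCompactSupport (HasCompactSupport.intro hθ.compact h0)
  have m1 : MemLp (fun x => (fderiv ℝ θ x (e j) : ℂ)) 2 (volume.restrict (strip R)) :=
    mem cdθ fun x hx => by simp [fderiv_eq_zero_of_notMem_tsupport hx]
  have m2 : MemLp (fun x => (θ x : ℂ)) 2 (volume.restrict (strip R)) :=
    mem cθ fun x hx => by simp [image_eq_zero_of_notMem_tsupport hx]
  have m3 : MemLp (fun x => (θ x : ℂ) * (Complex.I * (sigma a x * A0 x j : ℝ))) 2
      (volume.restrict (strip R)) :=
    mem (cθ.mul hcA) fun x hx => by simp [image_eq_zero_of_notMem_tsupport hx]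
  have mψ := fun n => (hψ n).memLp 2 (volume.restrict (strip R))
  have mD := fun n => (hψ n).memLp_covDerivSmooth a j 2 (volume.restrict (strip R))
  have l1 := tendsto_integral_mul mψ hu m1 h1
  have l2 := tendsto_integral_mul mD hw m2 h2
  have l3 := tendsto_integral_mul mψ hu m3 h1
  have heq : ∀ n, ∫ x in strip R, (fderiv ℝ θ x (e j) : ℂ) * ψ n x
      = -((∫ x in strip R, (θ x : ℂ) * covDerivSmooth a j (ψ n) x)
        + ∫ x in strip R, (θ x : ℂ) * (Complex.I * (sigma a x * A0 x j : ℝ)) * ψ n x) := by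
    intro n
    rw [← integral_add (integrable_mul_of_memLp m2 (mD n)) (integrable_mul_of_memLp m3 (mψ n)),
      hθ.setIntegral_eq (fun x hx => by simp [fderiv_eq_zero_of_notMem_tsupport hx]),
      hθ.setIntegral_eq (fun x hx => by simp [image_eq_zero_of_notMem_tsupport hx])]
    have hib := integral_smul_fderiv_eq_neg_fderiv_smul_of_integrable (μ := volume) (f := θ)
      (g := ψ n) (v := e j)
      (hθ.integrable ((hθ.continuous_fderiv_apply _).smul (hψ n).continuous)
        fun x hx => by simp [fderiv_eq_zero_of_notMem_tsupport hx])
      (hθ.integrable (hθ.continuous.smul ((hψ n).continuous_fderiv_apply _))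
        fun x hx => by simp [image_eq_zero_of_notMem_tsupport hx])
      (hθ.integrable (hθ.continuous.smul (hψ n).continuous)
        fun x hx => by simp [image_eq_zero_of_notMem_tsupport hx])
      (fun x _ => hθ.differentiable x) (fun x _ => (hψ n).differentiable x)
    simp only [Complex.real_smul] at hib
    rw [eq_comm, neg_eq_iff_eq_neg, ← hib]
    refine integral_congr_ae (ae_of_all _ fun x => ?_)
    simp only [covDerivSmooth]
    ring
  have l4 := (l2.add l3).neg
  have hlim := tendsto_nhds_unique (l1.congr heq) l4
  rw [hlim, neg_inj, ← integral_add (integrable_mul_of_memLp m2 hw)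
    (integrable_mul_of_memLp m3 hu)]
  refine integral_congr_ae (ae_of_all _ fun x => ?_)
  ring

/-- `L²`-limits of test functions together with their covariant derivatives lie in `𝓓_R`. -/
theorem mem_domainD_of_tendsto {a R : ℝ} {ψ : ℕ → ℝ × ℝ → ℂ} {u : ℝ × ℝ → ℂ}
    {w : Fin 2 → ℝ × ℝ → ℂ}
    (hψ : ∀ n, IsTest (strip R) (ψ n)) (hu : MemLp u 2 (volume.restrict (strip R)))
    (hw : ∀ j, MemLp (w j) 2 (volume.restrict (strip R)))
    (h1 : Tendsto (fun n => eLpNorm (ψ n - u) 2 (volume.restrict (strip R))) atTop (𝓝 0))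
    (h2 : ∀ j, Tendsto (fun n => eLpNorm (covDerivSmooth a j (ψ n) - w j) 2
      (volume.restrict (strip R))) atTop (𝓝 0)) :
    u ∈ domainD a R ∧ ∀ j, covDeriv a (strip R) j u =ᵐ[volume.restrict (strip R)] w j := by
  have hweak := fun j => hasWeakPartial_of_tendsto hψ hu (hw j) h1 (h2 j)
  have hae : ∀ j, covDeriv a (strip R) j u =ᵐ[volume.restrict (strip R)] w j := by
    intro j
    filter_upwards [(hweak j).weakPartial_ae_eq (isOpen_strip R)] with x hx
    rw [covDeriv, hx]
    ring
  refine ⟨⟨⟨hu, fun j => ⟨_, hweak j⟩, fun j => (memLp_congr_ae (hae j)).2 (hw j)⟩,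
    ψ, hψ, h1, fun j => ?_⟩, hae⟩
  refine (h2 j).congr fun n => eLpNorm_congr_ae ?_
  filter_upwards [hae j] with x hx
  simp [hx]

/-- The energy is continuous along sequences of test functions converging in `𝓓_R`. -/
theorem tendsto_energyS {a b R : ℝ} {ψ : ℕ → ℝ × ℝ → ℂ} {u : ℝ × ℝ → ℂ}
    (hψ : ∀ n, IsTest (strip R) (ψ n)) (hu : MemMagSobolev a (strip R) u)
    (h1 : Tendsto (fun n => eLpNorm (ψ n - u) 2 (volume.restrict (strip R))) atTop (𝓝 0))
    (h2 : ∀ j, Tendsto (fun n => eLpNorm (covDerivSmooth a j (ψ n) - covDeriv a (strip R) j u) 2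
      (volume.restrict (strip R))) atTop (𝓝 0)) :
    Tendsto (fun n => energyS a b (ψ n)) atTop (𝓝 (energyG a b R u)) := by
  set μ := volume.restrict (strip R) with hμ
  have mψ := fun n => (hψ n).memLp 2 μ
  have mψ4 := fun n => (hψ n).memLp ((4 : ℕ) : ℝ≥0∞) μ
  have mD := fun n j => (hψ n).memLp_covDerivSmooth a j 2 μ
  have hu2 := hu.memLp
  have hw := hu.memLp_covDeriv
  obtain ⟨K, hK0, hK⟩ := exists_ladyzhenskaya_const
  have cψ := integral_cauchy_of_tendsto (p := 2) two_ne_zero mψ hu2 h1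
  have cD := fun j => integral_cauchy_of_tendsto (p := 2) two_ne_zero (fun n => mD n j) (hw j)
    (h2 j)
  -- Mass and kinetic energy converge by the `L²` hypotheses. For the quartic term the Ladyzhenskaya
  -- inequality is applied to differences, with `2 ∫ |ψ m - ψ n|² + ∫ gradSq ≤ 2δ + 2δ`.
  have c4 : ∀ ε > 0, ∃ n₀, ∀ m ≥ n₀, ∀ n ≥ n₀, ∫ x, ‖ψ m x - ψ n x‖ ^ 4 ∂μ ≤ ε := by
    intro ε hε
    obtain ⟨δ, hδ, hδε⟩ : ∃ δ > 0, K * (4 * δ) ^ 2 ≤ ε := by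
      refine ⟨√(ε / (16 * (K + 1))), by positivity, ?_⟩
      rw [mul_pow, Real.sq_sqrt (by positivity)]
      rw [show K * (4 ^ 2 * (ε / (16 * (K + 1)))) = ε * (K / (K + 1)) by field_simp; ring]
      exact mul_le_of_le_one_right hε.le ((div_le_one (by positivity)).2 (by linarith))
    obtain ⟨n₁, e1⟩ := cψ δ hδ
    obtain ⟨n₂, e2⟩ := cD 0 δ hδ
    obtain ⟨n₃, e3⟩ := cD 1 δ hδ
    refine ⟨max n₁ (max n₂ n₃), fun m hm n hn => ?_⟩
    have hT := (hψ m).sub (hψ n)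
    have f1 := e1 m ((le_max_left _ _).trans hm) n ((le_max_left _ _).trans hn)
    have f2 := e2 m (((le_max_left _ _).trans (le_max_right _ _)).trans hm) n
      (((le_max_left _ _).trans (le_max_right _ _)).trans hn)
    have f3 := e3 m (((le_max_right _ _).trans (le_max_right _ _)).trans hm) n
      (((le_max_right _ _).trans (le_max_right _ _)).trans hn)
    rw [hμ, hT.setIntegral_eq (fun x hx => by
      have := image_eq_zero_of_notMem_tsupport hx
      simp [this])] at f1 ⊢
    have hD : ∀ j, ∫ x in strip R, ‖covDerivSmooth a j (ψ m) x - covDerivSmooth a j (ψ n) x‖ ^ 2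
        = ∫ x, ‖covDerivSmooth a j (fun x => ψ m x - ψ n x) x‖ ^ 2 := by
      intro j
      simp only [← (hψ m).covDerivSmooth_sub (hψ n)]
      exact hT.setIntegral_eq fun x hx => by simp [covDerivSmooth_eq_zero hx]
    rw [hμ, hD] at f2 f3
    have iD : ∀ j, Integrable fun x => ‖covDerivSmooth a j (fun x => ψ m x - ψ n x) x‖ ^ 2 :=
      fun j => hT.integrable ((hT.continuous_covDerivSmooth a j).norm.pow 2) fun x hx => by
        simp [covDerivSmooth_eq_zero hx]
    have hg : ∫ x, gradSq a (fun x => ψ m x - ψ n x) x ≤ 2 * δ := by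
      simp only [gradSq_eq]
      rw [integral_add (iD 0) (iD 1)]
      linarith
    have hg0 : 0 ≤ ∫ x, gradSq a (fun x => ψ m x - ψ n x) x :=
      integral_nonneg fun x => gradSq_nonneg a _ x
    have hn0 : 0 ≤ ∫ x, ‖ψ m x - ψ n x‖ ^ 2 := integral_nonneg fun x => by positivity
    refine (hK a (strip R) _ hT).trans (le_trans ?_ hδε)
    gcongr
    linarith
  obtain ⟨u', hu', ht'⟩ := exists_limit_of_integral_cauchy (by norm_num) mψ4 c4
  -- The `L²` and `L⁴` limits agree, both being limits in measure of the same sequence.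
  have huu : u =ᵐ[μ] u' := by
    refine tendstoInMeasure_ae_unique (f := ψ) (u := atTop) ?_ ?_
    · exact tendstoInMeasure_of_tendsto_eLpNorm (p := 2) (by norm_num) (fun n => (mψ n).1) hu2.1 h1
    · exact tendstoInMeasure_of_tendsto_eLpNorm (p := ((4 : ℕ) : ℝ≥0∞)) (by norm_num)
        (fun n => (mψ4 n).1) hu'.1 ht'
  have hu4 : MemLp u ((4 : ℕ) : ℝ≥0∞) μ := (memLp_congr_ae huu).2 hu'
  have t4 : Tendsto (fun n => eLpNorm (ψ n - u) ((4 : ℕ) : ℝ≥0∞) μ) atTop (𝓝 0) := by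
    refine ht'.congr fun n => eLpNorm_congr_ae ?_
    filter_upwards [huu] with x hx
    simp [hx]
  have T1 := tendsto_integral_norm_pow (p := 2) two_ne_zero mψ hu2 h1
  have T2 := fun j => tendsto_integral_norm_pow (p := 2) two_ne_zero (fun n => mD n j) (hw j) (h2 j)
  have T4 := tendsto_integral_norm_pow (p := 4) (by norm_num) mψ4 hu4 t4
  have iw : ∀ j, Integrable (fun x => ‖covDeriv a (strip R) j u x‖ ^ 2) μ := fun j =>
    (hw j).integrable_norm_pow (p := 2) two_ne_zero
  have iu : Integrable (fun x => ‖u x‖ ^ 2) μ := hu2.integrable_norm_pow (p := 2) two_ne_zero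
  have iu4 : Integrable (fun x => ‖u x‖ ^ 4) μ := hu4.integrable_norm_pow (by norm_num)
  have ig : Integrable (fun x => covGradSq a (strip R) u x) μ :=
    integrable_finsetSum _ fun j _ => iw j
  have igu : Integrable (fun x => b * covGradSq a (strip R) u x - ‖u x‖ ^ 2) μ :=
    (ig.const_mul b).sub iu
  have hE : energyG a b R u = b * (∑ j, ∫ x, ‖covDeriv a (strip R) j u x‖ ^ 2 ∂μ)
      - (∫ x, ‖u x‖ ^ 2 ∂μ) + 1 / 2 * ∫ x, ‖u x‖ ^ 4 ∂μ := by
    rw [energyG, ← hμ, integral_add igu (iu4.const_mul _), integral_sub (ig.const_mul b) iu,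
      integral_const_mul, integral_const_mul]
    simp only [covGradSq]
    rw [integral_finsetSum _ fun j _ => iw j]
  have hEn : ∀ n, energyS a b (ψ n) = b * (∑ j, ∫ x, ‖covDerivSmooth a j (ψ n) x‖ ^ 2 ∂μ)
      - (∫ x, ‖ψ n x‖ ^ 2 ∂μ) + 1 / 2 * ∫ x, ‖ψ n x‖ ^ 4 ∂μ := by
    intro n
    have hT := hψ n
    have iD : ∀ j, Integrable fun x => ‖covDerivSmooth a j (ψ n) x‖ ^ 2 :=
      fun j => hT.integrable ((hT.continuous_covDerivSmooth a j).norm.pow 2) fun x hx => by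
        simp [covDerivSmooth_eq_zero hx]
    rw [hT.energyS_eq, hμ,
      hT.setIntegral_eq (fun x hx => by simp [image_eq_zero_of_notMem_tsupport hx]),
      hT.setIntegral_eq (fun x hx => by simp [image_eq_zero_of_notMem_tsupport hx])]
    simp only [gradSq]
    rw [integral_finsetSum _ fun j _ => iD j]
    congr 3
    refine Finset.sum_congr rfl fun j _ => ?_
    exact (hT.setIntegral_eq fun x hx => by simp [covDerivSmooth_eq_zero hx]).symm
  rw [hE]
  simp only [hEn]
  exact (((tendsto_finsetSum _ fun j _ => T2 j).const_mul b).sub T1).add (T4.const_mul _)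

/-! ### Existence of a minimizer -/

/-- The parallelogram identity for the kinetic energy, and convexity of the quartic term. -/
theorem IsTest.energyS_midpoint_le {f g : ℝ × ℝ → ℂ} (hf : IsTest U f) (hg : IsTest U g)
    (a : ℝ) {b : ℝ} :
    energyS a b (fun x => (1 / 2 : ℂ) * (f x + g x))
        + b / 4 * ∫ x, gradSq a (fun x => f x - g x) x
      ≤ 1 / 2 * (energyS a b f + energyS a b g) + 1 / 4 * ∫ x, ‖f x - g x‖ ^ 2 := by
  have hm := (hf.add hg).const_mul (1 / 2)
  have hd := hf.sub hg
  have iE : Integrable fun x => (b * gradSq a f x - ‖f x‖ ^ 2 + 1 / 2 * ‖f x‖ ^ 4)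
      + (b * gradSq a g x - ‖g x‖ ^ 2 + 1 / 2 * ‖g x‖ ^ 4) :=
    (hf.integrable_energyS a b).add (hg.integrable_energyS a b)
  unfold energyS
  rw [← integral_const_mul, ← integral_const_mul, ← integral_add
    (hf.integrable_energyS a b) (hg.integrable_energyS a b), ← integral_const_mul,
    ← integral_add (hm.integrable_energyS a b) ((hd.integrable_gradSq a).const_mul _),
    ← integral_add (iE.const_mul _) (hd.integrable_normSq.const_mul _)]
  refine integral_mono ((hm.integrable_energyS a b).add ((hd.integrable_gradSq a).const_mul _))
    ((iE.const_mul _).add (hd.integrable_normSq.const_mul _)) fun x => ?_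
  have pl : ∀ z w : ℂ, ‖(1 / 2 : ℂ) * (z + w)‖ ^ 2 + 1 / 4 * ‖z - w‖ ^ 2
      = 1 / 2 * (‖z‖ ^ 2 + ‖w‖ ^ 2) := by
    intro z w
    rw [norm_mul, mul_pow]
    have h0 : ‖(1 / 2 : ℂ)‖ = 1 / 2 := by norm_num
    rw [h0]
    simp only [sq_norm_eq, Complex.add_re, Complex.add_im, Complex.sub_re, Complex.sub_im]
    ring
  have hgrad : gradSq a (fun x => (1 / 2 : ℂ) * (f x + g x)) x
      + 1 / 4 * gradSq a (fun x => f x - g x) x = 1 / 2 * (gradSq a f x + gradSq a g x) := by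
    simp only [gradSq_eq, hf.covDerivSmooth_sub hg, (hf.add hg).covDerivSmooth_const_mul,
      hf.covDerivSmooth_add hg]
    have p0 := pl (covDerivSmooth a 0 f x) (covDerivSmooth a 0 g x)
    have p1 := pl (covDerivSmooth a 1 f x) (covDerivSmooth a 1 g x)
    linarith
  have hn := pl (f x) (g x)
  have h4 : ‖(1 / 2 : ℂ) * (f x + g x)‖ ^ 4 ≤ 1 / 2 * (‖f x‖ ^ 4 + ‖g x‖ ^ 4) := by
    rw [norm_pow_four_eq, norm_pow_four_eq (f x), norm_pow_four_eq (g x)]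
    have h5 : ‖(1 / 2 : ℂ) * (f x + g x)‖ ^ 2 ≤ 1 / 2 * (‖f x‖ ^ 2 + ‖g x‖ ^ 2) := by
      nlinarith [sq_nonneg ‖f x - g x‖]
    have h6 := pow_le_pow_left₀ (sq_nonneg _) h5 2
    nlinarith [sq_nonneg (‖f x‖ ^ 2 - ‖g x‖ ^ 2)]
  have hb : b * gradSq a (fun x => (1 / 2 : ℂ) * (f x + g x)) x
      + b / 4 * gradSq a (fun x => f x - g x) x = b / 2 * (gradSq a f x + gradSq a g x) := by
    linear_combination b * hgrad
  beta_reduce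
  linarith

theorem IsTest.exists_boxTest {R : ℝ} (h : IsTest (strip R) ψ) :
    ∃ m₀ : ℕ, ∀ m : ℕ, m₀ ≤ m → BoxTest R m ψ := by
  obtain ⟨r, hr⟩ := h.compact.isBounded.exists_norm_le
  obtain ⟨m₀, hm₀⟩ := exists_nat_ge r
  refine ⟨m₀, fun m hm => ⟨h, fun x hx => ?_⟩⟩
  by_contra h0
  have h1 := hr x (subset_tsupport _ h0)
  have h2 : |x.2| ≤ ‖x‖ := norm_snd_le x
  have h3 : (m₀ : ℝ) ≤ m := Nat.cast_le.2 hm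
  linarith

/-- Fatou's lemma; in terms of `lintegral`, integrability of the limit need not be known. -/
theorem lintegral_ofReal_le_of_tendsto {α : Type*} [MeasurableSpace α] {μ : Measure α}
    {f : ℕ → α → ℝ} {g : α → ℝ} {K : ℝ≥0∞} (hf : ∀ n, Measurable (f n))
    (hlim : ∀ᵐ x ∂μ, Tendsto (fun n => f n x) atTop (𝓝 (g x)))
    (hK : ∀ n, ∫⁻ x, ENNReal.ofReal (f n x) ∂μ ≤ K) :
    ∫⁻ x, ENNReal.ofReal (g x) ∂μ ≤ K := by
  calc ∫⁻ x, ENNReal.ofReal (g x) ∂μ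
      = ∫⁻ x, liminf (fun n => ENNReal.ofReal (f n x)) atTop ∂μ := by
        refine lintegral_congr_ae ?_
        filter_upwards [hlim] with x hx
        exact ((ENNReal.continuous_ofReal.tendsto _).comp hx).liminf_eq.symm
    _ ≤ liminf (fun n => ∫⁻ x, ENNReal.ofReal (f n x) ∂μ) atTop :=
        lintegral_liminf_le fun n => (hf n).ennreal_ofReal
    _ ≤ K := by
        refine liminf_le_of_le (by isBoundedDefault) fun c hc => ?_
        obtain ⟨n, hn⟩ := hc.exists
        exact hn.trans (hK n)

theorem tendsto_div_log_sq : Tendsto (fun t : ℝ => t / Real.log t ^ 2) atTop atTop := by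
  have h1 := (Real.isLittleO_pow_log_id_atTop (n := 2)).tendsto_div_nhds_zero
  have h2 : ∀ᶠ t : ℝ in atTop, 0 < Real.log t ^ 2 / id t := by
    filter_upwards [eventually_gt_atTop 4] with t ht
    have := one_le_log ht.le
    have : 0 < id t := by simp only [id]; linarith
    positivity
  have h3 := (tendsto_nhdsWithin_iff.2 ⟨h1, h2⟩).inv_tendsto_nhdsGT_zero
  refine h3.congr fun t => ?_
  simp

/-- The weighted bound makes the tails uniformly small. -/
theorem exists_tail_le {a B ε : ℝ} (hB : 0 < B) (hε : 0 < ε) : ∃ L : ℝ, ∀ N : ℕ, L ≤ N →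
    ∀ (U : Set (ℝ × ℝ)) (ψ : ℝ × ℝ → ℂ), IsTest U ψ →
      ∫⁻ x in {x : ℝ × ℝ | 4 ≤ |x.2|}, ENNReal.ofReal (|x.2| / Real.log |x.2| ^ 2 *
        (gradSq a ψ x + ‖ψ x‖ ^ 2)) ≤ ENNReal.ofReal B →
      ∫ x in {x : ℝ × ℝ | (N : ℝ) ≤ |x.2|}, ‖ψ x‖ ^ 2 ≤ ε := by
  obtain ⟨L, hL⟩ := eventually_atTop.1 (tendsto_div_log_sq.eventually_ge_atTop (B / ε))
  refine ⟨max L 4, fun N hN U ψ h hw => ?_⟩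
  have hN1 : L ≤ N := (le_max_left _ _).trans hN
  have hN4 : (4 : ℝ) ≤ N := (le_max_right _ _).trans hN
  set S := {x : ℝ × ℝ | (N : ℝ) ≤ |x.2|} with hS
  have hSm : MeasurableSet S := measurableSet_far N
  have i1 : IntegrableOn (fun x => B / ε * ‖ψ x‖ ^ 2) S :=
    (h.integrable_normSq.const_mul _).integrableOn
  have h1 : ENNReal.ofReal (B / ε * ∫ x in S, ‖ψ x‖ ^ 2) ≤ ENNReal.ofReal B := by
    rw [← integral_const_mul, ofReal_integral_eq_lintegral_ofReal i1
      (ae_of_all _ fun x => by simp only [Pi.zero_apply]; positivity)]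
    refine le_trans ?_ hw
    refine le_trans (setLIntegral_mono' hSm fun x hx => ?_)
      (lintegral_mono_set (s := S) fun x hx => hN4.trans hx)
    refine ENNReal.ofReal_le_ofReal ?_
    have h2 := hL |x.2| (hN1.trans hx)
    have h3 := gradSq_nonneg a ψ x
    calc B / ε * ‖ψ x‖ ^ 2 ≤ |x.2| / Real.log |x.2| ^ 2 * ‖ψ x‖ ^ 2 := by gcongr
      _ ≤ _ := by
        gcongr
        linarith
  have h2 := (ENNReal.ofReal_le_ofReal_iff hB.le).1 h1
  have h3 : B * (∫ x in S, ‖ψ x‖ ^ 2) ≤ B * ε := by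
    calc B * (∫ x in S, ‖ψ x‖ ^ 2) = ε * (B / ε * ∫ x in S, ‖ψ x‖ ^ 2) := by field_simp
      _ ≤ ε * B := by gcongr
      _ = B * ε := mul_comm _ _
  exact le_of_mul_le_mul_left h3 hB

/-- A sequence converging in `L²` together with its covariant derivatives converges almost
everywhere along a subsequence. -/
theorem exists_subseq_tendsto_ae {α : Type*} [MeasurableSpace α] {μ : Measure α}
    {f₀ f₁ f₂ : ℕ → α → ℂ} {g₀ g₁ g₂ : α → ℂ}
    (m₀ : ∀ n, AEStronglyMeasurable (f₀ n) μ) (m₁ : ∀ n, AEStronglyMeasurable (f₁ n) μ)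
    (m₂ : ∀ n, AEStronglyMeasurable (f₂ n) μ) (n₀ : AEStronglyMeasurable g₀ μ)
    (n₁ : AEStronglyMeasurable g₁ μ) (n₂ : AEStronglyMeasurable g₂ μ)
    (h₀ : Tendsto (fun n => eLpNorm (f₀ n - g₀) 2 μ) atTop (𝓝 0))
    (h₁ : Tendsto (fun n => eLpNorm (f₁ n - g₁) 2 μ) atTop (𝓝 0))
    (h₂ : Tendsto (fun n => eLpNorm (f₂ n - g₂) 2 μ) atTop (𝓝 0)) :
    ∃ s : ℕ → ℕ, ∀ᵐ x ∂μ, Tendsto (fun n => f₀ (s n) x) atTop (𝓝 (g₀ x)) ∧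
      Tendsto (fun n => f₁ (s n) x) atTop (𝓝 (g₁ x)) ∧
      Tendsto (fun n => f₂ (s n) x) atTop (𝓝 (g₂ x)) := by
  obtain ⟨s, hs, as⟩ := (tendstoInMeasure_of_tendsto_eLpNorm (p := 2) (by norm_num) m₀ n₀
    h₀).exists_seq_tendsto_ae
  obtain ⟨t, ht, at'⟩ := (tendstoInMeasure_of_tendsto_eLpNorm (p := 2) (by norm_num)
    (fun n => m₁ (s n)) n₁ (h₁.comp hs.tendsto_atTop)).exists_seq_tendsto_ae
  obtain ⟨r, hr, ar⟩ := (tendstoInMeasure_of_tendsto_eLpNorm (p := 2) (by norm_num)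
    (fun n => m₂ (s (t n))) n₂
    (h₂.comp (hs.tendsto_atTop.comp ht.tendsto_atTop))).exists_seq_tendsto_ae
  refine ⟨fun n => s (t (r n)), ?_⟩
  filter_upwards [as, at', ar] with x h1 h2 h3
  exact ⟨h1.comp (ht.tendsto_atTop.comp hr.tendsto_atTop), h2.comp hr.tendsto_atTop, h3⟩

/-- A minimizing sequence of test functions which is Cauchy in `L²` converges in `𝓓_R` to a
minimizer. -/
theorem exists_minimizer_of_cauchy {a b R e₀ : ℝ} (hb : 0 < b) {ψ : ℕ → ℝ × ℝ → ℂ}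
    (hT : ∀ n, IsTest (strip R) (ψ n)) (hlow : ∀ v, IsTest (strip R) v → e₀ ≤ energyS a b v)
    (hE : Tendsto (fun n => energyS a b (ψ n)) atTop (𝓝 e₀))
    (hc : ∀ ε > 0, ∃ n₀, ∀ m ≥ n₀, ∀ n ≥ n₀, ∫ x, ‖ψ m x - ψ n x‖ ^ 2 ≤ ε) :
    ∃ φ ∈ domainD a R, IsMinOn (energyG a b R) (domainD a R) φ ∧
      Tendsto (fun n => eLpNorm (ψ n - φ) 2 (volume.restrict (strip R))) atTop (𝓝 0) ∧
      ∀ j, Tendsto (fun n => eLpNorm (covDerivSmooth a j (ψ n) - covDeriv a (strip R) j φ) 2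
        (volume.restrict (strip R))) atTop (𝓝 0) := by
  set μ := volume.restrict (strip R) with hμ
  have cψ : ∀ ε > 0, ∃ n₀, ∀ m ≥ n₀, ∀ n ≥ n₀, ∫ x, ‖ψ m x - ψ n x‖ ^ 2 ∂μ ≤ ε := by
    intro ε hε
    obtain ⟨n₀, h⟩ := hc ε hε
    refine ⟨n₀, fun m hm n hn => ?_⟩
    rw [hμ, ((hT m).sub (hT n)).setIntegral_eq fun x hx => by
      have := image_eq_zero_of_notMem_tsupport hx
      simp [this]]
    exact h m hm n hn
  have cD : ∀ j, ∀ ε > 0, ∃ n₀, ∀ m ≥ n₀, ∀ n ≥ n₀,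
      ∫ x, ‖covDerivSmooth a j (ψ m) x - covDerivSmooth a j (ψ n) x‖ ^ 2 ∂μ ≤ ε := by
    intro j ε hε
    obtain ⟨n₁, h1⟩ := hc (b * ε / 2) (by positivity)
    obtain ⟨n₂, h2⟩ := eventually_atTop.1
      (hE.eventually_le_const (show e₀ < e₀ + b * ε / 8 by linarith [mul_pos hb hε]))
    refine ⟨max n₁ n₂, fun m hm n hn => ?_⟩
    have hd := (hT m).sub (hT n)
    have k1 := h1 m ((le_max_left _ _).trans hm) n ((le_max_left _ _).trans hn)
    have k2 := h2 m ((le_max_right _ _).trans hm)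
    have k3 := h2 n ((le_max_right _ _).trans hn)
    have k4 := (hT m).energyS_midpoint_le (hT n) a (b := b)
    have k5 := hlow _ (((hT m).add (hT n)).const_mul (1 / 2))
    -- The midpoint has energy at least `e₀` and both endpoints at most `e₀ + bε/8`, so the midpoint
    -- inequality gives `(b/4) ∫ gradSq ≤ bε/8 + (1/4)(bε/2)`.
    have k6 : b * (∫ x, gradSq a (fun x => ψ m x - ψ n x) x) ≤ b * ε := by linarith
    have k7 := le_of_mul_le_mul_left k6 hb
    simp only [← (hT m).covDerivSmooth_sub (hT n)]
    rw [hμ, hd.setIntegral_eq fun x hx => by simp [covDerivSmooth_eq_zero hx]]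
    refine le_trans (integral_mono (hd.integrable
      ((hd.continuous_covDerivSmooth a j).norm.pow 2) fun x hx => by
        simp [covDerivSmooth_eq_zero hx]) (hd.integrable_gradSq a) fun x => ?_) k7
    exact Finset.single_le_sum (f := fun j => ‖covDerivSmooth a j (fun x => ψ m x - ψ n x) x‖ ^ 2)
      (fun i _ => by positivity) (Finset.mem_univ j)
  obtain ⟨φ, hφ, lφ⟩ := exists_limit_of_integral_cauchy (p := 2) two_ne_zero
    (fun n => (hT n).memLp _ μ) cψ
  choose w hw lw using fun j => exists_limit_of_integral_cauchy (p := 2) two_ne_zero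
    (fun n => (hT n).memLp_covDerivSmooth a j _ μ) (cD j)
  obtain ⟨hdom, hae⟩ := mem_domainD_of_tendsto hT hφ hw lφ lw
  have lw' : ∀ j, Tendsto (fun n => eLpNorm (covDerivSmooth a j (ψ n)
      - covDeriv a (strip R) j φ) 2 μ) atTop (𝓝 0) := by
    intro j
    refine (lw j).congr fun n => eLpNorm_congr_ae ?_
    filter_upwards [hae j] with x hx
    simp [hx]
  refine ⟨φ, hdom, ?_, lφ, lw'⟩
  have hEφ : energyG a b R φ = e₀ :=
    tendsto_nhds_unique (tendsto_energyS hT hdom.1 lφ lw') hE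
  intro v hv
  -- The boundary condition supplies test functions approximating `v`; by continuity of the energy,
  -- `e₀` is a lower bound on all of `𝓓_R`.
  obtain ⟨hv1, θ, hθ, hθ1, hθ2⟩ := hv
  change energyG a b R φ ≤ energyG a b R v
  rw [hEφ]
  exact ge_of_tendsto' (tendsto_energyS hθ hv1 hθ1 hθ2) fun n => hlow _ (hθ n)

end MagneticStep

end

/-! ### The minimizer and its estimates -/

open MagneticStep in
theorem proposition3p4 :
    ∃ C : ℝ, 0 < C ∧
      ∀ a b : ℝ, -1 ≤ a → a < 0 → 1 / |a| ≤ b → b < 1 / beta a →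
        ∀ R : ℝ, 0 < R →
          ∃ φ ∈ domainD a R,
            IsMinOn (energyG a b R) (domainD a R) φ ∧
            energyG a b R φ = groundEnergy a b R ∧
            eLpNorm φ ∞ (volume.restrict (strip R)) ≤ 1 ∧
            ∫⁻ x in strip R ∩ {x | 4 ≤ |x.2|},
                ENNReal.ofReal (|x.2| / (Real.log |x.2|) ^ 2 *
                  (covGradSq a (strip R) φ x + ‖φ x‖ ^ 2))
              ≤ ENNReal.ofReal (C * b * R) ∧
            ∫⁻ x in strip R ∩ {x | 4 ≤ |x.2|},
                ENNReal.ofReal (|x.2| ^ 3 / (Real.log |x.2|) ^ 2 * ‖φ x‖ ^ 4)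
              ≤ ENNReal.ofReal (C * b ^ 2 * R) ∧
            ∫⁻ x in strip R,
                ENNReal.ofReal (b * covGradSq a (strip R) φ x + ‖φ x‖ ^ 2)
              ≤ ENNReal.ofReal (C * b * R) := by
  obtain ⟨C, hC, H⟩ := exists_near_min_weighted_bounds
  refine ⟨C, hC, fun a b ha ha' hab _ R hR => ?_⟩
  have hb : 1 ≤ b := by
    refine le_trans ?_ hab
    rw [abs_of_neg ha', le_div_iff₀ (by linarith)]
    linarith
  have hb0 : 0 < b := by linarith
  have hB : 0 < C * b * R := by positivity
  -- `ψ m` is minimal in the box `|x₂| ≤ m` up to `1/(m + 1)`. Every test function lies in all large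
  -- boxes, so this is a minimizing sequence on the whole strip.
  choose ψ hψ h1 hmin hw2 hw4 hen using fun m : ℕ =>
    H a b R ha ha' hab hR m (Nat.cast_nonneg m) (1 / ((m : ℝ) + 1)) (by positivity)
  have hT : ∀ n, IsTest (strip R) (ψ n) := fun n => (hψ n).test
  have hG0 : ∀ n, 0 ≤ ∫ x, gradSq a (ψ n) x := fun n => integral_nonneg (gradSq_nonneg a _)
  have hN0 : ∀ n, 0 ≤ ∫ x, ‖ψ n x‖ ^ 2 := fun n => integral_nonneg fun x => by positivity
  have hG : ∀ n, ∫ x, gradSq a (ψ n) x ≤ C * b * R := fun n => by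
    nlinarith [hen n, hG0 n, hN0 n]
  have hN : ∀ n, ∫ x, ‖ψ n x‖ ^ 2 ≤ C * b * R := fun n => by
    nlinarith [hen n, hG0 n, hN0 n]
  -- Unlike the bound by the area of the box, this one is uniform in the box: the energy is at least
  -- `-∫ |ψ|²`.
  have hElow : ∀ n, -(C * b * R) ≤ energyS a b (ψ n) := fun n => by
    rw [(hT n).energyS_eq]
    have h4 : 0 ≤ ∫ x, ‖ψ n x‖ ^ 4 := integral_nonneg fun x => by positivity
    nlinarith [hG0 n, hN n]
  have hε : Tendsto (fun n : ℕ => 1 / ((n : ℝ) + 1)) atTop (𝓝 0) :=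
    tendsto_one_div_add_atTop_nhds_zero_nat
  have hev : ∀ v, IsTest (strip R) v →
      ∀ᶠ n : ℕ in atTop, energyS a b (ψ n) ≤ energyS a b v + 1 / ((n : ℝ) + 1) := by
    intro v hv
    obtain ⟨m₀, hm₀⟩ := hv.exists_boxTest
    filter_upwards [eventually_ge_atTop m₀] with n hn using hmin n v (hm₀ n hn)
  have hbd : ∀ v, IsTest (strip R) v → -(C * b * R) ≤ energyS a b v := by
    intro v hv
    have := ge_of_tendsto (tendsto_const_nhds.add hε) <| (hev v hv).mono fun n hn =>
      (hElow n).trans hn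
    simpa using this
  set e₀ := sInf (energyS a b '' {v | IsTest (strip R) v}) with he₀
  have hbelow : BddBelow (energyS a b '' {v | IsTest (strip R) v}) :=
    ⟨-(C * b * R), by rintro _ ⟨v, hv, rfl⟩; exact hbd v hv⟩
  have hlow : ∀ v, IsTest (strip R) v → e₀ ≤ energyS a b v := fun v hv =>
    csInf_le hbelow ⟨v, hv, rfl⟩
  have hE : Tendsto (fun n => energyS a b (ψ n)) atTop (𝓝 e₀) := by
    refine tendsto_order.2 ⟨fun t ht => .of_forall fun n => ht.trans_le (hlow _ (hT n)),
      fun t ht => ?_⟩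
    obtain ⟨_, ⟨v, hv, rfl⟩, hvt⟩ := exists_lt_of_csInf_lt
      (Set.Nonempty.image _ ⟨ψ 0, hT 0⟩) ht
    filter_upwards [hev v hv, hε.eventually_lt_const (sub_pos.2 hvt)] with n hn hn'
    linarith
  -- The weight `|x₂| / ln²|x₂|` tends to infinity, so the weighted bound prevents mass from
  -- escaping along the strip.
  obtain ⟨s, hs, hc⟩ := exists_subseq_cauchy ha ha' hT h1 hG hN fun ε hε => by
    obtain ⟨L, hL⟩ := exists_tail_le (a := a) hB hε
    exact ⟨L, fun N hN n => hL N hN _ _ (hT n) (hw2 n)⟩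
  obtain ⟨φ, hφ, hφmin, hφ2, hφD⟩ := exists_minimizer_of_cauchy hb0 (fun n => hT (s n)) hlow
    (hE.comp hs.tendsto_atTop) hc
  -- Only almost everywhere convergence along some indices is needed, as all bounds hold for every
  -- member of the sequence.
  obtain ⟨t, ht⟩ := exists_subseq_tendsto_ae
    (fun n => (hT (s n)).continuous.aestronglyMeasurable)
    (fun n => ((hT (s n)).continuous_covDerivSmooth a 0).aestronglyMeasurable)
    (fun n => ((hT (s n)).continuous_covDerivSmooth a 1).aestronglyMeasurable)
    hφ.1.memLp.1 (hφ.1.memLp_covDeriv 0).1 (hφ.1.memLp_covDeriv 1).1 hφ2 (hφD 0) (hφD 1)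
  have hlim : ∀ᵐ x ∂volume.restrict (strip R),
      Tendsto (fun n => ‖ψ (s (t n)) x‖) atTop (𝓝 ‖φ x‖) ∧
      Tendsto (fun n => gradSq a (ψ (s (t n))) x) atTop (𝓝 (covGradSq a (strip R) φ x)) := by
    filter_upwards [ht] with x ⟨x0, x1, x2⟩
    refine ⟨x0.norm, ?_⟩
    simp only [gradSq_eq, covGradSq, Fin.sum_univ_two]
    exact (x1.norm.pow 2).add (x2.norm.pow 2)
  have hfar := ae_mono (Measure.restrict_mono_set volume
    (inter_subset_left : strip R ∩ {x : ℝ × ℝ | 4 ≤ |x.2|} ⊆ strip R)) hlim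
  have mψ : ∀ n, Measurable fun x => ‖ψ n x‖ := fun n => (hT n).continuous.norm.measurable
  have mG : ∀ n, Measurable (gradSq a (ψ n)) := fun n =>
    ((hT n).continuous_gradSq a).measurable
  have mabs : Measurable fun x : ℝ × ℝ => |x.2| := continuous_snd.abs.measurable
  refine ⟨φ, hφ, hφmin, ?_, ?_, ?_, ?_, ?_⟩
  · have : IsLeast (energyG a b R '' domainD a R) (energyG a b R φ) :=
      ⟨⟨φ, hφ, rfl⟩, by rintro _ ⟨v, hv, rfl⟩; exact hφmin hv⟩
    exact this.csInf_eq.symm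
  · rw [eLpNorm_exponent_top, ← ENNReal.ofReal_one]
    refine eLpNormEssSup_le_of_ae_bound ?_
    filter_upwards [hlim] with x hx using le_of_tendsto hx.1 (.of_forall fun n => h1 _ x)
  · refine lintegral_ofReal_le_of_tendsto (f := fun n x => |x.2| / Real.log |x.2| ^ 2 *
      (gradSq a (ψ (s (t n))) x + ‖ψ (s (t n)) x‖ ^ 2)) (fun n => ?_) ?_ fun n =>
        (lintegral_mono_set inter_subset_right).trans (hw2 (s (t n)))
    · exact (mabs.div ((Real.measurable_log.comp mabs).pow_const 2)).mul
        ((mG _).add ((mψ _).pow_const 2))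
    · filter_upwards [hfar] with x hx using (hx.2.add (hx.1.pow 2)).const_mul _
  · refine lintegral_ofReal_le_of_tendsto (f := fun n x => |x.2| ^ 3 / Real.log |x.2| ^ 2 *
      ‖ψ (s (t n)) x‖ ^ 4) (fun n => ?_) ?_ fun n =>
        (lintegral_mono_set inter_subset_right).trans (hw4 (s (t n)))
    · exact ((mabs.pow_const 3).div ((Real.measurable_log.comp mabs).pow_const 2)).mul
        ((mψ _).pow_const 4)
    · filter_upwards [hfar] with x hx using (hx.1.pow 4).const_mul _
  · refine lintegral_ofReal_le_of_tendsto (f := fun n x => b * gradSq a (ψ (s (t n))) x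
      + ‖ψ (s (t n)) x‖ ^ 2) (fun n => ((mG _).const_mul b).add ((mψ _).pow_const 2)) ?_
        fun n => ?_
    · filter_upwards [hlim] with x hx using (hx.2.const_mul b).add (hx.1.pow 2)
    · have i1 := ((hT (s (t n))).integrable_gradSq a).const_mul b
      have i2 := (hT (s (t n))).integrable_normSq
      refine setLIntegral_ofReal_le (measurableSet_strip R) (i1.add i2) (fun x => ?_)
        (fun x _ => le_rfl) ?_
      · exact add_nonneg (mul_nonneg hb0.le (gradSq_nonneg a _ x)) (by positivity)
      · refine le_of_eq_of_le ?_ (hen (s (t n)))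
        rw [← integral_const_mul]
        exact integral_add i1 i2
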